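/- Let $R$ be a commutative ring of characteristic $0$ (for instance $\mathbb{Z}$, $\mathbb{Q}$ or $\mathbb{C}$), let $\mathrm{MM}(n)$ be the minimum number of operations $+,-,\times$ of an arithmetic circuit over $R$ that multiplies two $n\times n$ matrices, and let $\omega=\inf\{\tau\in\mathbb{R} : \mathrm{MM}(n)=O(n^\tau)\}$. Algorithms are deterministic word RAM algorithms with words of $O(\log n)$ bits. The Monochromatic All-Edges Triangle problem is: given an edge-colored simple graph on $n$ nodes, with colors from $\{0,\dots,n^2-1\}$, decide for each edge whether it is part of a triangle all of whose three edges have the same color. The Monochromatic All-Edges Triangle hypothesis states that, for every $\varepsilon>0$, this problem cannot be solved in time $O(n^{\frac{3+\omega}{2}-\varepsilon})$. Assume that $\omega>2$ and that the Monochromatic All-Edges Triangle hypothesis holds. Then, for every constant $c>0$ and every $\varepsilon>0$, there is no algorithm that computes the Boolean product of any two sparsely represented Boolean $n\times n$ matrices with at most $c\cdot n^{\frac{1+\omega}{2}}$ nonzero entries in total in time $O(n^{\omega-\varepsilon})$. -/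

import Mathlib

open Filter Asymptotics

noncomputable section

namespace FineGrained

/-! ### The word RAM

Memory is an array of cells indexed by addresses. A program is a fixed piece of code with
structured control flow, and every arithmetic or logical operation, memory access, test and
control transfer costs one step. (Programs with jumps simulate and are simulated by such
programs with a constant-factor overhead.) Words are the numbers below `W`: a run in which some
address, operand or intermediate result would be `W` or more is not a legal run, so a program can
not profit from large numbers. Word sizes are only fixed up to a constant factor, see
`Problem.SolvableInTime`, so this is equivalent to arithmetic modulo the word length. -/

/-- Memory contents. -/
abbrev Mem : Type := ℕ → ℕ

/-- The unit-cost operations on words; subtraction is truncated, division rounds down, and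
comparisons return `1` or `0`. -/
inductive BinOp : Type
  | add | sub | mul | div | mod | land | lor | xor | shl | shr | lt | eq

def BinOp.eval : BinOp → ℕ → ℕ → ℕ
  | .add, x, y => x + y
  | .sub, x, y => x - y
  | .mul, x, y => x * y
  | .div, x, y => x / y
  | .mod, x, y => x % y
  | .land, x, y => x &&& y
  | .lor, x, y => x ||| y
  | .xor, x, y => x ^^^ y
  | .shl, x, y => x <<< y
  | .shr, x, y => x >>> y
  | .lt, x, y => if x < y then 1 else 0
  | .eq, x, y => if x = y then 1 else 0

/-- Expressions: constants of the program, contents of the memory cell whose address is the value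
of an expression, and operations. -/
inductive Expr : Type
  | lit (c : ℕ)
  | load (a : Expr)
  | bin (o : BinOp) (a b : Expr)

/-- The value of an expression. -/
def Expr.eval (m : Mem) : Expr → ℕ
  | .lit c => c
  | .load a => m (a.eval m)
  | .bin o a b => o.eval (a.eval m) (b.eval m)

/-- The number of steps needed to evaluate an expression. -/
def Expr.cost : Expr → ℕ
  | .lit _ => 1
  | .load a => a.cost + 1
  | .bin _ a b => a.cost + b.cost + 1

/-- All values that occur while the expression is evaluated are words, i.e. are below `W`. -/
def Expr.Fits (W : ℕ) (m : Mem) : Expr → Prop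
  | .lit c => c < W
  | .load a => a.Fits W m ∧ m (a.eval m) < W
  | .bin o a b => a.Fits W m ∧ b.Fits W m ∧ o.eval (a.eval m) (b.eval m) < W

/-- Programs. `store a e` writes the value of `e` to the cell whose address is the value of `a`;
conditions are true when they are nonzero. -/
inductive Program : Type
  | nop
  | store (a e : Expr)
  | seq (p q : Program)
  | ite (c : Expr) (p q : Program)
  | loop (c : Expr) (p : Program)

/-- `Exec W p m t m'`: on the RAM whose words are the numbers below `W`, the program `p`, started
with memory `m`, halts after exactly `t` steps with memory `m'`. -/
inductive Exec (W : ℕ) : Program → Mem → ℕ → Mem → Prop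
  | nop (m : Mem) : Exec W .nop m 1 m
  | store (a e : Expr) (m : Mem) (ha : a.Fits W m) (he : e.Fits W m) :
      Exec W (.store a e) m (a.cost + e.cost + 1) (Function.update m (a.eval m) (e.eval m))
  | seq {p q : Program} {m m₁ m₂ : Mem} {t₁ t₂ : ℕ}
      (hp : Exec W p m t₁ m₁) (hq : Exec W q m₁ t₂ m₂) : Exec W (.seq p q) m (t₁ + t₂) m₂
  | iteTrue {c : Expr} {p q : Program} {m m' : Mem} {t : ℕ} (hc : c.Fits W m)
      (h : c.eval m ≠ 0) (hp : Exec W p m t m') : Exec W (.ite c p q) m (c.cost + 1 + t) m'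
  | iteFalse {c : Expr} {p q : Program} {m m' : Mem} {t : ℕ} (hc : c.Fits W m)
      (h : c.eval m = 0) (hq : Exec W q m t m') : Exec W (.ite c p q) m (c.cost + 1 + t) m'
  | loopStop {c : Expr} {p : Program} {m : Mem} (hc : c.Fits W m) (h : c.eval m = 0) :
      Exec W (.loop c p) m (c.cost + 1) m
  | loopStep {c : Expr} {p : Program} {m m₁ m₂ : Mem} {t₁ t₂ : ℕ} (hc : c.Fits W m)
      (h : c.eval m ≠ 0) (hp : Exec W p m t₁ m₁) (hl : Exec W (.loop c p) m₁ t₂ m₂) :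
      Exec W (.loop c p) m (c.cost + 1 + t₁ + t₂) m₂

/-- The initial memory: the input words in the cells `0, 1, 2, …`, all other cells zero. -/
def initMem (input : List ℕ) : Mem := fun a => input.getD a 0

/-- A computational problem: its instances, the size parameter in which running times are
measured, the encoding of instances as sequences of words, and the condition that a final memory
holds a correct answer. -/
structure Problem where
  Inst : Type
  size : Inst → ℕ
  input : Inst → List ℕ
  Correct : Inst → Mem → Prop

/-- The problem is solved by a deterministic word RAM algorithm in time `O(f(n))`, where `n` is the
size parameter and the word size is `k * (⌊log₂ n⌋ + 1)` bits for a constant `k` that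
depends on the algorithm only. -/
def Problem.SolvableInTime (P : Problem) (f : ℕ → ℝ) : Prop :=
  ∃ (p : Program) (k : ℕ) (T : ℕ → ℕ),
    ((fun n => (T n : ℝ)) =O[atTop] f) ∧
    ∀ x : P.Inst, ∃ (t : ℕ) (m : Mem),
      t ≤ T (P.size x) ∧
      Exec (2 ^ (k * (Nat.log 2 (P.size x) + 1))) p (initMem (P.input x)) t m ∧
      P.Correct x m

/-! ### The exponent of matrix multiplication -/

/-- The polynomials available without further operations once the list `l` has been computed:
members of `l`, the input variables, and constants. -/
def Available {R σ : Type*} [CommRing R] (l : List (MvPolynomial σ R))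
    (p : MvPolynomial σ R) : Prop :=
  p ∈ l ∨ (∃ i, p = MvPolynomial.X i) ∨ ∃ c, p = MvPolynomial.C c

/-- `l` lists (last operation first) the polynomials computed at the gates of a division-free
arithmetic circuit: each is the sum, difference or product of two polynomials that are available
before it. The number of arithmetic operations is the length of `l`. -/
def IsCircuit {R σ : Type*} [CommRing R] : List (MvPolynomial σ R) → Prop
  | [] => True
  | p :: l => (∃ a b, Available l a ∧ Available l b ∧ (p = a + b ∨ p = a - b ∨ p = a * b)) ∧
      IsCircuit l

/-- The minimum number of arithmetic operations of an arithmetic circuit over `R` that multiplies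
an `x × y` matrix with a `y × z` matrix, the entries of both being indeterminates. -/
def MM (R : Type*) [CommRing R] (x y z : ℕ) : ℕ :=
  sInf {s | ∃ l : List (MvPolynomial ((Fin x × Fin y) ⊕ (Fin y × Fin z)) R),
    IsCircuit l ∧ l.length = s ∧
    ∀ i k, Available l (∑ j, MvPolynomial.X (.inl (i, j)) * MvPolynomial.X (.inr (j, k)))}

/-- The exponent `ω` of square matrix multiplication over `R`. -/
def matMulExponent (R : Type*) [CommRing R] : ℝ :=
  sInf {τ : ℝ | (fun n : ℕ => (MM R n n n : ℝ)) =O[atTop] fun n : ℕ => (n : ℝ) ^ τ}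

/-! ### Input-sparse Boolean matrix multiplication -/

/-- The Boolean matrix product. -/
def boolMul {n : ℕ} (A B : Matrix (Fin n) (Fin n) Bool) : Matrix (Fin n) (Fin n) Bool :=
  fun i j => decide (∃ k, A i k = true ∧ B k j = true)

/-- `l` is a sparse representation of the Boolean matrix `A`: a list, in any order and without
repetitions, of the positions of its nonzero entries. -/
def IsSparseRep {n : ℕ} (l : List (Fin n × Fin n)) (A : Matrix (Fin n) (Fin n) Bool) : Prop :=
  l.Nodup ∧ ∀ i j, (i, j) ∈ l ↔ A i j = true

/-- Two sparsely represented Boolean `n × n` matrices with at most `c * n ^ τ` nonzero entries in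
total. -/
structure SparseBMMInst (c τ : ℝ) where
  n : ℕ
  A : Matrix (Fin n) (Fin n) Bool
  B : Matrix (Fin n) (Fin n) Bool
  listA : List (Fin n × Fin n)
  listB : List (Fin n × Fin n)
  repA : IsSparseRep listA A
  repB : IsSparseRep listB B
  sparse : ((listA.length + listB.length : ℕ) : ℝ) ≤ c * (n : ℝ) ^ τ

/-- A list of positions, written as a sequence of words. -/
def encodePositions {n : ℕ} (l : List (Fin n × Fin n)) : List ℕ :=
  l.flatMap fun q => [(q.1 : ℕ), (q.2 : ℕ)]

/-- Multiply two Boolean `n × n` matrices with at most `c * n ^ τ` nonzero entries. The product is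
to be written as an `n × n` table in row-major order. -/
def sparseBMM (c τ : ℝ) : Problem where
  Inst := SparseBMMInst c τ
  size x := x.n
  input x := [x.n, x.listA.length, x.listB.length] ++
    encodePositions x.listA ++ encodePositions x.listB
  Correct x m := ∀ i j : Fin x.n, m ((i : ℕ) * x.n + j) = if boolMul x.A x.B i j then 1 else 0

/-! ### Monochromatic All-Edges Triangle -/

/-- An edge-colored graph on `n` nodes. As there are fewer than `n ^ 2` edges when `n ≥ 1`, the
names `0, …, n ^ 2 - 1` suffice for the colors. Only the values of `color` at edges matter. -/
structure ColoredGraph where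
  n : ℕ
  graph : SimpleGraph (Fin n)
  color : Sym2 (Fin n) → Fin (n ^ 2)

/-- The edge `{i, j}` is part of a triangle all of whose edges have the same color. -/
def ColoredGraph.InMonoTriangle (G : ColoredGraph) (i j : Fin G.n) : Prop :=
  ∃ k, G.graph.Adj i j ∧ G.graph.Adj i k ∧ G.graph.Adj j k ∧
    G.color s(i, k) = G.color s(i, j) ∧ G.color s(j, k) = G.color s(i, j)

open Classical in
/-- The row-major adjacency table, with entry `0` for a non-edge and `color + 1` for an edge. -/
def ColoredGraph.table (G : ColoredGraph) : List ℕ :=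
  (List.finRange G.n).flatMap fun i => (List.finRange G.n).map fun j =>
    if G.graph.Adj i j then (G.color s(i, j) : ℕ) + 1 else 0

open Classical in
/-- Given an edge-colored graph, decide for each edge whether it is part of a monochromatic
triangle. -/
def monoAllEdgesTriangle : Problem where
  Inst := ColoredGraph
  size G := G.n
  input G := G.n :: G.table
  Correct G m := ∀ i j : Fin G.n, G.graph.Adj i j →
    m ((i : ℕ) * G.n + j) = if G.InMonoTriangle i j then 1 else 0

/-- The Monochromatic All-Edges Triangle hypothesis, for a given value `ω` of the matrix
multiplication exponent. -/
def MonoAllEdgesTriangleHypothesis (ω : ℝ) : Prop :=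
  ∀ ε : ℝ, 0 < ε →
    ¬ monoAllEdgesTriangle.SolvableInTime (fun n => (n : ℝ) ^ ((3 + ω) / 2 - ε))

end FineGrained

end

/-! The proof is a reduction: an algorithm for sparse Boolean products running in time `n ^ (ω - ε)`
yields an algorithm for monochromatic triangles that is polynomially faster than `n ^ ((3 + ω) /
2)`.

Fix a threshold `Δ`, about `n ^ r` with `r` slightly below `(ω - 1) / 2`. Triangles of color `c`
with a corner of `c`-degree at most `Δ` are found by brute force: for every edge at such a corner,
scan the at most `Δ` neighbours of the corner in that color. This takes time `O(Δ n²)` (`wp_low`).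
In every other monochromatic triangle all three corners have degree greater than `Δ` in the color
`c`. The degrees summed over all colors are at most `n²`, so there are at most `n² / Δ` pairs
(color, high node). These pairs are packed into bins. A bin is a `3n × 3n` Boolean matrix `M` whose
rows and columns are labelled by pairs of a color and a node, with an entry at `((c, u), (c, w))`
when `uw` is an edge of color `c` between high nodes and `w` has been assigned to this bin as middle
node. Entry `((c, u), (c, v))` of `M Mᵀ` is nonzero exactly when `u` and `v` share such a middle
node; it remains to check that `uv` has color `c`. A bin is closed when it has `2n` labels or `Δn`
entries. A potential argument bounds the number of closed bins by `2n / Δ`, while no bin exceeds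
`3n` labels or `Δn + n` entries (`wp_item`, `wp_bins`). Since `1 + r < (1 + ω) / 2`, the two factors
meet the sparsity bound for large `n` (`exists_capacity`). The products cost `n ^ (1 - r) * n ^ (ω -
ε)`, and with `r` close to `(ω - 1) / 2` both phases stay below the hypothesised bound
(`reductionTime_isBigO`). The bound `ω ≤ 3` from the naive circuit keeps the choice of `r` within
`[0, 1]`.

The algorithm must be an actual word RAM program. It is written in a small structured language whose
compilation costs a constant factor in time and keeps all numbers polynomial in `n` (`HExec.comp`),
and is verified with weakest preconditions that also count steps. The given algorithm is run as a
subroutine on relocated memory (`exec_reloc`); as untouched cells are zero, every bin receives a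
fresh memory at no cost. -/

namespace FineGrained

/-! ### Polynomially bounded expressions -/

/-- A polynomial pairing function. -/
def pr (a b : ℕ) : ℕ := (a + b) * (a + b) + a

/-- With `σ = a + b`, the value `σ² + a` lies in the interval from `σ²` up to but excluding `(σ +
1)²`, so it determines `σ` and then `a`. -/
theorem pr_inj {a b c d : ℕ} : pr a b = pr c d ↔ a = c ∧ b = d := by
  constructor
  · intro h
    unfold pr at h
    have hs : a + b = c + d := by
      rcases lt_trichotomy (a + b) (c + d) with h1 | h1 | h1
      · nlinarith
      · exact h1
      · nlinarith
    rw [hs] at h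
    omega
  · rintro ⟨rfl, rfl⟩; rfl

def addE (a b : Expr) : Expr := .bin .add a b
def mulE (a b : Expr) : Expr := .bin .mul a b
def prE (a b : Expr) : Expr := addE (mulE (addE a b) (addE a b)) a
/-- The address of entry `i` of the region `t`; cell `0` holds the start of the free memory. -/
def cellE (t i : Expr) : Expr := addE (.load (.lit 0)) (prE t i)

@[simp] theorem eval_addE (m : Mem) (a b : Expr) : (addE a b).eval m = a.eval m + b.eval m := rfl
@[simp] theorem eval_mulE (m : Mem) (a b : Expr) : (mulE a b).eval m = a.eval m * b.eval m := rfl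
@[simp] theorem eval_prE (m : Mem) (a b : Expr) :
    (prE a b).eval m = pr (a.eval m) (b.eval m) := rfl
@[simp] theorem eval_cellE (m : Mem) (t i : Expr) :
    (cellE t i).eval m = m 0 + pr (t.eval m) (i.eval m) := rfl
@[simp] theorem eval_lit (m : Mem) (c : ℕ) : (Expr.lit c).eval m = c := rfl
@[simp] theorem eval_load (m : Mem) (a : Expr) : (Expr.load a).eval m = m (a.eval m) := rfl

/-- A measure of an expression that bounds its cost and the growth of its value. -/
def Expr.sz : Expr → ℕ
  | .lit c => c + 1
  | .load a => a.sz + 1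
  | .bin _ a b => a.sz + b.sz + 1

theorem Expr.cost_le_sz (e : Expr) : e.cost ≤ e.sz := by
  induction e with
  | lit c => simp [cost, sz]
  | load a ih => simp [cost, sz, ih]
  | bin o a b iha ihb => simp only [cost, sz]; omega

/-- Expressions whose operations are additions, subtractions, multiplications and comparisons. -/
def Expr.Simple : Expr → Prop
  | .lit _ => True
  | .load a => a.Simple
  | .bin o a b => (o = .add ∨ o = .sub ∨ o = .mul ∨ o = .lt ∨ o = .eq) ∧ a.Simple ∧ b.Simple

theorem simple_addE {a b : Expr} (ha : a.Simple) (hb : b.Simple) : (addE a b).Simple :=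
  ⟨.inl rfl, ha, hb⟩
theorem simple_mulE {a b : Expr} (ha : a.Simple) (hb : b.Simple) : (mulE a b).Simple :=
  ⟨.inr (.inr (.inl rfl)), ha, hb⟩
theorem simple_prE {a b : Expr} (ha : a.Simple) (hb : b.Simple) : (prE a b).Simple :=
  simple_addE (simple_mulE (simple_addE ha hb) (simple_addE ha hb)) ha
theorem simple_cellE {a b : Expr} (ha : a.Simple) (hb : b.Simple) : (cellE a b).Simple :=
  simple_addE (a := .load (.lit 0)) trivial (simple_prE ha hb)

/-- The measure `sz` adds up over subexpressions, so the product of the bounds for two operands is a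
power of `B` again. The extra `1` per operation provides a factor `B ≥ 2`, which covers the sum of
two operands and the comparison values. Shifts are not simple, as they would break any polynomial
bound. -/
theorem Expr.Simple.eval_le {B : ℕ} (hB : 2 ≤ B) {m : Mem} (hm : ∀ a, m a ≤ B) {e : Expr}
    (he : e.Simple) : e.eval m ≤ B ^ e.sz := by
  have one_le : ∀ k, 1 ≤ B ^ k := fun k => Nat.one_le_pow _ _ (by omega)
  induction e with
  | lit c =>
    calc c ≤ 2 ^ c := Nat.lt_two_pow_self.le
      _ ≤ B ^ c := Nat.pow_le_pow_left hB c
      _ ≤ B ^ (c + 1) := Nat.pow_le_pow_right (by omega) (by omega)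
  | load a ih =>
    refine (hm _).trans ?_
    exact Nat.le_self_pow (by simp [sz]) B
  | bin o a b iha ihb =>
    obtain ⟨ho, ha, hb⟩ := he
    have h1 := iha ha
    have h2 := ihb hb
    have e1 : B ^ (Expr.bin o a b).sz = B ^ a.sz * B ^ b.sz * B := by
      simp only [sz, pow_succ, pow_add]
    have p1 := one_le a.sz
    have p2 := one_le b.sz
    have hmul : B ^ a.sz * B ^ b.sz ≤ B ^ a.sz * B ^ b.sz * B := Nat.le_mul_of_pos_right _ (by omega)
    have h3 : B ^ a.sz ≤ B ^ a.sz * B ^ b.sz := Nat.le_mul_of_pos_right _ (by omega)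
    have h4 : B ^ b.sz ≤ B ^ a.sz * B ^ b.sz := Nat.le_mul_of_pos_left _ (by omega)
    have h5 : B ^ a.sz * B ^ b.sz * 2 ≤ B ^ a.sz * B ^ b.sz * B := Nat.mul_le_mul_left _ hB
    rw [e1]
    rcases ho with rfl | rfl | rfl | rfl | rfl <;> simp only [eval, BinOp.eval]
    · omega
    · omega
    · exact (Nat.mul_le_mul h1 h2).trans hmul
    · split_ifs <;> omega
    · split_ifs <;> omega

theorem Expr.Simple.fits {B W : ℕ} (hB : 2 ≤ B) {m : Mem} (hm : ∀ a, m a ≤ B) {e : Expr}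
    (he : e.Simple) (hW : B ^ e.sz < W) : e.Fits W m := by
  induction e with
  | lit c => exact lt_of_le_of_lt (Expr.Simple.eval_le hB hm he) hW
  | load a ih =>
    refine ⟨ih he (lt_of_le_of_lt (Nat.pow_le_pow_right (by omega) (by simp [sz])) hW), ?_⟩
    exact lt_of_le_of_lt (Expr.Simple.eval_le (e := .load a) hB hm he) hW
  | bin o a b iha ihb =>
    refine ⟨iha he.2.1 (lt_of_le_of_lt (Nat.pow_le_pow_right (by omega) ?_) hW),
      ihb he.2.2 (lt_of_le_of_lt (Nat.pow_le_pow_right (by omega) ?_) hW), 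
      lt_of_le_of_lt (Expr.Simple.eval_le (e := .bin o a b) hB hm he) hW⟩ <;>
    simp only [sz] <;> omega

/-! ### Running a program on a relocated memory -/

theorem Expr.eval_lt_of_fits {W : ℕ} {m : Mem} {e : Expr} (h : e.Fits W m) : e.eval m < W := by
  cases e with
  | lit c => exact h
  | load a => exact h.2
  | bin o a b => exact h.2.2

/-- Replace every access to cell `a` by an access to entry `a` of the region `T`. -/
def Expr.reloc (e T : Expr) : Expr :=
  match e with
  | .lit c => .lit c
  | .load a => .load (cellE T (a.reloc T))
  | .bin o a b => .bin o (a.reloc T) (b.reloc T)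

def Program.reloc (T : Expr) : Program → Program
  | .nop => .nop
  | .store a e => .store (cellE T (a.reloc T)) (e.reloc T)
  | .seq p q => .seq (p.reloc T) (q.reloc T)
  | .ite c p q => .ite (c.reloc T) (p.reloc T) (q.reloc T)
  | .loop c p => .loop (c.reloc T) (p.reloc T)

/-- A bound for the number of steps of a primitive statement or test of a program. -/
def Program.K : Program → ℕ
  | .nop => 1
  | .store a e => a.cost + e.cost + 1
  | .seq p q => p.K + q.K
  | .ite c p q => c.cost + 1 + p.K + q.K
  | .loop c p => c.cost + 1 + p.K

theorem Expr.reloc_eval {T : Expr} {m mA : Mem}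
    (hm : ∀ a, m (m 0 + pr (T.eval m) a) = mA a) (e : Expr) :
    (e.reloc T).eval m = e.eval mA := by
  induction e with
  | lit c => rfl
  | load a ih => simp only [reloc, eval_load, eval_cellE, ih, hm]
  | bin o a b iha ihb => simp only [reloc, eval, iha, ihb]

/-- The address is a quadratic polynomial in numbers of size at most `B + 2`; the exponent `10` is a
crude bound that also covers all intermediate results, already for `B = 2`. -/
theorem cellE_fits {B W : ℕ} (hB : 2 ≤ B) (hW : B ^ 10 < W) {m : Mem} {T e : Expr}
    (hR : m 0 ≤ B) (hT : T.eval m ≤ B + 2) (hTf : T.Fits W m) (he : e.eval m ≤ B)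
    (hef : e.Fits W m) : (cellE T e).Fits W m := by
  have hb1 : B + 2 + B ≤ B ^ 3 := by nlinarith [pow_succ B 2, pow_succ B 1]
  have hb2 : (B + 2 + B) * (B + 2 + B) ≤ B ^ 6 := by
    calc _ ≤ B ^ 3 * B ^ 3 := Nat.mul_le_mul hb1 hb1
      _ = _ := by ring
  have hb3 : B ^ 6 * 2 ≤ B ^ 7 := by rw [pow_succ]; exact Nat.mul_le_mul_left _ hB
  have hb4 : B ^ 7 * 2 ≤ B ^ 8 := by rw [pow_succ B 7]; exact Nat.mul_le_mul_left _ hB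
  have hb5 : B ^ 8 ≤ B ^ 10 := Nat.pow_le_pow_right (by omega) (by omega)
  have hb6 : B ^ 3 ≤ B ^ 6 := Nat.pow_le_pow_right (by omega) (by omega)
  have hs : (T.eval m + e.eval m) * (T.eval m + e.eval m) ≤ B ^ 6 :=
    (Nat.mul_le_mul (by omega) (by omega)).trans hb2
  have h0 : (Expr.load (.lit 0)).Fits W m := ⟨by change 0 < W; omega, by change m 0 < W; omega⟩
  have hadd : (addE T e).Fits W m := ⟨hTf, hef, by change T.eval m + e.eval m < W; omega⟩
  refine ⟨h0, ⟨⟨hadd, hadd, ?_⟩, hTf, ?_⟩, ?_⟩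
  · change (T.eval m + e.eval m) * (T.eval m + e.eval m) < W; omega
  · change (T.eval m + e.eval m) * (T.eval m + e.eval m) + T.eval m < W; omega
  · change m 0 + ((T.eval m + e.eval m) * (T.eval m + e.eval m) + T.eval m) < W; omega

theorem Expr.reloc_fits {B W WA : ℕ} (hB : 2 ≤ B) (hW : B ^ 10 < W) (hWA : WA ≤ B)
    {T : Expr} {m mA : Mem} (hR : m 0 ≤ B) (hT : T.eval m ≤ B + 2) (hTf : T.Fits W m)
    (hm : ∀ a, m (m 0 + pr (T.eval m) a) = mA a) (e : Expr) (he : e.Fits WA mA) :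
    (e.reloc T).Fits W m := by
  have hBW : B < W := lt_of_le_of_lt (Nat.le_self_pow (by omega) B) hW
  induction e with
  | lit c => change c < W; change c < WA at he; omega
  | load a ih =>
    obtain ⟨h1, h2⟩ := he
    have h3 := eval_lt_of_fits h1
    have h4 := reloc_eval hm a
    refine ⟨cellE_fits hB hW hR hT hTf (by omega) (ih h1), ?_⟩
    rw [eval_cellE, h4, hm]; omega
  | bin o a b iha ihb =>
    refine ⟨iha he.1, ihb he.2.1, ?_⟩
    rw [reloc_eval hm, reloc_eval hm]
    have := he.2.2
    omega

/-- The relocated program simulates the original step by step, each step costing at most the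
constant `K`. The predicate `P` records what the expression `T` needs in order to keep its value
`τ`. Since `T` reads cells outside the region, and the simulation writes only inside it, `P` is
preserved by all writes. -/
theorem exec_reloc {B W WA : ℕ} (hB : 2 ≤ B) (hW : B ^ 10 < W) (hWA : WA ≤ B) {T : Expr} {R τ : ℕ}
    (hRB : R ≤ B) (hτB : τ ≤ B + 2) {P : Mem → Prop}
    (hP : ∀ m, P m → (m 0 = R ∧ T.Fits W m ∧ T.eval m = τ))
    (hP' : ∀ m a x, x ≤ B → P m → P (Function.update m (R + pr τ a) x))
    {p : Program} {mA mA' : Mem} {t : ℕ} (h : Exec WA p mA t mA') :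
    ∀ m, P m → (∀ a, m (R + pr τ a) = mA a) →
      ∃ m' t', t' ≤ (p.reloc T).K * t ∧ Exec W (p.reloc T) m t' m' ∧ P m' ∧
        (∀ a, m' (R + pr τ a) = mA' a) ∧ ∀ b, (∀ a, b ≠ R + pr τ a) → m' b = m b := by
  have fits : ∀ (m mA : Mem), P m → (∀ a, m (R + pr τ a) = mA a) → ∀ e : Expr, e.Fits WA mA →
      (e.reloc T).Fits W m ∧ (e.reloc T).eval m = e.eval mA := by
    intro m mA hm hA e he
    obtain ⟨h0, h1, h2⟩ := hP m hm
    have hA' : ∀ a, m (m 0 + pr (T.eval m) a) = mA a := by rw [h0, h2]; exact hA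
    exact ⟨Expr.reloc_fits hB hW hWA (by omega) (by omega) h1 hA' e he, Expr.reloc_eval hA' e⟩
  induction h with
  | nop mA =>
    intro m hm hA
    exact ⟨m, 1, by simp [Program.reloc, Program.K], .nop m, hm, hA, fun _ _ => rfl⟩
  | store a e mA ha he =>
    intro m hm hA
    obtain ⟨fa, va⟩ := fits m mA hm hA a ha
    obtain ⟨fe, ve⟩ := fits m mA hm hA e he
    obtain ⟨h0, h1, h2⟩ := hP m hm
    have la := Expr.eval_lt_of_fits ha
    have le := Expr.eval_lt_of_fits he
    refine ⟨_, _, ?_, .store _ _ m (cellE_fits hB hW (by omega) (by omega) h1 (by omega) fa) fe,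
      ?_, ?_, ?_⟩
    · simp only [Program.reloc, Program.K]
      exact Nat.le_mul_of_pos_right _ (by omega)
    · rw [eval_cellE, h0, h2]
      exact hP' _ _ _ (by omega) hm
    · intro b
      rw [eval_cellE, h0, h2, va, ve]
      by_cases hb : b = a.eval mA
      · subst hb; simp
      · rw [Function.update_of_ne hb, Function.update_of_ne, hA]
        intro h
        exact hb (pr_inj.1 (by omega : pr τ b = pr τ (a.eval mA))).2
    · intro b hb
      rw [eval_cellE, h0, h2]
      exact Function.update_of_ne (hb _) _ _
  | seq hp hq ihp ihq =>
    intro m hm hA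
    obtain ⟨m1, t1, l1, e1, p1, a1, f1⟩ := ihp m hm hA
    obtain ⟨m2, t2, l2, e2, p2, a2, f2⟩ := ihq m1 p1 a1
    refine ⟨m2, _, ?_, .seq e1 e2, p2, a2, fun b hb => (f2 b hb).trans (f1 b hb)⟩
    simp only [Program.reloc, Program.K]
    nlinarith
  | iteTrue hc h hp ih =>
    intro m hm hA
    obtain ⟨m1, t1, l1, e1, p1, a1, f1⟩ := ih m hm hA
    obtain ⟨fc, vc⟩ := fits m _ hm hA _ hc
    refine ⟨m1, _, ?_, .iteTrue fc (by rwa [vc]) e1, p1, a1, f1⟩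
    simp only [Program.reloc, Program.K]
    nlinarith [Nat.zero_le (Expr.cost ‹Expr›)]
  | iteFalse hc h hp ih =>
    intro m hm hA
    obtain ⟨m1, t1, l1, e1, p1, a1, f1⟩ := ih m hm hA
    obtain ⟨fc, vc⟩ := fits m _ hm hA _ hc
    refine ⟨m1, _, ?_, .iteFalse fc (by rwa [vc]) e1, p1, a1, f1⟩
    simp only [Program.reloc, Program.K]
    nlinarith [Nat.zero_le (Expr.cost ‹Expr›)]
  | loopStop hc h =>
    intro m hm hA
    obtain ⟨fc, vc⟩ := fits m _ hm hA _ hc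
    refine ⟨m, _, ?_, .loopStop fc (by rwa [vc]), hm, hA, fun _ _ => rfl⟩
    simp only [Program.reloc, Program.K]
    nlinarith
  | loopStep hc h hp hl ihp ihl =>
    intro m hm hA
    obtain ⟨fc, vc⟩ := fits m _ hm hA _ hc
    obtain ⟨m1, t1, l1, e1, p1, a1, f1⟩ := ihp m hm hA
    obtain ⟨m2, t2, l2, e2, p2, a2, f2⟩ := ihl m1 p1 a1
    refine ⟨m2, _, ?_, .loopStep fc (by rwa [vc]) e1 e2, p2, a2,
      fun b hb => (f2 b hb).trans (f1 b hb)⟩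
    simp only [Program.reloc, Program.K] at l1 l2 ⊢
    nlinarith

end FineGrained

namespace FineGrained

/-! ### A language with variables, arrays and virtual memories -/

/-- Structured memory: variables, three-dimensional arrays, the part of the memory that holds the
input and the output, and virtual memories. -/
structure St where
  v : ℕ → ℕ
  arr : ℕ → ℕ → ℕ → ℕ → ℕ
  raw : ℕ → ℕ
  vm : ℕ → Mem

namespace St

def setV (s : St) (j x : ℕ) : St := { s with v := Function.update s.v j x }
def setA (s : St) (j i k l x : ℕ) : St :=
  { s with arr := fun j' i' k' l' =>
      if j' = j ∧ i' = i ∧ k' = k ∧ l' = l then x else s.arr j' i' k' l' }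
def setRaw (s : St) (a x : ℕ) : St := { s with raw := Function.update s.raw a x }
def setVm (s : St) (t : ℕ) (m : Mem) : St := { s with vm := Function.update s.vm t m }

section
variable (s : St) (j i k l a x t : ℕ) (m : Mem)

@[simp] theorem setV_arr : (s.setV j x).arr = s.arr := rfl
@[simp] theorem setV_raw : (s.setV j x).raw = s.raw := rfl
@[simp] theorem setV_vm : (s.setV j x).vm = s.vm := rfl
@[simp] theorem setV_self : (s.setV j x).v j = x := by simp [setV]
@[simp] theorem setV_ne {k : ℕ} (h : k ≠ j) : (s.setV j x).v k = s.v k := by simp [setV, h]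
@[simp] theorem setA_v : (s.setA j i k l x).v = s.v := rfl
@[simp] theorem setA_raw : (s.setA j i k l x).raw = s.raw := rfl
@[simp] theorem setA_vm : (s.setA j i k l x).vm = s.vm := rfl
@[simp] theorem setA_ne {j' : ℕ} (h : j' ≠ j) : (s.setA j i k l x).arr j' = s.arr j' := by
  simp [setA, h]
theorem setA_self (i' k' l' : ℕ) : (s.setA j i k l x).arr j i' k' l' =
    if i' = i ∧ k' = k ∧ l' = l then x else s.arr j i' k' l' := by simp [setA]
theorem setA_arr_self : (s.setA j i k l x).arr j = fun i' k' l' =>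
    if i' = i ∧ k' = k ∧ l' = l then x else s.arr j i' k' l' := by simp [setA]
@[simp] theorem setA_same : (s.setA j i k l x).arr j i k l = x := by simp [setA]
@[simp] theorem setRaw_v : (s.setRaw a x).v = s.v := rfl
@[simp] theorem setRaw_arr : (s.setRaw a x).arr = s.arr := rfl
theorem setRaw_raw (b : ℕ) : (s.setRaw a x).raw b = if b = a then x else s.raw b := by
  simp [setRaw, Function.update_apply]
@[simp] theorem setVm_v : (s.setVm t m).v = s.v := rfl
@[simp] theorem setVm_arr : (s.setVm t m).arr = s.arr := rfl
@[simp] theorem setVm_raw : (s.setVm t m).raw = s.raw := rfl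
@[simp] theorem setVm_self : (s.setVm t m).vm t = m := by simp [setVm]
@[simp] theorem setVm_ne {t' : ℕ} (h : t' ≠ t) : (s.setVm t m).vm t' = s.vm t' := by
  simp [setVm, h]

end

/-- All entries are at most `B`. -/
structure Bdd (s : St) (B : ℕ) : Prop where
  v : ∀ j, s.v j ≤ B
  arr : ∀ j i k l, s.arr j i k l ≤ B
  raw : ∀ a, s.raw a ≤ B
  vm : ∀ t a, s.vm t a ≤ B

end St

inductive HExpr : Type
  | lit (c : ℕ)
  | v (j : ℕ)
  | arr (j : ℕ) (i k l : HExpr)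
  | add (a b : HExpr)
  | sub (a b : HExpr)
  | mul (a b : HExpr)
  | lt (a b : HExpr)
  | eq (a b : HExpr)

@[simp] def HExpr.eval (s : St) : HExpr → ℕ
  | .lit c => c
  | .v j => s.v j
  | .arr j i k l => s.arr j (i.eval s) (k.eval s) (l.eval s)
  | .add a b => a.eval s + b.eval s
  | .sub a b => a.eval s - b.eval s
  | .mul a b => a.eval s * b.eval s
  | .lt a b => if a.eval s < b.eval s then 1 else 0
  | .eq a b => if a.eval s = b.eval s then 1 else 0

/-- The first component of the pairing separates the regions: `0` for variables, `1` for arrays, and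
`t + 2` for the virtual memory `t`. -/
def vAddr (j : ℕ) : Expr := cellE (.lit 0) (.lit j)
def arrAddr (j : ℕ) (i k l : Expr) : Expr := cellE (.lit 1) (prE (.lit j) (prE i (prE k l)))

def HExpr.comp : HExpr → Expr
  | .lit c => .lit c
  | .v j => .load (vAddr j)
  | .arr j i k l => .load (arrAddr j i.comp k.comp l.comp)
  | .add a b => .bin .add a.comp b.comp
  | .sub a b => .bin .sub a.comp b.comp
  | .mul a b => .bin .mul a.comp b.comp
  | .lt a b => .bin .lt a.comp b.comp
  | .eq a b => .bin .eq a.comp b.comp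

theorem simple_vAddr (j : ℕ) : (vAddr j).Simple := simple_cellE trivial trivial
theorem simple_arrAddr (j : ℕ) {i k l : Expr} (hi : i.Simple) (hk : k.Simple) (hl : l.Simple) :
    (arrAddr j i k l).Simple :=
  simple_cellE (a := .lit 1) trivial
    (simple_prE (a := .lit j) trivial (simple_prE hi (simple_prE hk hl)))

theorem HExpr.comp_simple (e : HExpr) : e.comp.Simple := by
  induction e with
  | lit c => trivial
  | v j => exact simple_vAddr j
  | arr j i k l hi hk hl => exact simple_arrAddr j hi hk hl
  | add a b ha hb => exact ⟨by simp, ha, hb⟩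
  | sub a b ha hb => exact ⟨by simp, ha, hb⟩
  | mul a b ha hb => exact ⟨by simp, ha, hb⟩
  | lt a b ha hb => exact ⟨by simp, ha, hb⟩
  | eq a b ha hb => exact ⟨by simp, ha, hb⟩

/-- The memory `m` represents the structured memory `s`. -/
structure Rep (R B : ℕ) (m : Mem) (s : St) : Prop where
  zero : m 0 = R
  v : ∀ j, m (R + pr 0 j) = s.v j
  arr : ∀ j i k l, m (R + pr 1 (pr j (pr i (pr k l)))) = s.arr j i k l
  vm : ∀ t a, m (R + pr (t + 2) a) = s.vm t a
  raw : ∀ a, 1 ≤ a → a < R → m a = s.raw a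
  le : ∀ a, m a ≤ B

section
variable {R B : ℕ} {m : Mem} {s : St}

theorem HExpr.comp_eval (h : Rep R B m s) (e : HExpr) : e.comp.eval m = e.eval s := by
  induction e with
  | lit c => rfl
  | v j => simp [comp, vAddr, h.zero, h.v]
  | arr j i k l hi hk hl => simp [comp, arrAddr, h.zero, hi, hk, hl, h.arr]
  | add a b ha hb => simp [comp, Expr.eval, BinOp.eval, ha, hb]
  | sub a b ha hb => simp [comp, Expr.eval, BinOp.eval, ha, hb]
  | mul a b ha hb => simp [comp, Expr.eval, BinOp.eval, ha, hb]
  | lt a b ha hb => simp [comp, Expr.eval, BinOp.eval, ha, hb]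
  | eq a b ha hb => simp [comp, Expr.eval, BinOp.eval, ha, hb]

theorem update_le (h : ∀ a, m a ≤ B) (b : ℕ) {x : ℕ} (hx : x ≤ B) (a : ℕ) :
    Function.update m b x a ≤ B := by
  rw [Function.update_apply]; split_ifs <;> [exact hx; exact h a]

theorem Rep.setV (hR : 0 < R) (h : Rep R B m s) (j : ℕ) {x : ℕ} (hx : x ≤ B) :
    Rep R B (Function.update m (R + pr 0 j) x) (s.setV j x) where
  zero := by rw [Function.update_of_ne (by omega)]; exact h.zero
  v k := by
    by_cases hk : k = j
    · subst hk; simp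
    · rw [Function.update_of_ne, St.setV_ne _ _ _ hk, h.v]
      simpa [pr_inj] using hk
  arr j' i k l := by
    rw [Function.update_of_ne (by simp [pr_inj])]; exact h.arr _ _ _ _
  vm t a := by rw [Function.update_of_ne (by simp [pr_inj])]; exact h.vm _ _
  raw a h1 h2 := by rw [Function.update_of_ne (by omega)]; exact h.raw a h1 h2
  le := update_le h.le _ hx

theorem Rep.setA (hR : 0 < R) (h : Rep R B m s) (j i k l : ℕ) {x : ℕ} (hx : x ≤ B) :
    Rep R B (Function.update m (R + pr 1 (pr j (pr i (pr k l)))) x) (s.setA j i k l x) where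
  zero := by rw [Function.update_of_ne (by omega)]; exact h.zero
  v k := by rw [Function.update_of_ne (by simp [pr_inj])]; exact h.v _
  arr j' i' k' l' := by
    by_cases hk : j' = j ∧ i' = i ∧ k' = k ∧ l' = l
    · obtain ⟨rfl, rfl, rfl, rfl⟩ := hk; simp
    · rw [Function.update_of_ne (by simpa [pr_inj] using hk)]
      simp only [St.setA, if_neg hk]; exact h.arr _ _ _ _
  vm t a := by rw [Function.update_of_ne (by simp [pr_inj])]; exact h.vm _ _
  raw a h1 h2 := by rw [Function.update_of_ne (by omega)]; exact h.raw a h1 h2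
  le := update_le h.le _ hx

theorem Rep.setRaw (h : Rep R B m s) {a : ℕ} (h1 : 1 ≤ a) (h2 : a < R) {x : ℕ}
    (hx : x ≤ B) : Rep R B (Function.update m a x) (s.setRaw a x) where
  zero := by rw [Function.update_of_ne (by omega)]; exact h.zero
  v k := by rw [Function.update_of_ne (by omega)]; exact h.v _
  arr j' i' k' l' := by rw [Function.update_of_ne (by omega)]; exact h.arr _ _ _ _
  vm t a := by rw [Function.update_of_ne (by omega)]; exact h.vm _ _
  raw b h3 h4 := by
    rw [St.setRaw_raw, Function.update_apply]; split_ifs <;> [rfl; exact h.raw b h3 h4]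
  le := update_le h.le _ hx

theorem Rep.setVm (hR : 0 < R) (h : Rep R B m s) (t a : ℕ) {x : ℕ} (hx : x ≤ B) :
    Rep R B (Function.update m (R + pr (t + 2) a) x)
      (s.setVm t (Function.update (s.vm t) a x)) where
  zero := by rw [Function.update_of_ne (by omega)]; exact h.zero
  v k := by rw [Function.update_of_ne (by simp [pr_inj])]; exact h.v _
  arr j' i' k' l' := by rw [Function.update_of_ne (by simp [pr_inj])]; exact h.arr _ _ _ _
  vm t' a' := by
    by_cases ht : t' = t
    · subst ht
      rw [St.setVm_self, Function.update_apply, Function.update_apply, ← h.vm]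
      simp [pr_inj]
    · rw [St.setVm_ne _ _ _ ht, Function.update_of_ne, h.vm]
      simp [pr_inj, ht]
  raw b h3 h4 := by rw [Function.update_of_ne (by omega)]; exact h.raw b h3 h4
  le := update_le h.le _ hx

end

/-! ### Commands of the structured language, their compilation and their semantics. -/

inductive HProg : Type
  | skip
  | setV (j : ℕ) (e : HExpr)
  | setA (j : ℕ) (i k l e : HExpr)
  | getRaw (j : ℕ) (a : HExpr)
  | setRaw (a e : HExpr)
  | getVm (j : ℕ) (t a : HExpr)
  | setVm (t a e : HExpr)
  | call (j : ℕ) (p : Program)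
  | seq (p q : HProg)
  | ite (c : HExpr) (p q : HProg)
  | loop (c : HExpr) (p : HProg)

def vmAddr (t a : Expr) : Expr := cellE (addE t (.lit 2)) a

/-- In a call the number of the virtual memory is read from a variable at run time, so one fixed
piece of code serves all bins. -/
def HProg.comp : HProg → Program
  | .skip => .nop
  | .setV j e => .store (vAddr j) e.comp
  | .setA j i k l e => .store (arrAddr j i.comp k.comp l.comp) e.comp
  | .getRaw j a => .store (vAddr j) (.load a.comp)
  | .setRaw a e => .store a.comp e.comp
  | .getVm j t a => .store (vAddr j) (.load (vmAddr t.comp a.comp))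
  | .setVm t a e => .store (vmAddr t.comp a.comp) e.comp
  | .call j p => p.reloc (addE (.load (vAddr j)) (.lit 2))
  | .seq p q => .seq p.comp q.comp
  | .ite c p q => .ite c.comp p.comp q.comp
  | .loop c p => .loop c.comp p.comp

/-- A bound for the cost of the statements and tests of a program and for the size of the
numbers that occur. -/
def HProg.K : HProg → ℕ
  | .skip => 1
  | .setV j e => (vAddr j).sz + e.comp.sz + 1
  | .setA j i k l e => (arrAddr j i.comp k.comp l.comp).sz + e.comp.sz + 1
  | .getRaw j a => (vAddr j).sz + a.comp.sz + 2
  | .setRaw a e => a.comp.sz + e.comp.sz + 1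
  | .getVm j t a => (vAddr j).sz + (vmAddr t.comp a.comp).sz + 2
  | .setVm t a e => (vmAddr t.comp a.comp).sz + e.comp.sz + 1
  | .call j p => (p.reloc (addE (.load (vAddr j)) (.lit 2))).K +
      (addE (.load (vAddr j)) (.lit 2)).sz + 10
  | .seq p q => p.K + q.K
  | .ite c p q => c.comp.sz + 1 + p.K + q.K
  | .loop c p => c.comp.sz + 1 + p.K

/-- `HExec R B WA p s t s'`: started in `s`, the program halts in `s'` after `t` unit-cost steps;
all numbers stored are at most `B`, the cells `1, …, R - 1` can be accessed directly, and
subroutines use words below `WA`. -/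
inductive HExec (R B WA : ℕ) : HProg → St → ℕ → St → Prop
  | skip (s) : HExec R B WA .skip s 1 s
  | setV (j e s) (h : e.eval s ≤ B) : HExec R B WA (.setV j e) s 1 (s.setV j (e.eval s))
  | setA (j i k l e s) (h : e.eval s ≤ B) : HExec R B WA (.setA j i k l e) s 1
      (s.setA j (i.eval s) (k.eval s) (l.eval s) (e.eval s))
  | getRaw (j a s) (h1 : 1 ≤ a.eval s) (h2 : a.eval s < R) :
      HExec R B WA (.getRaw j a) s 1 (s.setV j (s.raw (a.eval s)))
  | setRaw (a e s) (h1 : 1 ≤ a.eval s) (h2 : a.eval s < R) (h : e.eval s ≤ B) :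
      HExec R B WA (.setRaw a e) s 1 (s.setRaw (a.eval s) (e.eval s))
  | getVm (j t a s) : HExec R B WA (.getVm j t a) s 1 (s.setV j (s.vm (t.eval s) (a.eval s)))
  | setVm (t a e s) (h : e.eval s ≤ B) : HExec R B WA (.setVm t a e) s 1
      (s.setVm (t.eval s) (Function.update (s.vm (t.eval s)) (a.eval s) (e.eval s)))
  | call (j p s t m) (h : Exec WA p (s.vm (s.v j)) t m) :
      HExec R B WA (.call j p) s t (s.setVm (s.v j) m)
  | seq {p q s s₁ s₂ t₁ t₂} (hp : HExec R B WA p s t₁ s₁) (hq : HExec R B WA q s₁ t₂ s₂) :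
      HExec R B WA (.seq p q) s (t₁ + t₂) s₂
  | iteTrue {c p q s s' t} (h : c.eval s ≠ 0) (hp : HExec R B WA p s t s') :
      HExec R B WA (.ite c p q) s (1 + t) s'
  | iteFalse {c p q s s' t} (h : c.eval s = 0) (hp : HExec R B WA q s t s') :
      HExec R B WA (.ite c p q) s (1 + t) s'
  | loopStop {c p s} (h : c.eval s = 0) : HExec R B WA (.loop c p) s 1 s
  | loopStep {c p s s₁ s₂ t₁ t₂} (h : c.eval s ≠ 0) (hp : HExec R B WA p s t₁ s₁)
      (hl : HExec R B WA (.loop c p) s₁ t₂ s₂) :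
      HExec R B WA (.loop c p) s (1 + t₁ + t₂) s₂

/-- All stored numbers are at most `B`, and an expression of the program has measure at most `K`, so
everything computed on the way is at most `B ^ K` and fits into a word. The same `K` bounds the cost
of one step. It depends on the program only, so the time grows by a constant factor. -/
theorem HExec.comp {R B WA W : ℕ} (hR : 0 < R) (hRB : R ≤ B) (hB : 2 ≤ B) (hWA : WA ≤ B)
    {p : HProg} {s s' : St} {t : ℕ} (h : HExec R B WA p s t s') (hW : B ^ p.K < W) :
    ∀ m, Rep R B m s → ∃ m' t', t' ≤ p.K * t ∧ Exec W p.comp m t' m' ∧ Rep R B m' s' := by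
  have fits : ∀ {k : ℕ} {m : Mem} {s : St} {e : Expr}, Rep R B m s → e.Simple → B ^ k < W →
      e.sz ≤ k → e.Fits W m := by
    intro k m s e hm he hk hek
    exact he.fits hB hm.le (lt_of_le_of_lt (Nat.pow_le_pow_right (by omega) hek) hk)
  have mono : ∀ {k l : ℕ}, B ^ l < W → k ≤ l → B ^ k < W := fun h hkl =>
    lt_of_le_of_lt (Nat.pow_le_pow_right (by omega) hkl) h
  have store : ∀ {k : ℕ} {m : Mem} {s s' : St} {a e : Expr}, Rep R B m s → a.Simple → e.Simple →
      B ^ k < W → a.sz + e.sz + 1 ≤ k → 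
      Rep R B (Function.update m (a.eval m) (e.eval m)) s' →
      ∃ m' t', t' ≤ k * 1 ∧ Exec W (.store a e) m t' m' ∧ Rep R B m' s' := by
    intro k m s s' a e hm ha he hk hl hm'
    refine ⟨_, _, ?_, .store a e m (fits hm ha hk (by omega)) (fits hm he hk (by omega)), hm'⟩
    have := a.cost_le_sz
    have := e.cost_le_sz
    omega
  induction h with
  | skip s => exact fun m hm => ⟨m, 1, by simp [HProg.K], .nop m, hm⟩
  | setV j e s h =>
    intro m hm
    refine store hm (simple_vAddr j) e.comp_simple hW le_rfl ?_
    rw [e.comp_eval hm]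
    simpa [vAddr, hm.zero] using hm.setV hR j h
  | setA j i k l e s h =>
    intro m hm
    refine store hm (simple_arrAddr j i.comp_simple k.comp_simple l.comp_simple) e.comp_simple
      hW le_rfl ?_
    rw [e.comp_eval hm]
    simpa [arrAddr, hm.zero, HExpr.comp_eval hm] using
      hm.setA hR j (i.eval s) (k.eval s) (l.eval s) h
  | getRaw j a s h1 h2 =>
    intro m hm
    refine store (e := .load a.comp) hm (simple_vAddr j) a.comp_simple hW
      (by simp only [Expr.sz, HProg.K]; omega) ?_
    rw [eval_load, a.comp_eval hm, ← hm.raw _ h1 h2]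
    simpa [vAddr, hm.zero] using hm.setV hR j (hm.le (a.eval s))
  | setRaw a e s h1 h2 h =>
    intro m hm
    refine store hm a.comp_simple e.comp_simple hW le_rfl ?_
    rw [e.comp_eval hm, a.comp_eval hm]
    exact hm.setRaw h1 h2 h
  | getVm j t a s =>
    intro m hm
    refine store (e := .load (vmAddr t.comp a.comp)) hm (simple_vAddr j)
      (simple_cellE (a := addE t.comp (.lit 2)) (simple_addE t.comp_simple trivial)
        a.comp_simple) hW (by simp only [Expr.sz, HProg.K]; omega) ?_
    have : (Expr.load (vmAddr t.comp a.comp)).eval m = s.vm (t.eval s) (a.eval s) := by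
      simp [vmAddr, hm.zero, HExpr.comp_eval hm, hm.vm]
    rw [this]
    simpa [vAddr, hm.zero] using hm.setV hR j (by rw [← hm.vm]; exact hm.le _)
  | setVm t a e s h =>
    intro m hm
    refine store hm (simple_cellE (a := addE t.comp (.lit 2)) (simple_addE t.comp_simple trivial)
      a.comp_simple) e.comp_simple hW le_rfl ?_
    rw [e.comp_eval hm]
    simpa [vmAddr, hm.zero, HExpr.comp_eval hm] using hm.setVm hR (t.eval s) (a.eval s) h
  | call j p s t mA h =>
    intro m hm
    set T : Expr := addE (.load (vAddr j)) (.lit 2) with hT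
    have hTs : T.Simple := simple_addE (a := .load (vAddr j)) (simple_vAddr j) trivial
    have hk : HProg.K (.call j p) = (p.reloc T).K + T.sz + 10 := rfl
    obtain ⟨m', t', l', e', ⟨h1, h2, h3⟩, h4, h5⟩ := exec_reloc (T := T) (R := R) (τ := s.v j + 2)
      (P := fun m => m 0 = R ∧ m (R + pr 0 j) = s.v j ∧ ∀ a, m a ≤ B) hB (mono hW (by omega)) hWA
      hRB (by rw [← hm.v]; exact Nat.add_le_add_right (hm.le _) 2)
      (fun m ⟨h1, h2, h3⟩ => ⟨h1, hTs.fits hB h3 (mono hW (by omega)), by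
        simp [hT, vAddr, h1, h2]⟩)
      (fun m a x hx ⟨h1, h2, h3⟩ => ⟨by rw [Function.update_of_ne (by omega)]; exact h1,
        by rw [Function.update_of_ne (by simp [pr_inj])]; exact h2, update_le h3 _ hx⟩)
      h m ⟨hm.zero, hm.v j, hm.le⟩ (hm.vm _)
    refine ⟨m', t', l'.trans (Nat.mul_le_mul_right _ (by omega)), e', h1, ?_, ?_, ?_, ?_, h3⟩
    · intro k; rw [h5 _ (by simp [pr_inj])]; exact hm.v k
    · intro j i k l; rw [h5 _ (by simp [pr_inj])]; exact hm.arr _ _ _ _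
    · intro t a
      by_cases ht : t = s.v j
      · subst ht; rw [h4, St.setVm_self]
      · rw [h5 _ (by simp [pr_inj, ht]), St.setVm_ne _ _ _ ht]; exact hm.vm _ _
    · intro a ha1 ha2; rw [h5 _ (by intro b; omega)]; exact hm.raw a ha1 ha2
  | @seq p q s s₁ s₂ t₁ t₂ hp hq ihp ihq =>
    intro m hm
    have hk : (HProg.seq p q).K = p.K + q.K := rfl
    obtain ⟨m1, t1, l1, e1, r1⟩ := ihp (mono hW (by omega)) m hm
    obtain ⟨m2, t2, l2, e2, r2⟩ := ihq (mono hW (by omega)) m1 r1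
    exact ⟨m2, _, by rw [hk]; nlinarith, .seq e1 e2, r2⟩
  | @iteTrue c p q s s' t h hp ih =>
    intro m hm
    have hk : (HProg.ite c p q).K = c.comp.sz + 1 + p.K + q.K := rfl
    obtain ⟨m1, t1, l1, e1, r1⟩ := ih (mono hW (by omega)) m hm
    have := c.comp.cost_le_sz
    exact ⟨m1, _, by rw [hk]; nlinarith, .iteTrue (fits hm c.comp_simple hW (by omega))
      (by rwa [c.comp_eval hm]) e1, r1⟩
  | @iteFalse c p q s s' t h hp ih =>
    intro m hm
    have hk : (HProg.ite c p q).K = c.comp.sz + 1 + p.K + q.K := rfl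
    obtain ⟨m1, t1, l1, e1, r1⟩ := ih (mono hW (by omega)) m hm
    have := c.comp.cost_le_sz
    exact ⟨m1, _, by rw [hk]; nlinarith, .iteFalse (fits hm c.comp_simple hW (by omega))
      (by rwa [c.comp_eval hm]) e1, r1⟩
  | @loopStop c p s h =>
    intro m hm
    have hk : (HProg.loop c p).K = c.comp.sz + 1 + p.K := rfl
    have := c.comp.cost_le_sz
    exact ⟨m, _, by rw [hk]; omega, .loopStop (fits hm c.comp_simple hW (by omega))
      (by rwa [c.comp_eval hm]), hm⟩
  | @loopStep c p s s₁ s₂ t₁ t₂ h hp hl ihp ihl =>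
    intro m hm
    have hk : (HProg.loop c p).K = c.comp.sz + 1 + p.K := rfl
    have := c.comp.cost_le_sz
    obtain ⟨m1, t1, l1, e1, r1⟩ := ihp (mono hW (by omega)) m hm
    obtain ⟨m2, t2, l2, e2, r2⟩ := ihl hW m1 r1
    refine ⟨m2, _, ?_, .loopStep (fits hm c.comp_simple hW (by omega))
      (by rwa [c.comp_eval hm]) e1 e2, r2⟩
    rw [hk] at l2 ⊢; nlinarith

/-- Stored values are words. This is what makes a subroutine call preserve boundedness of the state.
-/
theorem Exec.le {W B : ℕ} (hWB : W ≤ B) {p : Program} {m m' : Mem} {t : ℕ} (h : Exec W p m t m')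
    (hm : ∀ a, m a ≤ B) : ∀ a, m' a ≤ B := by
  induction h with
  | nop => exact hm
  | store a e m ha he => exact update_le hm _ ((Expr.eval_lt_of_fits he).le.trans hWB)
  | seq _ _ ih1 ih2 => exact ih2 (ih1 hm)
  | iteTrue _ _ _ ih => exact ih hm
  | iteFalse _ _ _ ih => exact ih hm
  | loopStop => exact hm
  | loopStep _ _ _ _ ih1 ih2 => exact ih2 (ih1 hm)

namespace St.Bdd
variable {s : St} {B : ℕ}

theorem setV (h : s.Bdd B) (j : ℕ) {x : ℕ} (hx : x ≤ B) : (s.setV j x).Bdd B :=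
  ⟨update_le h.v _ hx, h.arr, h.raw, h.vm⟩

theorem setA (h : s.Bdd B) (j i k l : ℕ) {x : ℕ} (hx : x ≤ B) : (s.setA j i k l x).Bdd B :=
  ⟨h.v, fun j' i' k' l' => by simp only [St.setA]; split_ifs <;> [exact hx; exact h.arr _ _ _ _],
    h.raw, h.vm⟩

theorem setRaw (h : s.Bdd B) (a : ℕ) {x : ℕ} (hx : x ≤ B) : (s.setRaw a x).Bdd B :=
  ⟨h.v, h.arr, update_le h.raw _ hx, h.vm⟩

theorem setVm (h : s.Bdd B) (t : ℕ) {m : Mem} (hm : ∀ a, m a ≤ B) : (s.setVm t m).Bdd B := by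
  refine ⟨h.v, h.arr, h.raw, fun t' a => ?_⟩
  by_cases ht : t' = t
  · subst ht; simpa using hm a
  · simpa [ht] using h.vm t' a

end St.Bdd

/-! ### Weakest preconditions -/

/-- Started in `s` after `τ` steps, the program halts with a final state and step count that
satisfy `Q`. -/
def wp (R B WA : ℕ) (p : HProg) (Q : St → ℕ → Prop) (s : St) (τ : ℕ) : Prop :=
  s.Bdd B → ∃ s' t, HExec R B WA p s t s' ∧ s'.Bdd B ∧ Q s' (τ + t)

section
variable {R B WA : ℕ} {Q Q' : St → ℕ → Prop} {s : St} {τ : ℕ} {p q : HProg}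

theorem wp_skip (h : Q s (τ + 1)) : wp R B WA .skip Q s τ :=
  fun hs => ⟨s, 1, .skip s, hs, h⟩

/-- The size obligation may assume that the current state is bounded, so that copying a stored value
needs no further argument. The same form is used for the other commands that write. -/
theorem wp_setV {j : ℕ} {e : HExpr} (h : s.Bdd B → e.eval s ≤ B)
    (hQ : Q (s.setV j (e.eval s)) (τ + 1)) : wp R B WA (.setV j e) Q s τ :=
  fun hs => ⟨_, 1, .setV j e s (h hs), hs.setV j (h hs), hQ⟩

theorem wp_setA {j : ℕ} {i k l e : HExpr} (h : s.Bdd B → e.eval s ≤ B)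
    (hQ : Q (s.setA j (i.eval s) (k.eval s) (l.eval s) (e.eval s)) (τ + 1)) :
    wp R B WA (.setA j i k l e) Q s τ :=
  fun hs => ⟨_, 1, .setA j i k l e s (h hs), hs.setA j _ _ _ (h hs), hQ⟩

theorem wp_getRaw {j : ℕ} {a : HExpr} (h1 : 1 ≤ a.eval s) (h2 : a.eval s < R)
    (hQ : Q (s.setV j (s.raw (a.eval s))) (τ + 1)) : wp R B WA (.getRaw j a) Q s τ :=
  fun hs => ⟨_, 1, .getRaw j a s h1 h2, hs.setV j (hs.raw _), hQ⟩

theorem wp_setRaw {a e : HExpr} (h1 : 1 ≤ a.eval s) (h2 : a.eval s < R)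
    (h : s.Bdd B → e.eval s ≤ B)
    (hQ : Q (s.setRaw (a.eval s) (e.eval s)) (τ + 1)) : wp R B WA (.setRaw a e) Q s τ :=
  fun hs => ⟨_, 1, .setRaw a e s h1 h2 (h hs), hs.setRaw _ (h hs), hQ⟩

theorem wp_getVm {j : ℕ} {t a : HExpr}
    (hQ : Q (s.setV j (s.vm (t.eval s) (a.eval s))) (τ + 1)) : wp R B WA (.getVm j t a) Q s τ :=
  fun hs => ⟨_, 1, .getVm j t a s, hs.setV j (hs.vm _ _), hQ⟩

theorem wp_setVm {t a e : HExpr} (h : s.Bdd B → e.eval s ≤ B)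
    (hQ : Q (s.setVm (t.eval s) (Function.update (s.vm (t.eval s)) (a.eval s) (e.eval s)))
      (τ + 1)) : wp R B WA (.setVm t a e) Q s τ :=
  fun hs => ⟨_, 1, .setVm t a e s (h hs), hs.setVm _ (update_le (hs.vm _) _ (h hs)), hQ⟩

theorem wp_call {j : ℕ} {p : Program} (hWA : WA ≤ B) {t : ℕ} {m : Mem}
    (h : Exec WA p (s.vm (s.v j)) t m) (hQ : Q (s.setVm (s.v j) m) (τ + t)) :
    wp R B WA (.call j p) Q s τ :=
  fun hs => ⟨_, t, .call j p s t m h, hs.setVm _ (h.le hWA (hs.vm _)), hQ⟩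

theorem wp_seq (h : wp R B WA p (wp R B WA q Q) s τ) : wp R B WA (.seq p q) Q s τ := by
  intro hs
  obtain ⟨s1, t1, e1, b1, h1⟩ := h hs
  obtain ⟨s2, t2, e2, b2, h2⟩ := h1 b1
  exact ⟨s2, t1 + t2, .seq e1 e2, b2, by rwa [← add_assoc]⟩

theorem wp_ite {c : HExpr} (h1 : c.eval s ≠ 0 → wp R B WA p Q s (τ + 1))
    (h2 : c.eval s = 0 → wp R B WA q Q s (τ + 1)) : wp R B WA (.ite c p q) Q s τ := by
  intro hs
  by_cases hc : c.eval s = 0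
  · obtain ⟨s1, t1, e1, b1, q1⟩ := h2 hc hs
    exact ⟨s1, 1 + t1, .iteFalse hc e1, b1, by rwa [← add_assoc]⟩
  · obtain ⟨s1, t1, e1, b1, q1⟩ := h1 hc hs
    exact ⟨s1, 1 + t1, .iteTrue hc e1, b1, by rwa [← add_assoc]⟩

theorem wp_mono (h : wp R B WA p Q s τ) (hQ : ∀ s τ, Q s τ → Q' s τ) : wp R B WA p Q' s τ := by
  intro hs
  obtain ⟨s1, t1, e1, b1, q1⟩ := h hs
  exact ⟨s1, t1, e1, b1, hQ _ _ q1⟩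

/-- The number `N` of iterations is known in advance and the invariant is indexed by the iteration.
Termination thus comes from an induction on the number of remaining rounds, and time bounds can be
part of the invariant. -/
theorem wp_loop {c : HExpr} {I : ℕ → St → ℕ → Prop} {N : ℕ}
    (step : ∀ i < N, ∀ s τ, I i s τ → c.eval s ≠ 0 ∧ wp R B WA p (I (i + 1)) s (τ + 1))
    (hend : ∀ s τ, I N s τ → c.eval s = 0 ∧ Q s (τ + 1)) (h0 : I 0 s τ) :
    wp R B WA (.loop c p) Q s τ := by
  suffices H : ∀ k i s τ, i + k = N → I i s τ → wp R B WA (.loop c p) Q s τ from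
    H N 0 s τ (by omega) h0
  intro k
  induction k with
  | zero =>
    intro i s τ hi hI hs
    obtain rfl : i = N := by omega
    obtain ⟨h1, h2⟩ := hend s τ hI
    exact ⟨s, 1, .loopStop h1, hs, h2⟩
  | succ k ih =>
    intro i s τ hi hI hs
    obtain ⟨h1, h2⟩ := step i (by omega) s τ hI
    obtain ⟨s1, t1, e1, b1, q1⟩ := h2 hs
    obtain ⟨s2, t2, e2, b2, q2⟩ := ih (i + 1) s1 _ (by omega) q1 b1
    exact ⟨s2, 1 + t1 + t2, .loopStep h1 e1 e2, b2, by rwa [← add_assoc, ← add_assoc]⟩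

end

/-- Run `p` with the variable `j` going through the numbers below the value of `b`. -/
def HProg.for (j : ℕ) (b : HExpr) (p : HProg) : HProg :=
  .seq (.setV j (.lit 0))
    (.loop (.lt (.v j) b) (.seq p (.setV j (.add (.v j) (.lit 1)))))

/-- The bound `b` is evaluated anew at every test, hence the requirement that the invariant fixes
its value. Besides its body, a round costs two steps, for the test and the increment. -/
theorem wp_for {R B WA : ℕ} {Q : St → ℕ → Prop} {s : St} {τ : ℕ} {p : HProg} {j : ℕ} {b : HExpr}
    (I : ℕ → St → ℕ → Prop) (N : ℕ) (hN : N ≤ B)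
    (h0 : I 0 (s.setV j 0) (τ + 1))
    (hb : ∀ i s τ, I i s τ → s.v j = i → b.eval s = N)
    (step : ∀ i < N, ∀ s τ, I i s τ → s.v j = i →
      wp R B WA p (fun s' τ' => s'.v j = i ∧ I (i + 1) (s'.setV j (i + 1)) (τ' + 1)) s (τ + 1))
    (hend : ∀ s τ, I N s τ → Q s (τ + 1)) :
    wp R B WA (.for j b p) Q s τ := by
  refine wp_seq (wp_setV (fun _ => Nat.zero_le _) ?_)
  refine wp_loop (I := fun i s τ => I i s τ ∧ s.v j = i) (N := N) ?_ ?_ ⟨h0, by simp⟩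
  · rintro i hi s τ ⟨hI, hj⟩
    refine ⟨by simp [hb i s τ hI hj, hj, hi], wp_seq (wp_mono (step i hi s τ hI hj) ?_)⟩
    rintro s' τ' ⟨h1, h2⟩
    refine wp_setV (fun _ => by simp [h1]; omega) ?_
    simp only [HExpr.eval, h1]
    exact ⟨h2, by simp⟩
  · rintro s τ ⟨hI, hj⟩
    exact ⟨by simp [hb N s τ hI hj, hj], hend s τ hI⟩

end FineGrained

namespace FineGrained

/-! ### Sorting the neighbours of all nodes by color -/

/-- The number of edges of color `c - 1` at node `v`, given the table of a colored graph. -/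
def colDeg (n : ℕ) (tab : ℕ → ℕ → ℕ) (c v : ℕ) : ℕ := Nat.count (fun u => tab v u = c) n

/-- The array `0` is the table, the array `1` holds the degrees, the array `2` lists the neighbours
for each node and color, and the arrays `3` and `4` list and count the nodes of degree greater than
`Δ` for each color. -/
structure Counted (n Δ : ℕ) (tab : ℕ → ℕ → ℕ) (A : ℕ → ℕ → ℕ → ℕ → ℕ) : Prop where
  table : ∀ v < n, ∀ u < n, A 0 v u 0 = tab v u
  deg : ∀ v < n, ∀ c ≠ 0, A 1 v c 0 = colDeg n tab c v
  nbr : ∀ v < n, ∀ u < n, tab v u ≠ 0 →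
    A 2 v (tab v u) (Nat.count (fun u' => tab v u' = tab v u) u) = u
  hc : ∀ c ≠ 0, A 4 c 0 0 = Nat.count (fun v => Δ < colDeg n tab c v) n
  hl : ∀ c ≠ 0, ∀ v < n, Δ < colDeg n tab c v →
    A 3 c (Nat.count (fun v => Δ < colDeg n tab c v) v) 0 = v

theorem Counted.setA {n Δ : ℕ} {tab : ℕ → ℕ → ℕ} {s : St} (h : Counted n Δ tab s.arr)
    {j : ℕ} (hj : 5 ≤ j) (i k l x : ℕ) : Counted n Δ tab (s.setA j i k l x).arr := by
  refine ⟨?_, ?_, ?_, ?_, ?_⟩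
  · rw [St.setA_ne _ _ _ _ _ _ (by omega)]; exact h.table
  · rw [St.setA_ne _ _ _ _ _ _ (by omega)]; exact h.deg
  · rw [St.setA_ne _ _ _ _ _ _ (by omega)]; exact h.nbr
  · rw [St.setA_ne _ _ _ _ _ _ (by omega)]; exact h.hc
  · rw [St.setA_ne _ _ _ _ _ _ (by omega)]; exact h.hl

/-- The current degree serves as the position of the next neighbour in its list. A node enters the
list of its color when its old degree equals `Δ`, the moment at which it becomes a node of high
degree; this happens once, and nodes are listed in increasing order. -/
def HProg.countBody : HProg :=
  .seq (.getRaw 4 (.add (.add (.lit 1) (.mul (.v 2) (.v 0))) (.v 3)))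
  (.seq (.setA 0 (.v 2) (.v 3) (.lit 0) (.v 4))
  (.ite (.v 4)
    (.seq (.setV 5 (.arr 1 (.v 2) (.v 4) (.lit 0)))
    (.seq (.setA 2 (.v 2) (.v 4) (.v 5) (.v 3))
    (.seq (.setA 1 (.v 2) (.v 4) (.lit 0) (.add (.v 5) (.lit 1)))
    (.ite (.eq (.v 5) (.v 1))
      (.seq (.setA 3 (.v 4) (.arr 4 (.v 4) (.lit 0) (.lit 0)) (.lit 0) (.v 2))
        (.setA 4 (.v 4) (.lit 0) (.lit 0) (.add (.arr 4 (.v 4) (.lit 0) (.lit 0)) (.lit 1))))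
      .skip))))
    .skip))

def HProg.count : HProg := .for 2 (.v 0) (.for 3 (.v 0) .countBody)

/-- The number of entries of row `v` that come before entry `k` of row `i`. -/
def pf (n i k v : ℕ) : ℕ := if v < i then n else if v = i then k else 0

structure CountInv (n Δ : ℕ) (tab : ℕ → ℕ → ℕ) (s₀ : St) (i k : ℕ) (s : St) : Prop where
  v0 : s.v 0 = n
  v1 : s.v 1 = Δ
  raw : s.raw = s₀.raw
  vm : s.vm = s₀.vm
  arr : ∀ j, 5 ≤ j → s.arr j = s₀.arr j
  table : ∀ v u, u < pf n i k v → s.arr 0 v u 0 = tab v u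
  deg : ∀ v, ∀ c ≠ 0, s.arr 1 v c 0 = Nat.count (fun u => tab v u = c) (pf n i k v)
  nbr : ∀ v u, u < pf n i k v → tab v u ≠ 0 →
    s.arr 2 v (tab v u) (Nat.count (fun u' => tab v u' = tab v u) u) = u
  hc : ∀ c ≠ 0, s.arr 4 c 0 0 = Nat.count (fun v => Δ < colDeg n tab c v) i +
    if Δ < Nat.count (fun u => tab i u = c) k then 1 else 0
  hl : ∀ c ≠ 0, ∀ v, Δ < Nat.count (fun u => tab v u = c) (pf n i k v) →
    s.arr 3 c (Nat.count (fun v => Δ < colDeg n tab c v) v) 0 = v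

variable {R B WA n Δ : ℕ} {tab : ℕ → ℕ → ℕ}

theorem CountInv.setV {s s₀ : St} {i k : ℕ} (h : CountInv n Δ tab s₀ i k s) {j x : ℕ}
    (hj : 2 ≤ j) : CountInv n Δ tab s₀ i k (s.setV j x) :=
  ⟨by rw [St.setV_ne _ _ _ (by omega), h.v0], by rw [St.setV_ne _ _ _ (by omega), h.v1], h.raw,
    h.vm, h.arr, h.table, h.deg, h.nbr, h.hc, h.hl⟩

theorem CountInv.next {s s₀ : St} {i : ℕ} (h : CountInv n Δ tab s₀ i n s) :
    CountInv n Δ tab s₀ (i + 1) 0 s := by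
  have hpf : pf n (i + 1) 0 = pf n i n := by
    funext v; unfold pf; split_ifs <;> omega
  refine ⟨h.v0, h.v1, h.raw, h.vm, h.arr, by rw [hpf]; exact h.table, by rw [hpf]; exact h.deg,
    by rw [hpf]; exact h.nbr, ?_, by rw [hpf]; exact h.hl⟩
  intro c hc
  rw [h.hc c hc, Nat.count_succ]
  by_cases hh : Δ < Nat.count (fun u => tab i u = c) n <;> simp [hh, colDeg]

theorem wp_countBody {s₀ s : St} {τ i k : ℕ} (hi : i < n) (hk : k < n) (hR : R = n * n + 1)
    (hB : n * n + n ≤ B)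
    (hraw : ∀ i < n, ∀ j < n, s₀.raw (1 + i * n + j) = tab i j)
    (h : CountInv n Δ tab s₀ i k s) (h2 : s.v 2 = i) (h3 : s.v 3 = k) :
    wp R B WA .countBody (fun s' τ' => s'.v 2 = i ∧ s'.v 3 = k ∧
      CountInv n Δ tab s₀ i (k + 1) s' ∧ τ' ≤ τ + 9) s τ := by
  have hidx : i * n + k < n * n := by nlinarith
  have hnB : n ≤ B := by nlinarith
  have hpf : ∀ v, v ≠ i → pf n i (k + 1) v = pf n i k v := by
    intro v hv; simp [pf, hv]
  have hpi : pf n i (k + 1) i = k + 1 := by simp [pf]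
  have hpi' : pf n i k i = k := by simp [pf]
  have htab : ∀ {s' : St}, s'.arr 0 = (s.setA 0 i k 0 (tab i k)).arr 0 →
      ∀ v u, u < pf n i (k + 1) v → s'.arr 0 v u 0 = tab v u := by
    intro s' hs' v u hu
    rw [hs', St.setA_self]
    split_ifs with h1
    · rw [h1.1, h1.2.1]
    · apply h.table
      by_cases hv : v = i
      · subst hv; rw [hpi] at hu; rw [hpi']; omega
      · rwa [← hpf v hv]
  have hraw' : s.raw (1 + i * n + k) = tab i k := by rw [h.raw, hraw i hi k hk]
  refine wp_seq (wp_getRaw (by simp; omega) (by simp [h2, h3, h.v0]; omega) ?_)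
  simp only [HExpr.eval, h2, h3, h.v0, hraw']
  refine wp_seq (wp_setA (fun hb => hb.v 4) ?_)
  simp [h2, h3]
  set c := tab i k with hc
  refine wp_ite (fun hc0 => ?_) (fun hc0 => ?_)
  · simp only [HExpr.eval, St.setA_v, St.setV_self] at hc0
    have hdeg := h.deg i c hc0
    rw [hpi'] at hdeg
    have hcnt : Nat.count (fun u => tab i u = c) (k + 1) =
        Nat.count (fun u => tab i u = c) k + 1 := by rw [Nat.count_succ]; simp [hc]
    have hcnt' : ∀ c' ≠ c, Nat.count (fun u => tab i u = c') (k + 1) =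
        Nat.count (fun u => tab i u = c') k := by
      intro c' hc'; rw [Nat.count_succ]; simp [← hc, hc'.symm]
    set d := Nat.count (fun u => tab i u = c) k with hd
    have hdk : d ≤ k := Nat.count_le _
    refine wp_seq (wp_setV (by intro _; simp [h2, hdeg]; omega) ?_)
    refine wp_seq (wp_setA (by intro _; simp [h3]; omega) ?_)
    refine wp_seq (wp_setA (by intro _; simp [h2, hdeg]; omega) ?_)
    simp [h2, h3, hdeg]
    have hdegF : ∀ {s' : St}, s'.arr 1 = (s.setA 1 i c 0 (d + 1)).arr 1 → ∀ v, ∀ c' ≠ 0,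
        s'.arr 1 v c' 0 = Nat.count (fun u => tab v u = c') (pf n i (k + 1) v) := by
      intro s' hs' v c' hc'
      rw [hs', St.setA_self]
      split_ifs with h1
      · rw [h1.1, h1.2.1, hpi, hcnt]
      · rw [h.deg v c' hc']
        by_cases hv : v = i
        · subst hv
          rw [hpi, hpi', hcnt' c' (by rintro rfl; simp at h1)]
        · rw [hpf v hv]
    have hnbrF : ∀ {s' : St}, s'.arr 2 = (s.setA 2 i c d k).arr 2 → ∀ v u,
        u < pf n i (k + 1) v → tab v u ≠ 0 →
        s'.arr 2 v (tab v u) (Nat.count (fun u' => tab v u' = tab v u) u) = u := by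
      intro s' hs' v u hu h0
      rw [hs', St.setA_self]
      by_cases hv : v = i
      · subst hv
        rw [hpi] at hu
        by_cases huk : u = k
        · subst huk; simp [← hc, ← hd]
        · rw [if_neg, h.nbr v u (by rw [hpi']; omega) h0]
          rintro ⟨-, h5, h6⟩
          rw [h5, hd] at h6
          -- An earlier neighbour of the same color has a strictly smaller rank, so the new list
          -- entry does not overwrite it.
          have h7 := Nat.count_strict_mono (p := fun u' => tab v u' = c) h5 (show u < k by omega)
          omega
      · rw [if_neg (by simp [hv]), h.nbr v u (by rwa [← hpf v hv]) h0]
    have hcF := h.hc c hc0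
    refine wp_ite (fun hdΔ => ?_) (fun hdΔ => ?_)
    · have hdΔ : d = Δ := by
        by_contra hne
        simp [h.v1, hne] at hdΔ
      have hh : Nat.count (fun v => Δ < colDeg n tab c v) i ≤ i := Nat.count_le _
      -- Before this edge the node `i` still has degree `Δ` and is not counted, so the length of the
      -- list is the rank of `i` among the high nodes.
      rw [if_neg (by omega), add_zero] at hcF
      refine wp_seq (wp_setA (by intro _; simp [h2]; omega) ?_)
      refine wp_setA (by intro _; simp [hcF]; omega) ?_
      simp [h2, h3, hcF]
      refine ⟨by simp [h.v0], by simp [h.v1], by simp [h.raw], by simp [h.vm], ?_, htab (by simp [St.setA_arr_self]),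
        hdegF (by simp [St.setA_arr_self]), hnbrF (by simp [St.setA_arr_self]), ?_, ?_⟩
      · intro j hj
        rw [St.setA_ne _ _ _ _ _ _ (by omega), St.setA_ne _ _ _ _ _ _ (by omega),
          St.setA_ne _ _ _ _ _ _ (by omega), St.setA_ne _ _ _ _ _ _ (by omega), St.setV_arr,
          St.setA_ne _ _ _ _ _ _ (by omega), St.setV_arr, h.arr j hj]
      · intro c' hc'
        rw [St.setA_self]
        by_cases h1 : c' = c
        · subst h1; rw [if_pos (by simp), hcnt, if_pos (by omega)]
        · rw [if_neg (by simp [h1]), hcnt' c' h1, ← h.hc c' hc']; simp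
      · intro c' hc' v hv
        rw [St.setA_ne _ _ _ _ _ _ (by omega), St.setA_self]
        by_cases hvi : v = i
        · subst hvi
          by_cases h1 : c' = c
          · subst h1; rw [if_pos (by simp)]
          · rw [if_neg (by simp [h1])]
            rw [hpi, hcnt' c' h1] at hv
            simpa using h.hl c' hc' v (by rwa [hpi'])
        · rw [hpf v hvi] at hv
          have h6 := h.hl c' hc' v hv
          rw [if_neg]
          · simpa using h6
          rintro ⟨h4, h5, -⟩
          subst h4
          have hvlt : v < i := by
            by_contra hge
            simp [pf, hvi, hge] at hv
          have hv' : Δ < colDeg n tab c v := by simpa [pf, hvlt, colDeg] using hv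
          have h7 := Nat.count_strict_mono (p := fun v => Δ < colDeg n tab c v) hv' hvlt
          omega
    · have hdΔ : d ≠ Δ := by
        rintro hne
        simp [h.v1, hne] at hdΔ
      refine wp_skip ⟨by simp [h2], by simp [h3], ⟨by simp [h.v0], by simp [h.v1], by simp [h.raw],
        by simp [h.vm], ?_, htab (by simp [St.setA_arr_self]), hdegF (by simp [St.setA_arr_self]), hnbrF (by simp [St.setA_arr_self]), ?_, ?_⟩, by omega⟩
      · intro j hj
        rw [St.setA_ne _ _ _ _ _ _ (by omega), St.setA_ne _ _ _ _ _ _ (by omega), St.setV_arr,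
          St.setA_ne _ _ _ _ _ _ (by omega), St.setV_arr, h.arr j hj]
      · intro c' hc'
        simp only [ne_eq, OfNat.ofNat_ne_one, not_false_eq_true, St.setA_ne, OfNat.ofNat_ne_zero,
          Nat.reduceEqDiff, St.setV_arr]
        rw [h.hc c' hc']
        by_cases h1 : c' = c
        · subst h1; rw [hcnt, ← hd]; congr 1
          split_ifs <;> omega
        · rw [hcnt' c' h1]
      · intro c' hc' v hv
        have : Δ < Nat.count (fun u => tab v u = c') (pf n i k v) := by
          by_cases hvi : v = i
          · subst hvi
            rw [hpi] at hv; rw [hpi']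
            by_cases h1 : c' = c
            · subst h1; rw [hcnt] at hv; omega
            · rwa [hcnt' c' h1] at hv
          · rwa [← hpf v hvi]
        simpa using h.hl c' hc' v this
  · have hc0 : c = 0 := by simpa using hc0
    have hcnt' : ∀ c' ≠ 0, Nat.count (fun u => tab i u = c') (k + 1) =
        Nat.count (fun u => tab i u = c') k := by
      intro c' hc'; rw [Nat.count_succ]; simp [← hc, hc0, hc'.symm]
    have hcnt2 : ∀ v, ∀ c' ≠ 0, Nat.count (fun u => tab v u = c') (pf n i (k + 1) v) =
        Nat.count (fun u => tab v u = c') (pf n i k v) := by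
      intro v c' hc'
      by_cases hvi : v = i
      · subst hvi; rw [hpi, hpi', hcnt' c' hc']
      · rw [hpf v hvi]
    refine wp_skip ⟨by simp [h2], by simp [h3], ⟨by simp [h.v0], by simp [h.v1], by simp [h.raw],
        by simp [h.vm], ?_, htab (by simp [St.setA_arr_self]), ?_, ?_, ?_, ?_⟩, by omega⟩
    · intro j hj
      rw [St.setA_ne _ _ _ _ _ _ (by omega), St.setV_arr, h.arr j hj]
    · intro v c' hc'
      rw [hcnt2 v c' hc', ← h.deg v c' hc']; simp
    · intro v u hu h0
      have : u < pf n i k v := by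
        by_cases hvi : v = i
        · subst hvi
          rw [hpi] at hu; rw [hpi']
          have : u ≠ k := by rintro rfl; exact h0 hc0
          omega
        · rwa [← hpf v hvi]
      simpa using h.nbr v u this h0
    · intro c' hc'
      rw [hcnt' c' hc', ← h.hc c' hc']; simp
    · intro c' hc' v hv
      rw [hcnt2 v c' hc'] at hv
      simpa using h.hl c' hc' v hv

/-- The state after the neighbours have been sorted. -/
structure CountPost (n Δ : ℕ) (tab : ℕ → ℕ → ℕ) (s₀ s : St) : Prop where
  v0 : s.v 0 = n
  v1 : s.v 1 = Δ
  vm : s.vm = s₀.vm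
  arr : ∀ j, 5 ≤ j → s.arr j = s₀.arr j
  counted : Counted n Δ tab s.arr

theorem CountInv.post {s s₀ : St} (h : CountInv n Δ tab s₀ n 0 s) : CountPost n Δ tab s₀ s := by
  have hpf : ∀ v < n, pf n n 0 v = n := fun v hv => by simp [pf, hv]
  refine ⟨h.v0, h.v1, h.vm, h.arr, ⟨?_, ?_, ?_, ?_, ?_⟩⟩
  · intro v hv u hu; exact h.table v u (by rwa [hpf v hv])
  · intro v hv c hc; rw [h.deg v c hc, hpf v hv, colDeg]
  · intro v hv u hu h0; exact h.nbr v u (by rwa [hpf v hv]) h0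
  · intro c hc; rw [h.hc c hc]; simp
  · intro c hc v hv h0; exact h.hl c hc v (by rwa [hpf v hv])

theorem wp_count {s₀ : St} {τ : ℕ} (hR : R = n * n + 1) (hB : n * n + n ≤ B)
    (h0 : s₀.v 0 = n) (h1 : s₀.v 1 = Δ) (harr : ∀ j, j < 5 → s₀.arr j = fun _ _ _ => 0)
    (hraw : ∀ i < n, ∀ j < n, s₀.raw (1 + i * n + j) = tab i j) :
    wp R B WA .count (fun s' τ' => CountPost n Δ tab s₀ s' ∧ τ' ≤ τ + 11 * n * n + 5 * n + 2)
      s₀ τ := by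
  have hnB : n ≤ B := by nlinarith
  have init : CountInv n Δ tab s₀ 0 0 s₀ := by
    refine ⟨h0, h1, rfl, rfl, fun _ _ => rfl, ?_, ?_, ?_, ?_, ?_⟩
    · intro v u hu; simp [pf] at hu
    · intro v c hc; simp [pf, harr]
    · intro v u hu; simp [pf] at hu
    · intro c hc; simp [harr]
    · intro c hc v hv; simp [pf] at hv
  refine wp_for (fun i s τ' => CountInv n Δ tab s₀ i 0 s ∧ τ' ≤ τ + i * (11 * n + 5) + 1) n hnB
    ⟨init.setV (by omega), by omega⟩ (fun i s τ' h _ => by simp [h.1.v0]) ?_ ?_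
  · rintro i hi s τ' ⟨h, hτ⟩ hi2
    refine wp_for (fun k s τ'' => s.v 2 = i ∧ CountInv n Δ tab s₀ i k s ∧
      τ'' ≤ τ' + 2 + k * 11) n hnB ⟨by simpa using hi2, h.setV (by omega), by omega⟩
      (fun i s τ' h _ => by simp [h.2.1.v0]) ?_ ?_
    · rintro k hk s τ'' ⟨h2, h, hτ⟩ h3
      refine wp_mono (wp_countBody hi hk hR hB hraw h h2 h3) ?_
      rintro s τ ⟨h2, h3, h4, h5⟩
      exact ⟨h3, by simpa using h2, h4.setV (by omega), by nlinarith⟩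
    · rintro s τ'' ⟨h2, h, hτ⟩
      exact ⟨h2, h.next.setV (by omega), by nlinarith⟩
  · rintro s τ' ⟨h, hτ⟩
    exact ⟨h.post, by nlinarith⟩

end FineGrained

namespace FineGrained

/-! ### Triangles with a node of low degree -/

/-- The edge `{i, j}` is part of a monochromatic triangle, in terms of the table of the graph. -/
def Tri (n : ℕ) (tab : ℕ → ℕ → ℕ) (i j : ℕ) : Prop :=
  tab i j ≠ 0 ∧ ∃ k < n, tab i k = tab i j ∧ tab j k = tab i j

/-- All marks are `0` or `1`, and only edges in monochromatic triangles are marked. -/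
def MarksSound (n : ℕ) (tab : ℕ → ℕ → ℕ) (A : ℕ → ℕ → ℕ → ℕ) : Prop :=
  ∀ i j, A i j 0 = 0 ∨ (A i j 0 = 1 ∧ Tri n tab i j)

/-- Three marks are set for a triangle with low corner `v` and neighbours `u`, `w`: the opposite
edge in the direction `(u, w)`, and `uv` in both directions. The remaining directions are covered
when `u` and `w` exchange roles. -/
def HProg.lowInner : HProg :=
  .seq (.setV 7 (.arr 2 (.v 2) (.v 4) (.v 6)))
  (.ite (.eq (.arr 0 (.v 3) (.v 7) (.lit 0)) (.v 4))
    (.seq (.setA 5 (.v 3) (.v 7) (.lit 0) (.lit 1))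
    (.seq (.setA 5 (.v 2) (.v 3) (.lit 0) (.lit 1))
      (.setA 5 (.v 3) (.v 2) (.lit 0) (.lit 1))))
    .skip)

def HProg.lowBody : HProg :=
  .seq (.setV 4 (.arr 0 (.v 2) (.v 3) (.lit 0)))
  (.ite (.v 4)
    (.seq (.setV 5 (.arr 1 (.v 2) (.v 4) (.lit 0)))
    (.ite (.lt (.v 1) (.v 5)) .skip (.for 6 (.v 5) .lowInner)))
    .skip)

def HProg.low : HProg := .for 2 (.v 0) (.for 3 (.v 0) .lowBody)

structure LowInv (n Δ : ℕ) (tab : ℕ → ℕ → ℕ) (s₀ : St) (D : ℕ → ℕ → ℕ → Prop) (s : St) :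
    Prop where
  v0 : s.v 0 = n
  v1 : s.v 1 = Δ
  vm : s.vm = s₀.vm
  arr : ∀ j, 6 ≤ j → s.arr j = s₀.arr j
  counted : Counted n Δ tab s.arr
  sound : MarksSound n tab (s.arr 5)
  done : ∀ v < n, ∀ u < n, ∀ w < n, D v u w → tab v u ≠ 0 → tab v w = tab v u →
    tab u w = tab v u → colDeg n tab (tab v u) v ≤ Δ →
    s.arr 5 u w 0 = 1 ∧ s.arr 5 v u 0 = 1 ∧ s.arr 5 u v 0 = 1

variable {R B WA n Δ : ℕ} {tab : ℕ → ℕ → ℕ} {s₀ s : St} {D D' : ℕ → ℕ → ℕ → Prop}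

theorem LowInv.setV (h : LowInv n Δ tab s₀ D s) {j x : ℕ}
    (hj : 2 ≤ j) : LowInv n Δ tab s₀ D (s.setV j x) :=
  ⟨by rw [St.setV_ne _ _ _ (by omega), h.v0], by rw [St.setV_ne _ _ _ (by omega), h.v1],
    h.vm, h.arr, h.counted, h.sound, h.done⟩

theorem LowInv.of_imp (h : LowInv n Δ tab s₀ D s)
    (hD : ∀ v < n, ∀ u < n, ∀ w < n, D' v u w → tab v u ≠ 0 → tab v w = tab v u →
      tab u w = tab v u → colDeg n tab (tab v u) v ≤ Δ → D v u w) :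
    LowInv n Δ tab s₀ D' s :=
  ⟨h.v0, h.v1, h.vm, h.arr, h.counted, h.sound, fun v hv u hu w hw h1 h2 h3 h4 h5 =>
    h.done v hv u hu w hw (hD v hv u hu w hw h1 h2 h3 h4 h5) h2 h3 h4 h5⟩

theorem MarksSound.setA (h : MarksSound n tab (s.arr 5)) {i j : ℕ} (hij : Tri n tab i j) :
    MarksSound n tab ((s.setA 5 i j 0 1).arr 5) := by
  intro i' j'
  rw [St.setA_self]
  split_ifs with h1
  · obtain ⟨rfl, rfl, -⟩ := h1; exact .inr ⟨rfl, hij⟩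
  · exact h i' j'

theorem setA_one {i j a b : ℕ} (h : s.arr 5 i j 0 = 1) : (s.setA 5 a b 0 1).arr 5 i j 0 = 1 := by
  rw [St.setA_self]; split_ifs <;> [rfl; exact h]

theorem LowInv.mark (h : LowInv n Δ tab s₀ D s) {i j : ℕ} (hij : Tri n tab i j) :
    LowInv n Δ tab s₀ D (s.setA 5 i j 0 1) := by
  refine ⟨h.v0, h.v1, h.vm, ?_, h.counted.setA (by omega) _ _ _ _, h.sound.setA hij, ?_⟩
  · intro k hk; rw [St.setA_ne _ _ _ _ _ _ (by omega), h.arr k hk]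
  · intro v hv u hu w hw h1 h2 h3 h4 h5
    obtain ⟨a, b, c⟩ := h.done v hv u hu w hw h1 h2 h3 h4 h5
    exact ⟨setA_one a, setA_one b, setA_one c⟩

/-- Every position below the number of neighbours of a color is the position of a neighbour. -/
theorem exists_count_eq {p : ℕ → Prop} [DecidablePred p] {d : ℕ} (hd : d < Nat.count p n) :
    ∃ w < n, p w ∧ Nat.count p w = d := by
  induction n with
  | zero => simp at hd
  | succ k ih =>
    rw [Nat.count_succ] at hd
    by_cases h : d < Nat.count p k
    · obtain ⟨w, hw, h1⟩ := ih h; exact ⟨w, by omega, h1⟩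
    · by_cases hp : p k
      · rw [if_pos hp] at hd; exact ⟨k, by omega, hp, by omega⟩
      · rw [if_neg hp] at hd; omega

theorem Counted.exists_nbr {A : ℕ → ℕ → ℕ → ℕ → ℕ} (h : Counted n Δ tab A) {v c d : ℕ}
    (hv : v < n) (hc : c ≠ 0) (hd : d < colDeg n tab c v) :
    ∃ w < n, tab v w = c ∧ Nat.count (fun u' => tab v u' = c) w = d ∧ A 2 v c d = w := by
  obtain ⟨w, hw, h1, h2⟩ := exists_count_eq hd
  have := h.nbr v hv w hw (by rw [h1]; exact hc)
  rw [h1, h2] at this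
  exact ⟨w, hw, h1, h2, this⟩

theorem wp_lowInner {τ v u d c : ℕ} (hsymm : ∀ i j, tab i j = tab j i)
    (hB : n * n + n + 1 ≤ B) (hv : v < n) (hu : u < n) (hc : c ≠ 0) (hvu : tab v u = c)
    (hd : d < colDeg n tab c v)
    (h : LowInv n Δ tab s₀ (fun v' u' w' => v' < v ∨ v' = v ∧ u' < u ∨
      v' = v ∧ u' = u ∧ Nat.count (fun u' => tab v u' = c) w' < d) s)
    (h2 : s.v 2 = v) (h3 : s.v 3 = u) (h4 : s.v 4 = c) (h6 : s.v 6 = d) :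
    wp R B WA .lowInner (fun s' τ' => s'.v 2 = v ∧ s'.v 3 = u ∧ s'.v 4 = c ∧ s'.v 6 = d ∧
      s'.v 5 = s.v 5 ∧
      LowInv n Δ tab s₀ (fun v' u' w' => v' < v ∨ v' = v ∧ u' < u ∨
        v' = v ∧ u' = u ∧ Nat.count (fun u' => tab v u' = c) w' < d + 1) s' ∧ τ' ≤ τ + 5)
      s τ := by
  obtain ⟨w, hw, hvw, hcw, hA⟩ := h.counted.exists_nbr hv hc hd
  have hnB : n ≤ B := by nlinarith
  have hT : s.arr 0 u w 0 = tab u w := h.counted.table u hu w hw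
  have hwu : ∀ w', tab v w' = c → Nat.count (fun u' => tab v u' = c) w' = d → w' = w := by
    intro w' h1 h2
    exact Nat.count_injective (p := fun u' => tab v u' = c) h1 hvw (by rw [h2, hcw])
  refine wp_seq (wp_setV (by intro _; simp [h2, h4, h6, hA]; omega) ?_)
  simp [h2, h4, h6, hA]
  refine wp_ite (fun ht => ?_) (fun ht => ?_)
  · have ht : tab u w = c := by
      by_contra hne; simp [h3, hT, h4, hne] at ht
    refine wp_seq (wp_setA (by intro _; simp; omega) ?_)
    refine wp_seq (wp_setA (by intro _; simp; omega) ?_)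
    refine wp_setA (by intro _; simp; omega) ?_
    simp [h2, h3, h4, h6]
    have t1 : Tri n tab u w := ⟨by rwa [ht], v, hv, by rw [hsymm u v, hvu, ht],
      by rw [hsymm w v, hvw, ht]⟩
    have t2 : Tri n tab v u := ⟨by rwa [hvu], w, hw, by rw [hvw, hvu], by rw [ht, hvu]⟩
    have t3 : Tri n tab u v := ⟨by rwa [hsymm, hvu], w, hw, by rw [hsymm u v, hvu, ht],
      by rw [hsymm u v, hvu, hvw]⟩
    have h' := (((h.setV (j := 7) (x := w) (by omega)).mark t1).mark t2).mark t3
    refine ⟨h'.v0, h'.v1, h'.vm, h'.arr, h'.counted, h'.sound, ?_⟩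
    intro v' hv' u' hu' w' hw' hD a1 a2 a3 a4
    by_cases hold : v' < v ∨ v' = v ∧ u' < u ∨
      v' = v ∧ u' = u ∧ Nat.count (fun u' => tab v u' = c) w' < d
    · exact h'.done v' hv' u' hu' w' hw' hold a1 a2 a3 a4
    · obtain ⟨rfl, rfl, hcd⟩ : v' = v ∧ u' = u ∧ Nat.count (fun u' => tab v u' = c) w' = d := by
        omega
      obtain rfl := hwu w' (by rw [a2, hvu]) hcd
      refine ⟨?_, ?_, ?_⟩ <;> simp [St.setA_self]
  · have ht : tab u w ≠ c := by
      intro hne; simp [h3, hT, h4, hne] at ht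
    refine wp_skip ⟨by simp [h2], by simp [h3], by simp [h4], by simp [h6], by simp,
      (h.setV (by omega)).of_imp ?_, by omega⟩
    intro v' hv' u' hu' w' hw' hD a1 a2 a3 a4
    by_contra hold
    obtain ⟨rfl, rfl, hcd⟩ : v' = v ∧ u' = u ∧ Nat.count (fun u' => tab v u' = c) w' = d := by
      omega
    obtain rfl := hwu w' (by rw [a2, hvu]) hcd
    exact ht (a3.trans hvu)

theorem wp_lowBody {τ v u : ℕ} (hsymm : ∀ i j, tab i j = tab j i)
    (hB : n * n + n + 1 ≤ B) (hv : v < n) (hu : u < n)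
    (h : LowInv n Δ tab s₀ (fun v' u' _ => v' < v ∨ v' = v ∧ u' < u) s)
    (h2 : s.v 2 = v) (h3 : s.v 3 = u) :
    wp R B WA .lowBody (fun s' τ' => s'.v 2 = v ∧ s'.v 3 = u ∧
      LowInv n Δ tab s₀ (fun v' u' _ => v' < v ∨ v' = v ∧ u' < u + 1) s' ∧ τ' ≤ τ + 7 * Δ + 6)
      s τ := by
  have hnB : n ≤ B := by nlinarith
  refine wp_seq (wp_setV (by intro hb; simpa using hb.arr _ _ _ _) ?_)
  simp [h2, h3, h.counted.table v hv u hu, -Order.lt_add_one_iff]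
  set c := tab v u with hc
  have next : ∀ {s'}, LowInv n Δ tab s₀ (fun v' u' _ => v' < v ∨ v' = v ∧ u' < u) s' →
      (c = 0 ∨ Δ < colDeg n tab c v) → 
      LowInv n Δ tab s₀ (fun v' u' _ => v' < v ∨ v' = v ∧ u' < u + 1) s' := by
    intro s' h' h0
    refine h'.of_imp ?_
    intro v' hv' u' hu' w' hw' hD a1 a2 a3 a4
    by_contra hold
    obtain ⟨rfl, rfl⟩ : v' = v ∧ u' = u := by omega
    rcases h0 with h0 | h0
    · exact a1 h0
    · rw [← hc] at a4; omega
  refine wp_ite (fun hc0 => ?_) (fun hc0 => ?_)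
  · simp at hc0
    refine wp_seq (wp_setV (by intro hb; simpa using hb.arr _ _ _ _) ?_)
    simp [h2, h.counted.deg v hv c hc0, -Order.lt_add_one_iff]
    refine wp_ite (fun hd => ?_) (fun hd => ?_)
    · have hd : Δ < colDeg n tab c v := by
        by_contra hne; simp [h.v1, hne] at hd
      exact wp_skip ⟨by simp [h2], by simp [h3], next ((h.setV (by omega)).setV (by omega))
        (.inr hd), by omega⟩
    · have hd : colDeg n tab c v ≤ Δ := by
        by_contra hne; simp [h.v1, hne] at hd
      refine wp_for (fun d s τ' => s.v 2 = v ∧ s.v 3 = u ∧ s.v 4 = c ∧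
          s.v 5 = colDeg n tab c v ∧
          LowInv n Δ tab s₀ (fun v' u' w' => v' < v ∨ v' = v ∧ u' < u ∨
            v' = v ∧ u' = u ∧ Nat.count (fun u' => tab v u' = c) w' < d) s ∧
          τ' ≤ τ + 5 + 7 * d) (colDeg n tab c v) ((Nat.count_le _).trans hnB) ?_ ?_ ?_ ?_
      · refine ⟨by simp [h2], by simp [h3], by simp, by simp, ?_, by omega⟩
        exact (((h.setV (by omega)).setV (by omega)).setV (by omega)).of_imp
          (by intro v' hv' u' hu' w' hw' hD _ _ _ _; omega)
      · rintro i s τ' ⟨_, _, _, h5, _⟩ _; simp [h5]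
      · rintro d hd' s τ' ⟨g2, g3, g4, g5, gI, gτ⟩ g6
        refine wp_mono (wp_lowInner hsymm hB hv hu hc0 hc.symm hd' gI g2 g3 g4 g6) ?_
        rintro s τ'' ⟨k2, k3, k4, k6, k5, kI, kτ⟩
        exact ⟨k6, by simp [k2], by simp [k3], by simp [k4], by simp [k5, g5],
          kI.setV (by omega), by omega⟩
      · rintro s τ' ⟨g2, g3, g4, g5, gI, gτ⟩
        refine ⟨g2, g3, gI.of_imp ?_, by omega⟩
        intro v' hv' u' hu' w' hw' hD a1 a2 a3 a4
        by_cases hvu : v' = v ∧ u' = u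
        · obtain ⟨rfl, rfl⟩ := hvu
          refine .inr (.inr ⟨rfl, rfl, ?_⟩)
          -- After the whole list has been scanned every neighbour of color `c` is done, because its
          -- rank is less than the degree.
          exact Nat.count_strict_mono (p := fun u'' => tab v' u'' = c) a2 hw'
        · omega
  · have hc0 : c = 0 := by simpa using hc0
    exact wp_skip ⟨by simp [h2], by simp [h3], next (h.setV (by omega)) (.inl hc0), by omega⟩

theorem wp_low {τ : ℕ} (hsymm : ∀ i j, tab i j = tab j i) (hB : n * n + n + 1 ≤ B)
    (h0 : s₀.v 0 = n) (h1 : s₀.v 1 = Δ) (hcounted : Counted n Δ tab s₀.arr)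
    (hres : s₀.arr 5 = fun _ _ _ => 0) :
    wp R B WA .low (fun s τ' => LowInv n Δ tab s₀ (fun _ _ _ => True) s ∧
      τ' ≤ τ + (7 * Δ + 8) * n * n + 4 * n + 2) s₀ τ := by
  have hnB : n ≤ B := by nlinarith
  have init : LowInv n Δ tab s₀ (fun _ _ _ => False) s₀ :=
    ⟨h0, h1, rfl, fun _ _ => rfl, hcounted, fun _ _ => .inl (by simp [hres]),
      fun _ _ _ _ _ _ h => h.elim⟩
  refine wp_for (fun i s τ' => LowInv n Δ tab s₀ (fun v _ _ => v < i) s ∧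
    τ' ≤ τ + i * ((7 * Δ + 8) * n + 4) + 1) n hnB
    ⟨(init.setV (by omega)).of_imp (by intros; omega), by omega⟩
    (fun i s τ' h _ => by simp [h.1.v0]) ?_ ?_
  · rintro i hi s τ' ⟨h, hτ⟩ hi2
    refine wp_for (fun k s τ'' => s.v 2 = i ∧
      LowInv n Δ tab s₀ (fun v u _ => v < i ∨ v = i ∧ u < k) s ∧
      τ'' ≤ τ' + 2 + k * (7 * Δ + 8)) n hnB
      ⟨by simpa using hi2, (h.setV (by omega)).of_imp (by intros; omega), by omega⟩
      (fun i s τ' h _ => by simp [h.2.1.v0]) ?_ ?_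
    · rintro k hk s τ'' ⟨h2, h, hτ⟩ h3
      refine wp_mono (wp_lowBody hsymm hB hi hk h h2 h3) ?_
      rintro s τ ⟨h2, h3, h4, h5⟩
      exact ⟨h3, by simpa using h2, h4.setV (by omega), by nlinarith⟩
    · rintro s τ'' ⟨h2, h, hτ⟩
      refine ⟨h2, (h.setV (by omega)).of_imp (by intros; omega), ?_⟩
      have : (i + 1) * ((7 * Δ + 8) * n + 4) = i * ((7 * Δ + 8) * n + 4) + n * (7 * Δ + 8) + 4 := by
        ring
      omega
  · rintro s τ' ⟨h, hτ⟩
    refine ⟨h.of_imp (fun v hv _ _ _ _ _ _ _ _ _ => hv), ?_⟩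
    have : n * ((7 * Δ + 8) * n + 4) = (7 * Δ + 8) * n * n + 4 * n := by ring
    omega

end FineGrained

namespace FineGrained

/-! ### Packing the nodes of high degree into products -/

/-- Bookkeeping for the bins: entry `(c, u)` of the array `6` is one more than the label of the node
`u` with respect to the color `c`, the arrays `7` and `8` hold the color and the node that belong
to a label, the array `9` the number of labels. The nonzero entries of the matrix of a bin are
listed in the arrays `10` and `11`, the array `12` holds their number, and the array `13` their
positions in the list. -/
structure BinCore (n Δ : ℕ) (tab : ℕ → ℕ → ℕ) (A : ℕ → ℕ → ℕ → ℕ → ℕ) : Prop where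
  lab : ∀ t c u x, A 6 t c u = x + 1 → x < A 9 t 0 0 ∧ A 7 t x 0 = c ∧ A 8 t x 0 = u
  who : ∀ t x, x < A 9 t 0 0 → A 6 t (A 7 t x 0) (A 8 t x 0) = x + 1 ∧ A 7 t x 0 ≠ 0 ∧
    A 8 t x 0 < n ∧ Δ < colDeg n tab (A 7 t x 0) (A 8 t x 0)
  ent : ∀ t j, j < A 12 t 0 0 → A 10 t j 0 < A 9 t 0 0 ∧ A 11 t j 0 < A 9 t 0 0 ∧
    A 13 t (A 10 t j 0) (A 11 t j 0) = j + 1 ∧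
    A 7 t (A 10 t j 0) 0 = A 7 t (A 11 t j 0) 0 ∧
    tab (A 8 t (A 11 t j 0) 0) (A 8 t (A 10 t j 0) 0) = A 7 t (A 11 t j 0) 0
  seen : ∀ t x y j, A 13 t x y = j + 1 → j < A 12 t 0 0 ∧ A 10 t j 0 = x ∧ A 11 t j 0 = y

/-- The matrix of bin `t` has an entry for the edge from `u` to the middle node `w` of color `c`. -/
def Entry (A : ℕ → ℕ → ℕ → ℕ → ℕ) (t c u w : ℕ) : Prop :=
  ∃ j < A 12 t 0 0, A 7 t (A 10 t j 0) 0 = c ∧ A 8 t (A 10 t j 0) 0 = u ∧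
    A 7 t (A 11 t j 0) 0 = c ∧ A 8 t (A 11 t j 0) 0 = w

/-- The array `6` stores labels shifted by one, so that the initial value `0` means that there is no
label yet. -/
def HProg.label (a : ℕ) : HProg :=
  .ite (.arr 6 (.v 9) (.v 4) (.v a)) .skip
    (.seq (.setA 7 (.v 9) (.arr 9 (.v 9) (.lit 0) (.lit 0)) (.lit 0) (.v 4))
    (.seq (.setA 8 (.v 9) (.arr 9 (.v 9) (.lit 0) (.lit 0)) (.lit 0) (.v a))
    (.seq (.setA 9 (.v 9) (.lit 0) (.lit 0) (.add (.arr 9 (.v 9) (.lit 0) (.lit 0)) (.lit 1)))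
      (.setA 6 (.v 9) (.v 4) (.v a) (.arr 9 (.v 9) (.lit 0) (.lit 0))))))

/-- Positions are looked up in the array `13`, again shifted by one, before they are listed. The
list is therefore free of repetitions by construction, as a sparse representation must be. -/
def HProg.insert : HProg :=
  .ite (.arr 13 (.v 9) (.v 10) (.v 11)) .skip
    (.seq (.setA 10 (.v 9) (.arr 12 (.v 9) (.lit 0) (.lit 0)) (.lit 0) (.v 10))
    (.seq (.setA 11 (.v 9) (.arr 12 (.v 9) (.lit 0) (.lit 0)) (.lit 0) (.v 11))
    (.seq (.setA 12 (.v 9) (.lit 0) (.lit 0) (.add (.arr 12 (.v 9) (.lit 0) (.lit 0)) (.lit 1)))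
      (.setA 13 (.v 9) (.v 10) (.v 11) (.arr 12 (.v 9) (.lit 0) (.lit 0))))))

variable {R B WA n Δ : ℕ} {tab : ℕ → ℕ → ℕ} {s : St} {A A' : ℕ → ℕ → ℕ → ℕ → ℕ}

/-- The new label `r` is the old number of labels. All data refer to labels below `r`, so the update
changes none of them, and the pair `(c, u)` had no label that could be lost. -/
theorem BinCore.label {t c u r : ℕ} (h : BinCore n Δ tab A) (hr : A 9 t 0 0 = r)
    (hc : c ≠ 0) (hu : u < n) (hhigh : Δ < colDeg n tab c u) (hnew : A 6 t c u = 0)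
    (h6 : ∀ t' c' u', A' 6 t' c' u' = if t' = t ∧ c' = c ∧ u' = u then r + 1 else A 6 t' c' u')
    (h7 : ∀ t' x, A' 7 t' x 0 = if t' = t ∧ x = r then c else A 7 t' x 0)
    (h8 : ∀ t' x, A' 8 t' x 0 = if t' = t ∧ x = r then u else A 8 t' x 0)
    (h9 : ∀ t', A' 9 t' 0 0 = if t' = t then r + 1 else A 9 t' 0 0)
    (hA : ∀ j, 10 ≤ j → A' j = A j) :
    BinCore n Δ tab A' ∧ ∀ t' c' u' w', Entry A t' c' u' w' → Entry A' t' c' u' w' := by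
  have keep : ∀ t' x, x < A 9 t' 0 0 → A' 7 t' x 0 = A 7 t' x 0 ∧ A' 8 t' x 0 = A 8 t' x 0 ∧
      x < A' 9 t' 0 0 := by
    intro t' x hx
    rw [h7, h8, h9]
    have : ¬ (t' = t ∧ x = r) := by rintro ⟨rfl, rfl⟩; omega
    rw [if_neg this, if_neg this]
    refine ⟨rfl, rfl, ?_⟩
    split_ifs with ht
    · subst ht; omega
    · exact hx
  have e10 := hA 10 (by omega)
  have e11 := hA 11 (by omega)
  have e12 := hA 12 (by omega)
  have e13 := hA 13 (by omega)
  refine ⟨⟨?_, ?_, ?_, ?_⟩, ?_⟩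
  · intro t' c' u' x hx
    rw [h6] at hx
    split_ifs at hx with h1
    · obtain ⟨rfl, rfl, rfl⟩ := h1
      obtain rfl : r = x := by omega
      rw [h7, h8, h9]; simp
    · obtain ⟨a, b, d⟩ := h.lab t' c' u' x hx
      obtain ⟨k1, k2, k3⟩ := keep t' x a
      exact ⟨k3, k1.trans b, k2.trans d⟩
  · intro t' x hx
    by_cases h1 : t' = t ∧ x = r
    · rw [h6, h7, h8, if_pos h1, if_pos h1, if_pos ⟨h1.1, rfl, rfl⟩]
      exact ⟨by rw [h1.2], hc, hu, hhigh⟩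
    · have hx' : x < A 9 t' 0 0 := by
        rw [h9] at hx
        split_ifs at hx with h2
        · subst h2; have : x ≠ r := fun h3 => h1 ⟨rfl, h3⟩
          omega
        · exact hx
      obtain ⟨a, b, d, e⟩ := h.who t' x hx'
      obtain ⟨k1, k2, k3⟩ := keep t' x hx'
      rw [h6, k1, k2, if_neg]
      · exact ⟨a, b, d, e⟩
      · rintro ⟨rfl, h3, h4⟩
        rw [h3, h4, hnew] at a; omega
  · intro t' j hj
    rw [e12] at hj
    obtain ⟨a, b, d, e, f⟩ := h.ent t' j hj
    obtain ⟨k1, k2, k3⟩ := keep t' _ a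
    obtain ⟨l1, l2, l3⟩ := keep t' _ b
    rw [e10, e11, e13, k1, k2, l1, l2]
    exact ⟨k3, l3, d, e, f⟩
  · rw [e10, e11, e12, e13]; exact h.seen
  · rintro t' c' u' w' ⟨j, hj, a, b, d, e⟩
    obtain ⟨p, q, -⟩ := h.ent t' j hj
    obtain ⟨k1, k2, k3⟩ := keep t' _ p
    obtain ⟨l1, l2, l3⟩ := keep t' _ q
    refine ⟨j, by rwa [e12], ?_⟩
    rw [e10, e11, k1, k2, l1, l2]
    exact ⟨a, b, d, e⟩

/-- The new list index `e` lies just beyond the old list and the position `(x, y)` was unseen, so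
the updates leave the old entries and their positions intact. -/
theorem BinCore.insert {t c u w x y e : ℕ} (h : BinCore n Δ tab A) (he : A 12 t 0 0 = e)
    (hx : A 6 t c u = x + 1) (hy : A 6 t c w = y + 1) (hwu : tab w u = c)
    (hnew : A 13 t x y = 0)
    (h10 : ∀ t' j, A' 10 t' j 0 = if t' = t ∧ j = e then x else A 10 t' j 0)
    (h11 : ∀ t' j, A' 11 t' j 0 = if t' = t ∧ j = e then y else A 11 t' j 0)
    (h12 : ∀ t', A' 12 t' 0 0 = if t' = t then e + 1 else A 12 t' 0 0)
    (h13 : ∀ t' x' y', A' 13 t' x' y' =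
      if t' = t ∧ x' = x ∧ y' = y then e + 1 else A 13 t' x' y')
    (hA : ∀ j, j < 10 → A' j = A j) :
    BinCore n Δ tab A' ∧ (∀ t' c' u' w', Entry A t' c' u' w' → Entry A' t' c' u' w') ∧
      Entry A' t c u w := by
  have e6 := hA 6 (by omega)
  have e7 := hA 7 (by omega)
  have e8 := hA 8 (by omega)
  have e9 := hA 9 (by omega)
  obtain ⟨hx1, hx2, hx3⟩ := h.lab t c u x hx
  obtain ⟨hy1, hy2, hy3⟩ := h.lab t c w y hy
  have keep : ∀ t' j, j < A 12 t' 0 0 → A' 10 t' j 0 = A 10 t' j 0 ∧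
      A' 11 t' j 0 = A 11 t' j 0 ∧ j < A' 12 t' 0 0 := by
    intro t' x hx
    rw [h10, h11, h12]
    have : ¬ (t' = t ∧ x = e) := by rintro ⟨rfl, rfl⟩; omega
    rw [if_neg this, if_neg this]
    refine ⟨rfl, rfl, ?_⟩
    split_ifs with ht
    · subst ht; omega
    · exact hx
  refine ⟨⟨?_, ?_, ?_, ?_⟩, ?_, ?_⟩
  · rw [e6, e7, e8, e9]; exact h.lab
  · rw [e6, e7, e8, e9]; exact h.who
  · intro t' j hj
    rw [e7, e8, e9]
    by_cases h1 : t' = t ∧ j = e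
    · obtain ⟨rfl, rfl⟩ := h1
      rw [h13, h10, h11]
      simp only [and_self, if_true]
      exact ⟨hx1, hy1, trivial, by rw [hx2, hy2], by rw [hx3, hy3, hy2, hwu]⟩
    · have hj' : j < A 12 t' 0 0 := by
        rw [h12] at hj
        split_ifs at hj with h2
        · subst h2; have : j ≠ e := fun h3 => h1 ⟨rfl, h3⟩
          omega
        · exact hj
      obtain ⟨a, b, d, f, g⟩ := h.ent t' j hj'
      obtain ⟨k1, k2, k3⟩ := keep t' _ hj'
      rw [h13, k1, k2, if_neg]
      · exact ⟨a, b, d, f, g⟩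
      · rintro ⟨rfl, h3, h4⟩
        rw [h3, h4, hnew] at d; omega
  · intro t' x' y' j hj
    rw [h13] at hj
    split_ifs at hj with h1
    · obtain ⟨rfl, rfl, rfl⟩ := h1
      obtain rfl : e = j := by omega
      rw [h10, h11, h12]; simp
    · obtain ⟨a, b, d⟩ := h.seen t' x' y' j hj
      obtain ⟨k1, k2, k3⟩ := keep t' j a
      exact ⟨k3, k1.trans b, k2.trans d⟩
  · rintro t' c' u' w' ⟨j, hj, a⟩
    obtain ⟨k1, k2, k3⟩ := keep t' _ hj
    refine ⟨j, k3, ?_⟩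
    rw [e7, e8, k1, k2]
    exact a
  · refine ⟨e, by rw [h12]; simp, ?_⟩
    rw [e7, e8, h10, h11]
    simp [hx2, hx3, hy2, hy3]

/-- The nodes that have a label in bin `t` with respect to the color `c`. -/
def labSet (n : ℕ) (A : ℕ → ℕ → ℕ → ℕ → ℕ) (t c : ℕ) : Finset ℕ :=
  (Finset.range n).filter fun u => A 6 t c u ≠ 0

theorem labSet_card_le : (labSet n A t c).card ≤ n :=
  (Finset.card_filter_le _ _).trans (by simp)

/-- The effect of giving a label to a node. -/
structure Labelled (n Δ : ℕ) (tab : ℕ → ℕ → ℕ) (t c u : ℕ) (s s' : St) : Prop where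
  v : s'.v = s.v
  vm : s'.vm = s.vm
  arr : ∀ j, j < 6 ∨ 10 ≤ j → s'.arr j = s.arr j
  core : BinCore n Δ tab s'.arr
  entry : ∀ t' c' u' w', Entry s.arr t' c' u' w' → Entry s'.arr t' c' u' w'
  has : s'.arr 6 t c u ≠ 0
  lab : ∀ u', s.arr 6 t c u' ≠ 0 → s'.arr 6 t c u' ≠ 0
  ne : ∀ t', t' ≠ t → s'.arr 9 t' 0 0 = s.arr 9 t' 0 0
  card : s'.arr 9 t 0 0 + (labSet n s.arr t c).card =
    s.arr 9 t 0 0 + (labSet n s'.arr t c).card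

theorem wp_label {τ a t c u : ℕ} (hB : 3 * n + 1 ≤ B) (h : BinCore n Δ tab s.arr)
    (hc : c ≠ 0) (hu : u < n) (hhigh : Δ < colDeg n tab c u)
    (hr : s.arr 9 t 0 0 ≤ 3 * n) (h9 : s.v 9 = t) (h4 : s.v 4 = c) (ha : s.v a = u) :
    wp R B WA (.label a) (fun s' τ' => Labelled n Δ tab t c u s s' ∧ τ' ≤ τ + 5) s τ := by
  refine wp_ite (fun h0 => ?_) (fun h0 => ?_)
  · simp [h9, h4, ha] at h0
    exact wp_skip ⟨⟨rfl, rfl, fun _ _ => rfl, h, fun _ _ _ _ h => h, h0, fun _ h => h,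
      fun _ _ => rfl, rfl⟩, by omega⟩
  · simp [h9, h4, ha] at h0
    refine wp_seq (wp_setA (fun hb => hb.v 4) ?_)
    refine wp_seq (wp_setA (fun hb => hb.v a) ?_)
    refine wp_seq (wp_setA (by intro _; simp [h9]; omega) ?_)
    refine wp_setA (by intro _; simp [h9]; omega) ?_
    simp [h9, h4, ha]
    set r := s.arr 9 t 0 0 with hrr
    set s' := (((s.setA 7 t r 0 c).setA 8 t r 0 u).setA 9 t 0 0 (r + 1)).setA 6 t c u (r + 1)
      with hs'
    have e6 : ∀ t' c' u', s'.arr 6 t' c' u' =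
        if t' = t ∧ c' = c ∧ u' = u then r + 1 else s.arr 6 t' c' u' := by
      intro t' c' u'; simp [hs', St.setA_self]
    have e9 : ∀ t', s'.arr 9 t' 0 0 = if t' = t then r + 1 else s.arr 9 t' 0 0 := by
      intro t'; simp [hs', St.setA_self]
    have hA : ∀ j, j < 6 ∨ 10 ≤ j → s'.arr j = s.arr j := by
      intro j hj
      rw [hs', St.setA_ne _ _ _ _ _ _ (by omega), St.setA_ne _ _ _ _ _ _ (by omega),
        St.setA_ne _ _ _ _ _ _ (by omega), St.setA_ne _ _ _ _ _ _ (by omega)]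
    obtain ⟨k1, k2⟩ := h.label (A' := s'.arr) hrr.symm hc hu hhigh h0 e6
      (by intro t' x; simp [hs', St.setA_self]) (by intro t' x; simp [hs', St.setA_self]) e9
      (fun j hj => hA j (.inr hj))
    refine ⟨rfl, rfl, hA, k1, k2, by rw [e6]; simp, ?_, fun t' ht' => by rw [e9, if_neg ht'], ?_⟩
    · intro u' hu'; rw [e6]; split_ifs <;> [omega; exact hu']
    · have : labSet n s'.arr t c = insert u (labSet n s.arr t c) := by
        ext u'
        simp only [labSet, Finset.mem_filter, Finset.mem_range, Finset.mem_insert, e6]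
        by_cases h1 : u' = u
        · subst h1; simp [hu]
        · simp [h1]
      rw [this, Finset.card_insert_of_notMem (by simp [labSet, h0]), e9, if_pos rfl]
      omega

/-- The effect of inserting an entry into the matrix of a bin. -/
structure Inserted (n Δ : ℕ) (tab : ℕ → ℕ → ℕ) (t c u w : ℕ) (s s' : St) : Prop where
  v : s'.v = s.v
  vm : s'.vm = s.vm
  arr : ∀ j, j < 10 → s'.arr j = s.arr j
  core : BinCore n Δ tab s'.arr
  entry : ∀ t' c' u' w', Entry s.arr t' c' u' w' → Entry s'.arr t' c' u' w'
  has : Entry s'.arr t c u w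
  ne : ∀ t', t' ≠ t → s'.arr 12 t' 0 0 = s.arr 12 t' 0 0
  card : s'.arr 12 t 0 0 ≤ s.arr 12 t 0 0 + 1

theorem wp_insert {τ t c u w x y e : ℕ} (hB : e + 1 ≤ B) (h : BinCore n Δ tab s.arr)
    (hx : s.arr 6 t c u = x + 1) (hy : s.arr 6 t c w = y + 1) (hwu : tab w u = c)
    (he : s.arr 12 t 0 0 = e) (h9 : s.v 9 = t) (h10 : s.v 10 = x) (h11 : s.v 11 = y) :
    wp R B WA .insert (fun s' τ' => Inserted n Δ tab t c u w s s' ∧ τ' ≤ τ + 5) s τ := by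
  obtain ⟨hx1, hx2, hx3⟩ := h.lab t c u x hx
  obtain ⟨hy1, hy2, hy3⟩ := h.lab t c w y hy
  refine wp_ite (fun h0 => ?_) (fun h0 => ?_)
  · simp [h9, h10, h11] at h0
    obtain ⟨a, b, d⟩ := h.seen t x y (s.arr 13 t x y - 1) (by omega)
    exact wp_skip ⟨⟨rfl, rfl, fun _ _ => rfl, h, fun _ _ _ _ h => h,
      ⟨_, a, by rw [b, hx2], by rw [b, hx3], by rw [d, hy2], by rw [d, hy3]⟩,
      fun _ _ => rfl, by omega⟩, by omega⟩
  · simp [h9, h10, h11] at h0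
    refine wp_seq (wp_setA (fun hb => hb.v 10) ?_)
    refine wp_seq (wp_setA (fun hb => hb.v 11) ?_)
    refine wp_seq (wp_setA (by intro _; simp [h9, he]; omega) ?_)
    refine wp_setA (by intro _; simp [h9, he]; omega) ?_
    simp [h9, h10, h11, he]
    set s' := (((s.setA 10 t e 0 x).setA 11 t e 0 y).setA 12 t 0 0 (e + 1)).setA 13 t x y (e + 1)
      with hs'
    have e12 : ∀ t', s'.arr 12 t' 0 0 = if t' = t then e + 1 else s.arr 12 t' 0 0 := by
      intro t'; simp [hs', St.setA_self]
    have hA : ∀ j, j < 10 → s'.arr j = s.arr j := by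
      intro j hj
      rw [hs', St.setA_ne _ _ _ _ _ _ (by omega), St.setA_ne _ _ _ _ _ _ (by omega),
        St.setA_ne _ _ _ _ _ _ (by omega), St.setA_ne _ _ _ _ _ _ (by omega)]
    obtain ⟨k1, k2, k3⟩ := h.insert (A' := s'.arr) he hx hy hwu h0
      (by intro t' x; simp [hs', St.setA_self]) (by intro t' x; simp [hs', St.setA_self]) e12
      (by intro t' x' y'; simp [hs', St.setA_self]) hA
    exact ⟨rfl, rfl, hA, k1, k2, k3, fun t' ht' => by rw [e12, if_neg ht'],
      by rw [e12, if_pos rfl, he]⟩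

end FineGrained

/-! ### Amortised analysis of the packing. -/

namespace FineGrained

/-- The number of edges at the first `k` nodes of high degree for the color `c`. -/
def hsum (n Δ : ℕ) (tab : ℕ → ℕ → ℕ) (c k : ℕ) : ℕ :=
  ∑ w ∈ (Finset.range n).filter fun w => Δ < colDeg n tab c w ∧
    Nat.count (fun v => Δ < colDeg n tab c v) w < k, colDeg n tab c w

/-- The number of edges at the nodes of high degree for the first `i` colors. -/
def htot (n Δ : ℕ) (tab : ℕ → ℕ → ℕ) (i : ℕ) : ℕ :=
  ∑ i' ∈ Finset.range i,
    hsum n Δ tab (i' + 1) (Nat.count (fun v => Δ < colDeg n tab (i' + 1) v) n)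

section
variable {n Δ : ℕ} {tab : ℕ → ℕ → ℕ} {c k w : ℕ}

theorem hsum_zero : hsum n Δ tab c 0 = 0 := by simp [hsum]

theorem hsum_succ (hw : w < n) (hhigh : Δ < colDeg n tab c w)
    (hk : Nat.count (fun v => Δ < colDeg n tab c v) w = k) :
    hsum n Δ tab c (k + 1) = hsum n Δ tab c k + colDeg n tab c w := by
  unfold hsum
  rw [add_comm _ (colDeg n tab c w), ← Finset.sum_insert (a := w) (by simp [hk])]
  congr 1
  ext v
  simp only [Finset.mem_filter, Finset.mem_range, Finset.mem_insert]
  constructor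
  · rintro ⟨h1, h2, h3⟩
    rcases Nat.lt_succ_iff_lt_or_eq.1 h3 with h3 | h3
    · exact .inr ⟨h1, h2, h3⟩
    · exact .inl (Nat.count_injective (p := fun v => Δ < colDeg n tab c v) h2 hhigh (by omega))
  · rintro (rfl | ⟨h1, h2, h3⟩)
    · exact ⟨hw, hhigh, by omega⟩
    · exact ⟨h1, h2, by omega⟩

/-- Every high node has more than `Δ` edges of its color, so these edges can pay `Δ` for each label
of the color. -/
theorem mul_card_le_hsum : Δ * Nat.count (fun v => Δ < colDeg n tab c v) n ≤
    hsum n Δ tab c (Nat.count (fun v => Δ < colDeg n tab c v) n) := by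
  have : (Finset.range n).filter (fun w => Δ < colDeg n tab c w ∧
      Nat.count (fun v => Δ < colDeg n tab c v) w <
        Nat.count (fun v => Δ < colDeg n tab c v) n) =
      (Finset.range n).filter (fun w => Δ < colDeg n tab c w) := by
    ext w
    simp only [Finset.mem_filter, Finset.mem_range]
    constructor
    · rintro ⟨h1, h2, -⟩; exact ⟨h1, h2⟩
    · rintro ⟨h1, h2⟩
      exact ⟨h1, h2, Nat.count_strict_mono (p := fun v => Δ < colDeg n tab c v) h2 h1⟩
  rw [hsum, this, Nat.count_eq_card_filter_range, mul_comm, ← smul_eq_mul]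
  exact Finset.card_nsmul_le_sum _ _ _ fun w hw => (Finset.mem_filter.1 hw).2.le

theorem hsum_mono {k l : ℕ} (h : k ≤ l) : hsum n Δ tab c k ≤ hsum n Δ tab c l := by
  refine Finset.sum_le_sum_of_subset fun w hw => ?_
  simp only [Finset.mem_filter] at hw ⊢
  exact ⟨hw.1, hw.2.1, by omega⟩

theorem htot_succ {i : ℕ} : htot n Δ tab (i + 1) = htot n Δ tab i +
    hsum n Δ tab (i + 1) (Nat.count (fun v => Δ < colDeg n tab (i + 1) v) n) :=
  Finset.sum_range_succ _ _

/-- For a fixed node the edges of different colors have disjoint sets of endpoints, so its degrees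
over all colors add up to at most `n`. -/
theorem htot_le (i : ℕ) : htot n Δ tab i ≤ n * n := by
  calc htot n Δ tab i ≤ ∑ i' ∈ Finset.range i, ∑ w ∈ Finset.range n, colDeg n tab (i' + 1) w :=
        Finset.sum_le_sum fun _ _ => Finset.sum_le_sum_of_subset (Finset.filter_subset _ _)
    _ = ∑ w ∈ Finset.range n, ∑ i' ∈ Finset.range i, colDeg n tab (i' + 1) w :=
        Finset.sum_comm
    _ ≤ ∑ w ∈ Finset.range n, n := by
        refine Finset.sum_le_sum fun w _ => ?_
        simp only [colDeg, Nat.count_eq_card_filter_range]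
        rw [← Finset.card_biUnion]
        · exact (Finset.card_le_card (Finset.biUnion_subset.2 fun _ _ =>
            Finset.filter_subset _ _)).trans (by simp)
        · intro a _ b _ hab
          rw [Function.onFun, Finset.disjoint_left]
          intro u hu hu'
          simp only [Finset.mem_filter] at hu hu'
          omega
    _ = n * n := by simp

end

def HProg.itemInner : HProg :=
  .seq (.setV 8 (.arr 2 (.v 7) (.v 4) (.v 5)))
  (.ite (.lt (.v 1) (.arr 1 (.v 8) (.v 4) (.lit 0)))
    (.seq (.label 8)
    (.seq (.setV 10 (.sub (.arr 6 (.v 9) (.v 4) (.v 8)) (.lit 1)))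
    (.seq (.setV 11 (.sub (.arr 6 (.v 9) (.v 4) (.v 7)) (.lit 1)))
      .insert)))
    .skip)

/-- All edges of one middle node go into one bin, since the two edges of a path through it must meet
in the same product. The bin is tested for closing only afterwards, which lets it exceed `Δn`
entries by at most `n`. The two tests are for `≥`, written as `<` with a successor, and their sum
acts as a disjunction. -/
def HProg.item : HProg :=
  .seq (.setV 7 (.arr 3 (.v 4) (.v 6) (.lit 0)))
  (.seq (.label 7)
  (.seq (.for 5 (.arr 1 (.v 7) (.v 4) (.lit 0)) .itemInner)
  (.ite (.add (.lt (.mul (.lit 2) (.v 0)) (.add (.arr 9 (.v 9) (.lit 0) (.lit 0)) (.lit 1)))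
      (.lt (.mul (.v 1) (.v 0)) (.add (.arr 12 (.v 9) (.lit 0) (.lit 0)) (.lit 1))))
    (.setV 9 (.add (.v 9) (.lit 1)))
    .skip)))

def HProg.bins : HProg :=
  .seq (.setV 9 (.lit 0))
  (.for 2 (.mul (.v 0) (.v 0))
    (.seq (.setV 4 (.add (.v 2) (.lit 1)))
      (.for 6 (.arr 4 (.v 4) (.lit 0) (.lit 0)) .item)))

/-- The state of the packing: `t` is the current bin, `c` the current color, `r₀` bounds the number
of labels of the bin that belong to other colors, and the middle nodes in `D` are done. -/
structure BinInv (n Δ : ℕ) (tab : ℕ → ℕ → ℕ) (s₀ : St) (D : ℕ → ℕ → Prop) (c F t r₀ G e : ℕ)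
    (s : St) : Prop where
  v0 : s.v 0 = n
  v1 : s.v 1 = Δ
  v9 : s.v 9 = t
  vm : s.vm = s₀.vm
  res : s.arr 5 = s₀.arr 5
  counted : Counted n Δ tab s.arr
  core : BinCore n Δ tab s.arr
  fresh : ∀ t' > t, s.arr 9 t' 0 0 = 0 ∧ s.arr 12 t' 0 0 = 0
  old : ∀ t' < t, s.arr 9 t' 0 0 ≤ 3 * n ∧ s.arr 12 t' 0 0 ≤ Δ * n + n ∧ s.arr 12 t' 0 0 ≤ G
  done : ∀ c' w, D c' w → c' ≠ 0 → w < n → Δ < colDeg n tab c' w →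
    ∃ t' ≤ t, ∀ u < n, Δ < colDeg n tab c' u → tab w u = c' → Entry s.arr t' c' u w
  r_le : r₀ ≤ 2 * n
  lab_le : s.arr 9 t 0 0 ≤ r₀ + (labSet n s.arr t c).card
  pot : Δ * n * t + Δ * r₀ + s.arr 12 t 0 0 ≤ F + G
  ent_le : s.arr 12 t 0 0 ≤ e
  ent_le' : s.arr 12 t 0 0 ≤ G

variable {R B WA n Δ : ℕ} {tab : ℕ → ℕ → ℕ} {s s₀ s' : St} {D D' : ℕ → ℕ → Prop}
  {c F t r₀ G e : ℕ}

theorem BinInv.setV (h : BinInv n Δ tab s₀ D c F t r₀ G e s) {j x : ℕ} (hj : 2 ≤ j)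
    (hj' : j ≠ 9) : BinInv n Δ tab s₀ D c F t r₀ G e (s.setV j x) :=
  ⟨by rw [St.setV_ne _ _ _ (by omega), h.v0], by rw [St.setV_ne _ _ _ (by omega), h.v1],
    by rw [St.setV_ne _ _ _ (by omega), h.v9], h.vm, h.res, h.counted, h.core, h.fresh, h.old,
    h.done, h.r_le, h.lab_le, h.pot, h.ent_le, h.ent_le'⟩

theorem BinInv.relax (h : BinInv n Δ tab s₀ D c F t r₀ G e s) {G' e' : ℕ} (hG : G ≤ G')
    (he : e ≤ e') : BinInv n Δ tab s₀ D c F t r₀ G' e' s :=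
  ⟨h.v0, h.v1, h.v9, h.vm, h.res, h.counted, h.core, h.fresh, fun t' ht' =>
    ⟨(h.old t' ht').1, (h.old t' ht').2.1, (h.old t' ht').2.2.trans hG⟩, h.done, h.r_le, h.lab_le,
    h.pot.trans (by omega), h.ent_le.trans he, h.ent_le'.trans hG⟩

theorem BinInv.of_imp (h : BinInv n Δ tab s₀ D c F t r₀ G e s)
    (hD : ∀ c' w, D' c' w → c' ≠ 0 → w < n → Δ < colDeg n tab c' w → D c' w ∨
      ∃ t' ≤ t, ∀ u < n, Δ < colDeg n tab c' u → tab w u = c' → Entry s.arr t' c' u w) :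
    BinInv n Δ tab s₀ D' c F t r₀ G e s :=
  ⟨h.v0, h.v1, h.v9, h.vm, h.res, h.counted, h.core, h.fresh, h.old, fun c' w h1 h2 h3 h4 =>
    (hD c' w h1 h2 h3 h4).elim (fun h5 => h.done c' w h5 h2 h3 h4) id, h.r_le, h.lab_le,
    h.pot, h.ent_le, h.ent_le'⟩

theorem Counted.congr {A A' : ℕ → ℕ → ℕ → ℕ → ℕ} (h : Counted n Δ tab A)
    (hA : ∀ j, j < 5 → A' j = A j) : Counted n Δ tab A' := by
  refine ⟨?_, ?_, ?_, ?_, ?_⟩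
  · rw [hA 0 (by omega)]; exact h.table
  · rw [hA 1 (by omega)]; exact h.deg
  · rw [hA 2 (by omega)]; exact h.nbr
  · rw [hA 4 (by omega)]; exact h.hc
  · rw [hA 3 (by omega)]; exact h.hl

theorem BinInv.rc_le (h : BinInv n Δ tab s₀ D c F t r₀ G e s) : s.arr 9 t 0 0 ≤ 3 * n := by
  have h1 := h.lab_le
  have h2 := h.r_le
  have h3 := labSet_card_le (n := n) (A := s.arr) (t := t) (c := c)
  omega

/-- A new label raises the number of labels and the number of labelled nodes of the current color
alike, so the contribution `r₀` of the other colors and the potential are unchanged. -/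
theorem BinInv.labelled {u : ℕ} (h : BinInv n Δ tab s₀ D c F t r₀ G e s)
    (hl : Labelled n Δ tab t c u s s') : BinInv n Δ tab s₀ D c F t r₀ G e s' := by
  have h12 := hl.arr 12 (by omega)
  refine ⟨by rw [hl.v, h.v0], by rw [hl.v, h.v1], by rw [hl.v, h.v9], by rw [hl.vm, h.vm],
    by rw [hl.arr 5 (by omega), h.res], h.counted.congr fun j hj => hl.arr j (by omega), hl.core,
    ?_, ?_, ?_, h.r_le, ?_, ?_, ?_, ?_⟩
  · intro t' ht'; rw [hl.ne t' (by omega), h12]; exact h.fresh t' ht'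
  · intro t' ht'; rw [hl.ne t' (by omega), h12]; exact h.old t' ht'
  · intro c' w h1 h2 h3 h4
    obtain ⟨t', ht', h5⟩ := h.done c' w h1 h2 h3 h4
    exact ⟨t', ht', fun u hu h6 h7 => hl.entry _ _ _ _ (h5 u hu h6 h7)⟩
  · have h1 := h.lab_le
    have h2 := hl.card
    omega
  · rw [h12]; exact h.pot
  · rw [h12]; exact h.ent_le
  · rw [h12]; exact h.ent_le'

theorem BinInv.inserted {u w : ℕ} (h : BinInv n Δ tab s₀ D c F t r₀ G e s)
    (hl : Inserted n Δ tab t c u w s s') :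
    BinInv n Δ tab s₀ D c F t r₀ (G + 1) (e + 1) s' := by
  have h9 := hl.arr 9 (by omega)
  have hcard := hl.card
  refine ⟨by rw [hl.v, h.v0], by rw [hl.v, h.v1], by rw [hl.v, h.v9], by rw [hl.vm, h.vm],
    by rw [hl.arr 5 (by omega), h.res], h.counted.congr fun j hj => hl.arr j (by omega), hl.core,
    ?_, ?_, ?_, h.r_le, ?_, ?_, ?_, ?_⟩
  · intro t' ht'; rw [hl.ne t' (by omega), h9]; exact h.fresh t' ht'
  · intro t' ht'; rw [hl.ne t' (by omega), h9]
    obtain ⟨a, b, d⟩ := h.old t' ht'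
    exact ⟨a, b, by omega⟩
  · intro c' w h1 h2 h3 h4
    obtain ⟨t', ht', h5⟩ := h.done c' w h1 h2 h3 h4
    exact ⟨t', ht', fun u hu h6 h7 => hl.entry _ _ _ _ (h5 u hu h6 h7)⟩
  · have h1 := h.lab_le
    rw [h9, labSet, hl.arr 6 (by omega)]; exact h1
  · have := h.pot; omega
  · have := h.ent_le; omega
  · have := h.ent_le'; omega

theorem wp_itemInner {τ w d : ℕ} (hB : 3 * n + 1 ≤ B) (hGB : G + 1 ≤ B) (hw : w < n) (hc : c ≠ 0)
    (hd : d < colDeg n tab c w)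
    (h : BinInv n Δ tab s₀ D c F t r₀ G e s) (hlab : s.arr 6 t c w ≠ 0)
    (hpart : ∀ u < n, Δ < colDeg n tab c u → tab w u = c →
      Nat.count (fun u' => tab w u' = c) u < d → Entry s.arr t c u w)
    (h4 : s.v 4 = c) (h5 : s.v 5 = d) (h7 : s.v 7 = w) :
    wp R B WA .itemInner (fun s' τ' => (∀ j < 8, s'.v j = s.v j) ∧
      BinInv n Δ tab s₀ D c F t r₀ (G + 1) (e + 1) s' ∧ s'.arr 6 t c w ≠ 0 ∧
      (∀ u < n, Δ < colDeg n tab c u → tab w u = c →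
        Nat.count (fun u' => tab w u' = c) u < d + 1 → Entry s'.arr t c u w) ∧ τ' ≤ τ + 14)
      s τ := by
  obtain ⟨u, hu, hwu, hcu, hA⟩ := h.counted.exists_nbr hw hc hd
  have huniq : ∀ u', tab w u' = c → Nat.count (fun u' => tab w u' = c) u' = d → u' = u := by
    intro u' h1 h2
    exact Nat.count_injective (p := fun u' => tab w u' = c) h1 hwu (by rw [h2, hcu])
  refine wp_seq (wp_setV (fun hb => hb.arr _ _ _ _) ?_)
  simp only [HExpr.eval, h7, h4, h5, hA]
  have hI := h.setV (j := 8) (x := u) (by omega) (by omega)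
  refine wp_ite (fun hhigh => ?_) (fun hhigh => ?_)
  · have hhigh : Δ < colDeg n tab c u := by
      by_contra hne; simp [h.v1, h4, h.counted.deg u hu c hc, hne] at hhigh
    refine wp_seq (wp_mono (wp_label (t := t) (c := c) hB hI.core hc hu hhigh hI.rc_le hI.v9
      (by simp [h4]) (by simp)) ?_)
    rintro s1 τ1 ⟨hl, hτ1⟩
    have hI1 := hI.labelled hl
    have hlab1 : s1.arr 6 t c w ≠ 0 := hl.lab w hlab
    have hv : ∀ j, j ≠ 8 → s1.v j = s.v j := fun j hj => by rw [hl.v, St.setV_ne _ _ _ hj]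
    have hv8 : s1.v 8 = u := by rw [hl.v, St.setV_self]
    have hu1 := hl.has
    refine wp_seq (wp_setV (fun hb => (Nat.sub_le _ _).trans (hb.arr _ _ _ _)) ?_)
    simp only [HExpr.eval, hI1.v9, hv 4 (by omega), hv8, h4]
    refine wp_seq (wp_setV (fun hb => (Nat.sub_le _ _).trans (hb.arr _ _ _ _)) ?_)
    have hev : HExpr.eval (s1.setV 10 (s1.arr 6 t c u - 1))
        (.sub (.arr 6 (.v 9) (.v 4) (.v 7)) (.lit 1)) = s1.arr 6 t c w - 1 := by
      simp [hI1.v9, hv, h4, h7]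
    rw [hev]
    have hI2 := (hI1.setV (j := 10) (x := s1.arr 6 t c u - 1) (by omega) (by omega)).setV (j := 11)
      (x := s1.arr 6 t c w - 1) (by omega) (by omega)
    refine wp_mono (wp_insert (t := t) (c := c) (u := u) (w := w) (x := s1.arr 6 t c u - 1)
      (y := s1.arr 6 t c w - 1) (e := s1.arr 12 t 0 0)
      (by have := hI1.ent_le'; omega) hI2.core ?_ ?_ hwu rfl hI2.v9 ?_ ?_) ?_
    · simp only [St.setV_arr]; omega
    · simp only [St.setV_arr]; omega
    · simp
    · simp
    rintro s2 τ2 ⟨hi, hτ2⟩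
    refine ⟨?_, hI2.inserted hi, ?_, ?_, by omega⟩
    · intro j hj
      rw [hi.v, St.setV_ne _ _ _ (by omega), St.setV_ne _ _ _ (by omega), hv j (by omega)]
    · rw [hi.arr 6 (by omega)]; exact hlab1
    · intro u' hu' h1 h2 h3
      by_cases h4 : Nat.count (fun u' => tab w u' = c) u' < d
      · exact hi.entry _ _ _ _ (hl.entry _ _ _ _ (hpart u' hu' h1 h2 h4))
      · obtain rfl := huniq u' h2 (by omega)
        exact hi.has
  · have hhigh : ¬ Δ < colDeg n tab c u := by
      intro hne; simp [h.v1, h4, h.counted.deg u hu c hc, hne] at hhigh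
    refine wp_skip ⟨fun j hj => St.setV_ne _ _ _ (by omega), hI.relax (by omega) (by omega),
      hlab, ?_, by omega⟩
    intro u' hu' h1 h2 h3
    by_cases h4 : Nat.count (fun u' => tab w u' = c) u' < d
    · exact hpart u' hu' h1 h2 h4
    · obtain rfl := huniq u' h2 (by omega)
      exact absurd h1 hhigh

/-- In the potential, `G` counts the edges at the middle nodes treated so far, and `F` those at the
high nodes of earlier colors, which pay for labels. Closing a bin costs `Δn`. Only labels of other
colors are charged, because those of the current color are paid for when the color is finished. -/
theorem wp_item {τ w k : ℕ} (hB : 3 * n + 1 ≤ B) (hΔ : 1 ≤ Δ)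
    (hGB : F + G + colDeg n tab c w + 1 ≤ B)
    (hw : w < n) (hc : c ≠ 0) (hhigh : Δ < colDeg n tab c w)
    (hk : Nat.count (fun v => Δ < colDeg n tab c v) w = k)
    (h : BinInv n Δ tab s₀ D c F t r₀ G (Δ * n) s) (hrc : s.arr 9 t 0 0 ≤ 2 * n)
    (h4 : s.v 4 = c) (h6 : s.v 6 = k) :
    wp R B WA .item (fun s' τ' => s'.v 2 = s.v 2 ∧ s'.v 4 = c ∧ s'.v 6 = k ∧ (∃ t' r',
      BinInv n Δ tab s₀ (fun c' w' => D c' w' ∨ c' = c ∧ w' = w) c F t' r'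
        (G + colDeg n tab c w) (Δ * n) s' ∧ s'.arr 9 t' 0 0 ≤ 2 * n) ∧
      τ' ≤ τ + 26 * colDeg n tab c w) s τ := by
  have hdn : colDeg n tab c w ≤ n := Nat.count_le _
  refine wp_seq (wp_setV (fun hb => hb.arr _ _ _ _) ?_)
  have hA : s.arr 3 c k 0 = w := by rw [← hk]; exact h.counted.hl c hc w hw hhigh
  simp only [HExpr.eval, h4, h6, hA]
  have hI := h.setV (j := 7) (x := w) (by omega) (by omega)
  refine wp_seq (wp_mono (wp_label (t := t) (c := c) hB hI.core hc hw hhigh hI.rc_le hI.v9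
      (by simp [h4]) (by simp)) ?_)
  rintro s1 τ1 ⟨hl, hτ1⟩
  have hI1 := hI.labelled hl
  have hv : ∀ j, j ≠ 7 → s1.v j = s.v j := fun j hj => by rw [hl.v, St.setV_ne _ _ _ hj]
  have hv7 : s1.v 7 = w := by rw [hl.v, St.setV_self]
  have hlab := hl.has
  refine wp_seq (wp_for (fun d s' τ' => (s'.v 2 = s.v 2 ∧ s'.v 4 = c ∧ s'.v 6 = k ∧ s'.v 7 = w) ∧
      BinInv n Δ tab s₀ D c F t r₀ (G + d) (Δ * n + d) s' ∧ s'.arr 6 t c w ≠ 0 ∧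
      (∀ u < n, Δ < colDeg n tab c u → tab w u = c →
        Nat.count (fun u' => tab w u' = c) u < d → Entry s'.arr t c u w) ∧
      τ' ≤ τ + 7 + 16 * d) (colDeg n tab c w) (by omega) ?_ ?_ ?_ ?_)
  · refine ⟨⟨?_, ?_, ?_, ?_⟩, hI1.setV (by omega) (by omega), hlab,
      fun _ _ _ _ h => absurd h (by omega), by omega⟩
    · rw [St.setV_ne _ _ _ (by omega), hv _ (by omega)]
    · rw [St.setV_ne _ _ _ (by omega), hv _ (by omega), h4]
    · rw [St.setV_ne _ _ _ (by omega), hv _ (by omega), h6]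
    · rw [St.setV_ne _ _ _ (by omega), hv7]
  · rintro d s' τ' ⟨⟨-, g4, -, g7⟩, gI, -⟩ -
    simp only [HExpr.eval, g7, g4, gI.counted.deg w hw c hc]
  · rintro d hd s' τ' ⟨⟨g2, g4, g6, g7⟩, gI, glab, gpart, gτ⟩ g5
    refine wp_mono (wp_itemInner hB (by omega) hw hc hd gI glab gpart g4 g5 g7) ?_
    rintro s'' τ'' ⟨kv, kI, klab, kpart, kτ⟩
    refine ⟨by rw [kv _ (by omega), g5], ⟨?_, ?_, ?_, ?_⟩, kI.setV (by omega) (by omega), klab,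
      kpart, by omega⟩
    · rw [St.setV_ne _ _ _ (by omega), kv _ (by omega), g2]
    · rw [St.setV_ne _ _ _ (by omega), kv _ (by omega), g4]
    · rw [St.setV_ne _ _ _ (by omega), kv _ (by omega), g6]
    · rw [St.setV_ne _ _ _ (by omega), kv _ (by omega), g7]
  rintro s2 τ2 ⟨⟨g2, g4, g6, g7⟩, gI, glab, gpart, gτ⟩
  have hD : BinInv n Δ tab s₀ (fun c' w' => D c' w' ∨ c' = c ∧ w' = w) c F t r₀
      (G + colDeg n tab c w) (Δ * n + colDeg n tab c w) s2 := by
    refine gI.of_imp ?_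
    rintro c' w' (h1 | ⟨rfl, rfl⟩) h2 h3 h4
    · exact .inl h1
    · exact .inr ⟨t, le_rfl, fun u hu h5 h6 => gpart u hu h5 h6
        (Nat.count_strict_mono (p := fun u' => tab w' u' = c') h6 hu)⟩
  refine wp_ite (fun hclose => ?_) (fun hclose => ?_)
  · have hclose : 2 * n ≤ s2.arr 9 t 0 0 ∨ Δ * n ≤ s2.arr 12 t 0 0 := by
      by_contra! hne
      refine hclose ?_
      simp only [HExpr.eval, gI.v0, gI.v1, gI.v9]
      rw [if_neg (by omega), if_neg (by omega)]
    -- If the bin is closed because of `2n` labels, at most `n` of them belong to the current color,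
    -- so `r₀ ≥ n` and the term `Δ r₀` pays; otherwise the entries pay `Δn`.
    have hpot : Δ * n * (t + 1) ≤ F + (G + colDeg n tab c w) := by
      have h1 := hD.pot
      rw [mul_add, mul_one]
      rcases hclose with h2 | h2
      · have h3 := hD.lab_le
        have h5 := labSet_card_le (n := n) (A := s2.arr) (t := t) (c := c)
        have h6 : Δ * n ≤ Δ * r₀ := Nat.mul_le_mul_left _ (by omega)
        omega
      · omega
    -- The potential also shows that the number of the new bin is small enough to be stored.
    have ht : t + 1 ≤ Δ * n * (t + 1) :=
      Nat.le_mul_of_pos_left _ (Nat.mul_pos (by omega) (by omega))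
    refine wp_setV (fun _ => by simp only [HExpr.eval, gI.v9]; omega) ?_
    simp only [HExpr.eval, gI.v9]
    have hf := hD.fresh (t + 1) (by omega)
    refine ⟨?_, ?_, ?_, ⟨t + 1, 0, ⟨?_, ?_, ?_, hD.vm, hD.res, hD.counted, hD.core, ?_, ?_, ?_,
      by omega, ?_, ?_, ?_, ?_⟩, ?_⟩, by omega⟩
    · rw [St.setV_ne _ _ _ (by omega), g2]
    · rw [St.setV_ne _ _ _ (by omega), g4]
    · rw [St.setV_ne _ _ _ (by omega), g6]
    · rw [St.setV_ne _ _ _ (by omega), hD.v0]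
    · rw [St.setV_ne _ _ _ (by omega), hD.v1]
    · rw [St.setV_self]
    · intro t' ht'; exact hD.fresh t' (by omega)
    · intro t' ht'
      by_cases h1 : t' = t
      · subst h1
        exact ⟨hD.rc_le, hD.ent_le.trans (by omega), hD.ent_le'⟩
      · exact hD.old t' (by omega)
    · intro c' w' h1 h2 h3 h5
      obtain ⟨t', ht', h6⟩ := hD.done c' w' h1 h2 h3 h5
      exact ⟨t', by omega, h6⟩
    · rw [St.setV_arr, hf.1]; omega
    · rw [St.setV_arr, hf.2]; omega
    · rw [St.setV_arr, hf.2]; omega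
    · rw [St.setV_arr, hf.2]; omega
    · rw [St.setV_arr, hf.1]; omega
  · have hopen : s2.arr 9 t 0 0 < 2 * n ∧ s2.arr 12 t 0 0 < Δ * n := by
      simp only [HExpr.eval, gI.v0, gI.v1, gI.v9] at hclose
      split_ifs at hclose <;> omega
    refine wp_skip ⟨g2, g4, g6, ⟨t, r₀, ⟨hD.v0, hD.v1, hD.v9, hD.vm, hD.res, hD.counted, hD.core,
      hD.fresh, hD.old, hD.done, hD.r_le, hD.lab_le, hD.pot, hopen.2.le, hD.ent_le'⟩,
      hopen.1.le⟩, by omega⟩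

/-- Going on to the next color. -/
theorem BinInv.next (h : BinInv n Δ tab s₀ D c F t r₀ G e s) (hrc : s.arr 9 t 0 0 ≤ 2 * n)
    {F' : ℕ} (hF : F + Δ * Nat.count (fun v => Δ < colDeg n tab c v) n ≤ F') (c₁ : ℕ) :
    BinInv n Δ tab s₀ D c₁ F' t (s.arr 9 t 0 0) G e s := by
  refine ⟨h.v0, h.v1, h.v9, h.vm, h.res, h.counted, h.core, h.fresh, h.old, h.done, hrc,
    Nat.le_add_right _ _, ?_, h.ent_le, h.ent_le'⟩
  -- Only high nodes receive labels, so the labels of the finished color number at most its high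
  -- nodes. These labels now move into `r₀`, and the increase of `F` pays for them.
  have h1 : (labSet n s.arr t c).card ≤ Nat.count (fun v => Δ < colDeg n tab c v) n := by
    rw [Nat.count_eq_card_filter_range]
    refine Finset.card_le_card fun u hu => ?_
    simp only [labSet, Finset.mem_filter] at hu ⊢
    refine ⟨hu.1, ?_⟩
    obtain ⟨h2, h3, h4⟩ := h.core.lab t c u (s.arr 6 t c u - 1) (by omega)
    have := (h.core.who t _ h2).2.2.2
    rwa [h3, h4] at this
  have h2 := h.lab_le
  have h3 : Δ * s.arr 9 t 0 0 ≤ Δ * r₀ + Δ * Nat.count (fun v => Δ < colDeg n tab c v) n := by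
    rw [← mul_add]; exact Nat.mul_le_mul_left _ (by omega)
  have := h.pot
  omega

/-- The state after the packing, with `t` the last bin. -/
structure BinPost (n Δ : ℕ) (tab : ℕ → ℕ → ℕ) (s₀ : St) (t : ℕ) (s : St) : Prop where
  v0 : s.v 0 = n
  v9 : s.v 9 = t
  vm : s.vm = s₀.vm
  res : s.arr 5 = s₀.arr 5
  counted : Counted n Δ tab s.arr
  core : BinCore n Δ tab s.arr
  bound : ∀ t' ≤ t, s.arr 9 t' 0 0 ≤ 3 * n ∧ s.arr 12 t' 0 0 ≤ Δ * n + n ∧ s.arr 12 t' 0 0 ≤ n * n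
  done : ∀ c ≠ 0, c ≤ n * n → ∀ w < n, Δ < colDeg n tab c w →
    ∃ t' ≤ t, ∀ u < n, Δ < colDeg n tab c u → tab w u = c → Entry s.arr t' c u w
  pot : Δ * n * t ≤ 2 * (n * n)

/-- At the end `F` and `G` are both at most `n²`, which gives the bound `2n²` on the potential. The
time is linear in the number of edges treated plus the number of colors. -/
theorem wp_bins {τ : ℕ} (hB : 2 * (n * n) + 3 * n + 1 ≤ B) (hΔ : 1 ≤ Δ ∨ n = 0)
    (h0 : s₀.v 0 = n) (h1 : s₀.v 1 = Δ) (hcounted : Counted n Δ tab s₀.arr)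
    (harr : ∀ j, 6 ≤ j → s₀.arr j = fun _ _ _ => 0) :
    wp R B WA .bins (fun s τ' => (∃ t, BinPost n Δ tab s₀ t s) ∧
      τ' ≤ τ + 33 * (n * n) + 3) s₀ τ := by
  have core : BinCore n Δ tab s₀.arr := by
    refine ⟨?_, ?_, ?_, ?_⟩
    · intro t c u x hx; simp [harr] at hx
    · intro t x hx; simp [harr] at hx
    · intro t x hx; simp [harr] at hx
    · intro t c u x hx; simp [harr] at hx
  have init : BinInv n Δ tab s₀ (fun _ _ => False) 1 0 0 0 0 (Δ * n) (s₀.setV 9 0) := by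
    refine ⟨by simpa using h0, by simpa using h1, by simp, rfl, rfl, hcounted, core, ?_, ?_, ?_,
      by omega, ?_, ?_, ?_, ?_⟩ <;> simp [harr]
  refine wp_seq (wp_setV (fun _ => Nat.zero_le _) ?_)
  simp only [HExpr.eval]
  refine wp_for (fun i s τ' => (∃ t r₀, BinInv n Δ tab s₀ (fun c' _ => c' < i + 1) (i + 1)
      (htot n Δ tab i) t r₀ (htot n Δ tab i) (Δ * n) s ∧ s.arr 9 t 0 0 ≤ 2 * n) ∧
      τ' ≤ τ + 2 + 6 * i + 27 * htot n Δ tab i) (n * n) (by omega) ?_ ?_ ?_ ?_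
  · refine ⟨⟨0, 0, ?_, by simp [harr]⟩, by omega⟩
    exact (init.setV (by omega) (by omega)).of_imp (by intros; omega)
  · rintro i s τ' ⟨⟨t, r₀, h, -⟩, -⟩ -
    simp only [HExpr.eval, h.v0]
  · rintro i hi s τ' ⟨⟨t, r₀, h, hrc⟩, hτ⟩ h2
    have hΔ : 1 ≤ Δ := hΔ.resolve_right (by rintro rfl; omega)
    refine wp_seq (wp_setV (fun _ => by simp only [HExpr.eval, h2]; omega) ?_)
    simp only [HExpr.eval, h2]
    set H := Nat.count (fun v => Δ < colDeg n tab (i + 1) v) n with hH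
    have hHn : H ≤ n := Nat.count_le _
    have htot1 : htot n Δ tab (i + 1) = htot n Δ tab i + hsum n Δ tab (i + 1) H := htot_succ
    have htotle := htot_le (n := n) (Δ := Δ) (tab := tab) (i + 1)
    refine wp_for (fun k s τ'' => (s.v 2 = i ∧ s.v 4 = i + 1) ∧ (∃ t r₀,
      BinInv n Δ tab s₀ (fun c' w' => c' < i + 1 ∨ c' = i + 1 ∧
        Nat.count (fun v => Δ < colDeg n tab c' v) w' < k) (i + 1)
      (htot n Δ tab i) t r₀ (htot n Δ tab i + hsum n Δ tab (i + 1) k) (Δ * n) s ∧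
      s.arr 9 t 0 0 ≤ 2 * n) ∧
      τ'' ≤ τ' + 3 + 27 * hsum n Δ tab (i + 1) k) H (by omega) ?_ ?_ ?_ ?_
    · refine ⟨⟨by simp [h2], by simp⟩, ⟨t, r₀, ?_, hrc⟩, by omega⟩
      rw [hsum_zero, add_zero]
      exact ((h.setV (by omega) (by omega)).setV (by omega) (by omega)).of_imp
        (by intros; omega)
    · rintro k s τ'' ⟨⟨-, g4⟩, ⟨t, r₀, g, -⟩, -⟩ -
      simp only [HExpr.eval, g4, g.counted.hc (i + 1) (by omega), hH]
    · rintro k hk s τ'' ⟨⟨g2, g4⟩, ⟨t, r₀, g, grc⟩, gτ⟩ g6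
      obtain ⟨w, hw, hhigh, hwk⟩ := exists_count_eq hk
      have hs := hsum_succ hw hhigh hwk
      have hs' : hsum n Δ tab (i + 1) (k + 1) ≤ hsum n Δ tab (i + 1) H := hsum_mono hk
      refine wp_mono (wp_item (by omega) hΔ (by omega) hw (by omega) hhigh hwk g grc g4 g6) ?_
      rintro s' τ3 ⟨k2, k4, k6, ⟨t', r', kI, krc⟩, kτ⟩
      refine ⟨k6, ⟨by simp [k2, g2], by simp [k4]⟩, ⟨t', r', ?_, krc⟩, ?_⟩
      · rw [hs, ← add_assoc]
        refine (kI.setV (by omega) (by omega)).of_imp ?_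
        rintro c' w' (h1 | ⟨rfl, h1⟩) h5 h6 h7
        · exact .inl (.inl (.inl h1))
        · left
          rcases Nat.lt_succ_iff_lt_or_eq.1 h1 with h1 | h1
          · exact .inl (.inr ⟨rfl, h1⟩)
          · exact .inr ⟨rfl, Nat.count_injective (p := fun v => Δ < colDeg n tab (i + 1) v) h7
              hhigh (by omega)⟩
      · omega
    · rintro s τ'' ⟨⟨g2, g4⟩, ⟨t, r₀, g, grc⟩, gτ⟩
      refine ⟨g2, ⟨t, s.arr 9 t 0 0, ?_, grc⟩, by omega⟩
      rw [← htot1] at g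
      refine ((g.next (F' := htot n Δ tab (i + 1)) grc ?_ (i + 1 + 1)).of_imp ?_).setV (by omega)
        (by omega)
      · rw [htot1]
        exact Nat.add_le_add_left mul_card_le_hsum _
      · intro c' w h1 h3 h4 h5
        left
        by_cases h6 : c' = i + 1
        · subst h6
          exact .inr ⟨rfl, Nat.count_strict_mono (p := fun v => Δ < colDeg n tab (i + 1) v) h5 h4⟩
        · omega
  · rintro s τ' ⟨⟨t, r₀, h, hrc⟩, hτ⟩
    have htotle := htot_le (n := n) (Δ := Δ) (tab := tab) (n * n)
    refine ⟨⟨t, h.v0, h.v9, h.vm, h.res, h.counted, h.core, ?_, ?_, ?_⟩, by omega⟩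
    · intro t' ht'
      rcases Nat.lt_or_eq_of_le ht' with h3 | rfl
      · obtain ⟨a, b, d⟩ := h.old t' h3
        exact ⟨a, b, d.trans htotle⟩
      · exact ⟨h.rc_le, h.ent_le.trans (by omega), h.ent_le'.trans htotle⟩
    · intro c hc hcn w hw hh
      exact h.done c w (by omega) hc hw hh
    · have := h.pot; omega

end FineGrained

namespace FineGrained

/-! ### Running the sparse matrix multiplication on all bins -/

/-- The input for the product of the matrix with the nonzero positions `(X j, Y j)` and its
transpose. -/
def binInput (N e : ℕ) (X Y : ℕ → ℕ) : List ℕ :=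
  [N, e, e] ++ (List.range e).flatMap (fun j => [X j, Y j]) ++
    (List.range e).flatMap (fun j => [Y j, X j])

theorem length_flatMap_pair (e : ℕ) (X Y : ℕ → ℕ) :
    ((List.range e).flatMap fun j => [X j, Y j]).length = 2 * e := by
  induction e with
  | zero => rfl
  | succ e ih => rw [List.range_succ, List.flatMap_append, List.length_append, ih]; simp; omega

theorem getD_flatMap_pair {e j : ℕ} (X Y : ℕ → ℕ) (hj : j < e) :
    ((List.range e).flatMap fun j => [X j, Y j]).getD (2 * j) 0 = X j ∧
    ((List.range e).flatMap fun j => [X j, Y j]).getD (2 * j + 1) 0 = Y j := by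
  induction e with
  | zero => omega
  | succ e ih =>
    have hl := length_flatMap_pair e X Y
    rw [List.range_succ, List.flatMap_append]
    by_cases h : j < e
    · rw [List.getD_append _ _ _ _ (by omega), List.getD_append _ _ _ _ (by omega)]
      exact ih h
    · obtain rfl : j = e := by omega
      rw [List.getD_append_right _ _ _ _ (by omega), List.getD_append_right _ _ _ _ (by omega), hl]
      simp

/-- The subroutine is specified only for the exact initial memory, including zeros behind the input,
so the virtual memory has to agree in every cell. -/
theorem eq_initMem_binInput {N e : ℕ} {X Y : ℕ → ℕ} {m : Mem} (h0 : m 0 = N) (h1 : m 1 = e)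
    (h2 : m 2 = e)
    (h : ∀ j < e, m (3 + 2 * j) = X j ∧ m (4 + 2 * j) = Y j ∧ m (3 + 2 * e + 2 * j) = Y j ∧
      m (4 + 2 * e + 2 * j) = X j)
    (hz : ∀ a, 3 + 4 * e ≤ a → m a = 0) : m = initMem (binInput N e X Y) := by
  have l1 := length_flatMap_pair e X Y
  have l2 := length_flatMap_pair e Y X
  funext a
  unfold initMem binInput
  by_cases a3 : a < 3
  · rw [List.append_assoc, List.getD_append _ _ _ _ (by simpa using a3)]
    interval_cases a <;> simp [h0, h1, h2]
  rw [List.append_assoc, List.getD_append_right _ _ _ _ (by simp; omega)]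
  simp only [List.length_cons, List.length_nil]
  by_cases ae : a < 3 + 2 * e
  · rw [List.getD_append _ _ _ _ (by omega)]
    obtain ⟨j, hj | hj⟩ : ∃ j, a = 3 + 2 * j ∨ a = 4 + 2 * j := ⟨(a - 3) / 2, by omega⟩
    · rw [show a - (0 + 1 + 1 + 1) = 2 * j by omega, (getD_flatMap_pair X Y (by omega)).1, hj,
        (h j (by omega)).1]
    · rw [show a - (0 + 1 + 1 + 1) = 2 * j + 1 by omega, (getD_flatMap_pair X Y (by omega)).2, hj,
        (h j (by omega)).2.1]
  rw [List.getD_append_right _ _ _ _ (by omega), l1]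
  by_cases ae' : a < 3 + 4 * e
  · obtain ⟨j, hj | hj⟩ : ∃ j, a = 3 + 2 * e + 2 * j ∨ a = 4 + 2 * e + 2 * j :=
      ⟨(a - 3 - 2 * e) / 2, by omega⟩
    · rw [show a - (0 + 1 + 1 + 1) - 2 * e = 2 * j by omega,
        (getD_flatMap_pair Y X (by omega)).1, hj, (h j (by omega)).2.2.1]
    · rw [show a - (0 + 1 + 1 + 1) - 2 * e = 2 * j + 1 by omega,
        (getD_flatMap_pair Y X (by omega)).2, hj, (h j (by omega)).2.2.2]
  · rw [hz a (by omega), List.getD_eq_default _ _ (by omega)]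

def HProg.copyBody : HProg :=
  .seq (.setVm (.v 14) (.add (.lit 3) (.mul (.lit 2) (.v 15))) (.arr 10 (.v 14) (.v 15) (.lit 0)))
  (.seq (.setVm (.v 14) (.add (.lit 4) (.mul (.lit 2) (.v 15)))
    (.arr 11 (.v 14) (.v 15) (.lit 0)))
  (.seq (.setVm (.v 14) (.add (.add (.lit 3) (.mul (.lit 2) (.arr 12 (.v 14) (.lit 0) (.lit 0))))
    (.mul (.lit 2) (.v 15))) (.arr 11 (.v 14) (.v 15) (.lit 0)))
  (.setVm (.v 14) (.add (.add (.lit 4) (.mul (.lit 2) (.arr 12 (.v 14) (.lit 0) (.lit 0))))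
    (.mul (.lit 2) (.v 15))) (.arr 10 (.v 14) (.v 15) (.lit 0)))))

def HProg.copy : HProg :=
  .seq (.setVm (.v 14) (.lit 0) (.mul (.lit 3) (.v 0)))
  (.seq (.setVm (.v 14) (.lit 1) (.arr 12 (.v 14) (.lit 0) (.lit 0)))
  (.seq (.setVm (.v 14) (.lit 2) (.arr 12 (.v 14) (.lit 0) (.lit 0)))
  (.for 15 (.arr 12 (.v 14) (.lit 0) (.lit 0)) .copyBody)))

def HProg.readBody : HProg :=
  .seq (.getVm 18 (.v 14) (.add (.mul (.v 16) (.mul (.lit 3) (.v 0))) (.v 17)))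
  (.ite (.v 18)
    (.seq (.setV 19 (.arr 7 (.v 14) (.v 16) (.lit 0)))
    (.seq (.setV 20 (.arr 8 (.v 14) (.v 16) (.lit 0)))
    (.seq (.setV 21 (.arr 8 (.v 14) (.v 17) (.lit 0)))
    (.ite (.eq (.arr 0 (.v 20) (.v 21) (.lit 0)) (.v 19))
      (.setA 5 (.v 20) (.v 21) (.lit 0) (.lit 1)) .skip))))
    .skip)

def HProg.read : HProg :=
  .for 16 (.mul (.lit 3) (.v 0)) (.for 17 (.mul (.lit 3) (.v 0)) .readBody)

def HProg.run (p : Program) : HProg :=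
  .for 14 (.add (.v 9) (.lit 1)) (.seq .copy (.seq (.call 14 p) .read))

variable {R B WA n Δ : ℕ} {tab : ℕ → ℕ → ℕ} {s s₀ : St}

theorem wp_copy {τ t e : ℕ} (hB : 3 * n ≤ B) (heB : e ≤ B) (h0 : s.v 0 = n) (h14 : s.v 14 = t)
    (he : s.arr 12 t 0 0 = e) (hvm : s.vm t = fun _ => 0) :
    wp R B WA .copy (fun s' τ' => (∀ j, j ≠ 15 → s'.v j = s.v j) ∧ s'.arr = s.arr ∧
      s'.raw = s.raw ∧
      (∀ t', t' ≠ t → s'.vm t' = s.vm t') ∧ s'.vm t =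
        initMem (binInput (3 * n) e (fun j => s.arr 10 t j 0) (fun j => s.arr 11 t j 0)) ∧
      τ' ≤ τ + 6 * e + 5) s τ := by
  refine wp_seq (wp_setVm (by intro _; simp [h0]; omega) ?_)
  refine wp_seq (wp_setVm (by intro _; simp [h14]; omega) ?_)
  refine wp_seq (wp_setVm (by intro _; simp [h14]; omega) ?_)
  simp [h14, h0, he]
  refine wp_for (fun k s' τ' => (∀ j, j ≠ 15 → s'.v j = s.v j) ∧ s'.arr = s.arr ∧
    s'.raw = s.raw ∧ (∀ t', t' ≠ t → s'.vm t' = s.vm t') ∧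
    (s'.vm t 0 = 3 * n ∧ s'.vm t 1 = e ∧ s'.vm t 2 = e ∧
      (∀ j < k, s'.vm t (3 + 2 * j) = s.arr 10 t j 0 ∧ s'.vm t (4 + 2 * j) = s.arr 11 t j 0 ∧
        s'.vm t (3 + 2 * e + 2 * j) = s.arr 11 t j 0 ∧
        s'.vm t (4 + 2 * e + 2 * j) = s.arr 10 t j 0) ∧
      ∀ a, 3 + 4 * e ≤ a → s'.vm t a = 0) ∧ τ' ≤ τ + 4 + 6 * k) e heB ?_ ?_ ?_ ?_
  · refine ⟨fun j hj => by simp [hj], rfl, rfl, fun t' ht' => by simp [ht'], ⟨?_, ?_, ?_, ?_, ?_⟩,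
      by omega⟩
    · simp
    · simp
    · simp
    · intro j hj; omega
    · intro a ha
      simp only [St.setV_vm, St.setVm_self]
      rw [Function.update_of_ne (by omega), Function.update_of_ne (by omega),
        Function.update_of_ne (by omega), hvm]
  · rintro k s' τ' ⟨hv, harr, -⟩ -
    simp [hv, harr, h14, he]
  · rintro k hk s' τ' ⟨hv, harr, hraw, hne, ⟨k0, k1, k2, kj, kz⟩, hτ⟩ h15
    have hv14 : s'.v 14 = t := by rw [hv _ (by omega), h14]
    refine wp_seq (wp_setVm (fun hb => hb.arr _ _ _ _) ?_)
    refine wp_seq (wp_setVm (fun hb => hb.arr _ _ _ _) ?_)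
    refine wp_seq (wp_setVm (fun hb => hb.arr _ _ _ _) ?_)
    refine wp_setVm (fun hb => hb.arr _ _ _ _) ?_
    simp only [HExpr.eval, St.setVm_v, St.setVm_arr, hv14, h15, harr, he, St.setVm_self]
    refine ⟨trivial, fun j hj => by simp [hj, hv], by simp [harr], by simp [hraw],
      fun t' ht' => by simp [ht', hne],
      ⟨?_, ?_, ?_, ?_, ?_⟩, by omega⟩
    · simp only [St.setV_vm, St.setVm_self]
      rw [Function.update_of_ne (by omega), Function.update_of_ne (by omega),
        Function.update_of_ne (by omega), Function.update_of_ne (by omega), k0]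
    · simp only [St.setV_vm, St.setVm_self]
      rw [Function.update_of_ne (by omega), Function.update_of_ne (by omega),
        Function.update_of_ne (by omega), Function.update_of_ne (by omega), k1]
    · simp only [St.setV_vm, St.setVm_self]
      rw [Function.update_of_ne (by omega), Function.update_of_ne (by omega),
        Function.update_of_ne (by omega), Function.update_of_ne (by omega), k2]
    · intro j hj
      simp only [St.setV_vm, St.setVm_self, Function.update_apply]
      by_cases hjk : j = k
      · subst hjk
        refine ⟨?_, ?_, ?_, ?_⟩
        · rw [if_neg (by omega), if_neg (by omega), if_neg (by omega), if_pos rfl]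
        · rw [if_neg (by omega), if_neg (by omega), if_pos rfl]
        · rw [if_neg (by omega), if_pos rfl]
        · rw [if_pos rfl]
      · obtain ⟨a, b, c, d⟩ := kj j (by omega)
        refine ⟨?_, ?_, ?_, ?_⟩
        · rw [if_neg (by omega), if_neg (by omega), if_neg (by omega), if_neg (by omega), a]
        · rw [if_neg (by omega), if_neg (by omega), if_neg (by omega), if_neg (by omega), b]
        · rw [if_neg (by omega), if_neg (by omega), if_neg (by omega), if_neg (by omega), c]
        · rw [if_neg (by omega), if_neg (by omega), if_neg (by omega), if_neg (by omega), d]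
    · intro a ha
      simp only [St.setV_vm, St.setVm_self]
      rw [Function.update_of_ne (by omega), Function.update_of_ne (by omega),
        Function.update_of_ne (by omega), Function.update_of_ne (by omega), kz a ha]
  · rintro s' τ' ⟨hv, harr, hraw, hne, ⟨k0, k1, k2, kj, kz⟩, hτ⟩
    exact ⟨hv, harr, hraw, hne, eq_initMem_binInput k0 k1 k2 kj kz, by omega⟩

/-- The state while the results of bin `t` are read from the memory `m`; the pairs of labels in `D`
are done. -/
structure ReadInv (n Δ : ℕ) (tab : ℕ → ℕ → ℕ) (s₀ : St) (D : ℕ → ℕ → Prop) (t : ℕ) (m : Mem)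
    (s : St) : Prop where
  v0 : s.v 0 = n
  v9 : s.v 9 = s₀.v 9
  v14 : s.v 14 = t
  arr : ∀ j, j ≠ 5 → s.arr j = s₀.arr j
  vm : s.vm t = m
  vm' : ∀ t' > t, s.vm t' = s₀.vm t'
  sound : MarksSound n tab (s.arr 5)
  mono : ∀ i j, s₀.arr 5 i j 0 = 1 → s.arr 5 i j 0 = 1
  done : ∀ x y, D x y → x < 3 * n → y < 3 * n → m (x * (3 * n) + y) ≠ 0 →
    tab (s₀.arr 8 t x 0) (s₀.arr 8 t y 0) = s₀.arr 7 t x 0 →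
    s.arr 5 (s₀.arr 8 t x 0) (s₀.arr 8 t y 0) 0 = 1

theorem ReadInv.setV {D : ℕ → ℕ → Prop} {t : ℕ} {m : Mem}
    (h : ReadInv n Δ tab s₀ D t m s) {j x : ℕ} (hj : 15 ≤ j) :
    ReadInv n Δ tab s₀ D t m (s.setV j x) :=
  ⟨by rw [St.setV_ne _ _ _ (by omega), h.v0], by rw [St.setV_ne _ _ _ (by omega), h.v9],
    by rw [St.setV_ne _ _ _ (by omega), h.v14], h.arr, h.vm, h.vm', h.sound, h.mono, h.done⟩

theorem ReadInv.of_imp {D D' : ℕ → ℕ → Prop} {t : ℕ} {m : Mem}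
    (h : ReadInv n Δ tab s₀ D t m s)
    (hD : ∀ x y, D' x y → x < 3 * n → y < 3 * n → m (x * (3 * n) + y) ≠ 0 →
      tab (s₀.arr 8 t x 0) (s₀.arr 8 t y 0) = s₀.arr 7 t x 0 → D x y) :
    ReadInv n Δ tab s₀ D' t m s :=
  ⟨h.v0, h.v9, h.v14, h.arr, h.vm, h.vm', h.sound, h.mono, fun x y h1 h2 h3 h4 h5 =>
    h.done x y (hD x y h1 h2 h3 h4 h5) h2 h3 h4 h5⟩

/-- A nonzero entry of the product says that the labels `x` and `y` share a column. A column label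
has the same color as each of its row labels, so `x` and `y` have one color, and it suffices to
compare the color of `x` with the edge between the two nodes. -/
theorem wp_readBody {τ t x y : ℕ} {m : Mem} (hB : 1 ≤ B)
    (hsymm : ∀ i j, tab i j = tab j i) (hcounted : Counted n Δ tab s₀.arr)
    (hcore : BinCore n Δ tab s₀.arr)
    (hm : m (x * (3 * n) + y) ≠ 0 → ∃ j < s₀.arr 12 t 0 0, ∃ j' < s₀.arr 12 t 0 0,
      s₀.arr 10 t j 0 = x ∧ s₀.arr 10 t j' 0 = y ∧ s₀.arr 11 t j 0 = s₀.arr 11 t j' 0)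
    (h : ReadInv n Δ tab s₀ (fun x' y' => x' < x ∨ x' = x ∧ y' < y) t m s)
    (h16 : s.v 16 = x) (h17 : s.v 17 = y) :
    wp R B WA .readBody (fun s' τ' => s'.v 16 = x ∧ s'.v 17 = y ∧
      ReadInv n Δ tab s₀ (fun x' y' => x' < x ∨ x' = x ∧ y' < y + 1) t m s' ∧ τ' ≤ τ + 7)
      s τ := by
  refine wp_seq (wp_getVm ?_)
  simp only [HExpr.eval, h.v14, h16, h17, h.v0, h.vm]
  have hI := h.setV (j := 18) (x := m (x * (3 * n) + y)) (by omega)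
  refine wp_ite (fun h0 => ?_) (fun h0 => ?_)
  · simp only [HExpr.eval, St.setV_self] at h0
    obtain ⟨j, hj, j', hj', rfl, rfl, hY⟩ := hm h0
    obtain ⟨a1, a2, a3, a4, a5⟩ := hcore.ent t j hj
    obtain ⟨b1, b2, b3, b4, b5⟩ := hcore.ent t j' hj'
    obtain ⟨c1, c2, c3, c4⟩ := hcore.who t _ a1
    obtain ⟨d1, d2, d3, d4⟩ := hcore.who t _ b1
    obtain ⟨e1, e2, e3, e4⟩ := hcore.who t _ a2
    refine wp_seq (wp_setV (fun hb => hb.arr _ _ _ _) ?_)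
    refine wp_seq (wp_setV (fun hb => hb.arr _ _ _ _) ?_)
    refine wp_seq (wp_setV (fun hb => hb.arr _ _ _ _) ?_)
    have E7 := h.arr 7 (by omega)
    have E8 := h.arr 8 (by omega)
    simp only [HExpr.eval, ne_eq, Nat.reduceEqDiff, not_false_eq_true, St.setV_ne, h.v14, h16,
      h17, St.setV_arr, E7, E8]
    set x := s₀.arr 10 t j 0 with hx
    set y := s₀.arr 10 t j' 0 with hy
    set c := s₀.arr 7 t x 0 with hc
    set u := s₀.arr 8 t x 0 with hu
    set v := s₀.arr 8 t y 0 with hv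
    have hI2 := ((hI.setV (j := 19) (x := c) (by omega)).setV (j := 20) (x := u) (by omega)).setV
      (j := 21) (x := v) (by omega)
    have hT : s.arr 0 u v 0 = tab u v := by rw [h.arr 0 (by omega)]; exact hcounted.table u c3 v d3
    refine wp_ite (fun ht => ?_) (fun ht => ?_)
    · have ht : tab u v = c := by
        by_contra hne; simp [hT, hne] at ht
      refine wp_setA (fun _ => hB) ?_
      -- The third corner is the node of the common column label.
      have htri : Tri n tab u v := by
        refine ⟨by rwa [ht], s₀.arr 8 t (s₀.arr 11 t j 0) 0, e3, ?_, ?_⟩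
        · rw [hsymm, a5, ht, ← a4]
        · rw [hsymm, hY, b5, ht, ← hY, ← a4]
      simp only [HExpr.eval, ne_eq, Nat.reduceEqDiff, not_false_eq_true, St.setV_ne, St.setV_self]
      refine ⟨by simp [h16], by simp [h17], ⟨hI2.v0, hI2.v9, hI2.v14, ?_, hI2.vm, hI2.vm',
        hI2.sound.setA htri, fun i k hik => setA_one (hI2.mono i k hik), ?_⟩, by omega⟩
      · intro k hk; rw [St.setA_ne _ _ _ _ _ _ hk, hI2.arr k hk]
      · intro x' y' hD h1 h2 h3 h4
        by_cases hxy : x' = x ∧ y' = y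
        · obtain ⟨rfl, rfl⟩ := hxy
          simp [hu, hv]
        · exact setA_one (hI2.done x' y' (by omega) h1 h2 h3 h4)
    · have ht : tab u v ≠ c := by
        intro hne; simp [hT, hne] at ht
      refine wp_skip ⟨by simp [h16], by simp [h17], hI2.of_imp ?_, by omega⟩
      intro x' y' hD h1 h2 h3 h4
      by_contra hne
      obtain ⟨rfl, rfl⟩ : x' = x ∧ y' = y := by omega
      exact ht h4
  · simp only [HExpr.eval, St.setV_self] at h0
    refine wp_skip ⟨by simp [h16], by simp [h17], hI.of_imp ?_, by omega⟩
    intro x' y' hD h1 h2 h3 h4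
    by_contra hne
    obtain ⟨rfl, rfl⟩ : x' = x ∧ y' = y := by omega
    exact h3 h0

theorem wp_read {τ t : ℕ} {m : Mem} (hB : 3 * n + 1 ≤ B)
    (hsymm : ∀ i j, tab i j = tab j i) (hcounted : Counted n Δ tab s₀.arr)
    (hcore : BinCore n Δ tab s₀.arr)
    (hm : ∀ x < 3 * n, ∀ y < 3 * n, m (x * (3 * n) + y) ≠ 0 →
      ∃ j < s₀.arr 12 t 0 0, ∃ j' < s₀.arr 12 t 0 0,
      s₀.arr 10 t j 0 = x ∧ s₀.arr 10 t j' 0 = y ∧ s₀.arr 11 t j 0 = s₀.arr 11 t j' 0)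
    (h : ReadInv n Δ tab s₀ (fun _ _ => False) t m s) :
    wp R B WA .read (fun s' τ' =>
      ReadInv n Δ tab s₀ (fun _ _ => True) t m s' ∧ τ' ≤ τ + 81 * n * n + 12 * n + 2) s τ := by
  refine wp_for (fun i s τ' => ReadInv n Δ tab s₀ (fun x _ => x < i) t m s ∧
    τ' ≤ τ + 1 + i * (27 * n + 4)) (3 * n) (by omega)
    ⟨(h.setV (by omega)).of_imp (by intros; omega), by omega⟩
    (fun i s τ' h _ => by simp [h.1.v0]) ?_ ?_
  · rintro i hi s τ' ⟨h, hτ⟩ hi2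
    refine wp_for (fun k s τ'' => s.v 16 = i ∧
      ReadInv n Δ tab s₀ (fun x y => x < i ∨ x = i ∧ y < k) t m s ∧
      τ'' ≤ τ' + 2 + k * 9) (3 * n) (by omega)
      ⟨by simpa using hi2, (h.setV (by omega)).of_imp (by intros; omega), by omega⟩
      (fun i s τ' h _ => by simp [h.2.1.v0]) ?_ ?_
    · rintro k hk s τ'' ⟨h2, h, hτ⟩ h3
      refine wp_mono (wp_readBody (by omega) hsymm hcounted hcore (hm i hi k hk) h h2 h3) ?_
      rintro s τ ⟨h2, h3, h4, h5⟩
      exact ⟨h3, by simpa using h2, h4.setV (by omega), by omega⟩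
    · rintro s τ'' ⟨h2, h, hτ⟩
      refine ⟨h2, (h.setV (by omega)).of_imp (by intros; omega), ?_⟩
      have : (i + 1) * (27 * n + 4) = i * (27 * n + 4) + 27 * n + 4 := by ring
      omega
  · rintro s τ' ⟨h, hτ⟩
    refine ⟨h.of_imp (fun x y _ hx _ _ _ => hx), ?_⟩
    have : 3 * n * (27 * n + 4) = 81 * n * n + 12 * n := by ring
    omega

/-- On every matrix that fits into a bin, the program computes the product of the matrix with its
transpose in at most `T` steps. -/
def MulCorrect (WA n Δ T : ℕ) (p : Program) : Prop :=
  ∀ (e : ℕ) (X Y : ℕ → ℕ), e ≤ Δ * n + n → (e ≠ 0 → Δ < n) →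
    (∀ j < e, X j < 3 * n ∧ Y j < 3 * n) →
    (∀ j < e, ∀ j' < e, X j = X j' → Y j = Y j' → j = j') →
    ∃ t m, t ≤ T ∧ Exec WA p (initMem (binInput (3 * n) e X Y)) t m ∧
      ∀ x < 3 * n, ∀ y < 3 * n, m (x * (3 * n) + y) ≠ 0 ↔
        ∃ j < e, ∃ j' < e, X j = x ∧ X j' = y ∧ Y j = Y j'

/-- The state when the bins below `k` have been multiplied. -/
structure RunInv (n Δ : ℕ) (tab : ℕ → ℕ → ℕ) (s₀ : St) (k : ℕ) (s : St) : Prop where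
  v0 : s.v 0 = n
  v9 : s.v 9 = s₀.v 9
  arr : ∀ j, j ≠ 5 → s.arr j = s₀.arr j
  vm : ∀ t ≥ k, s.vm t = s₀.vm t
  sound : MarksSound n tab (s.arr 5)
  mono : ∀ i j, s₀.arr 5 i j 0 = 1 → s.arr 5 i j 0 = 1
  done : ∀ t < k, ∀ c u w v, Entry s₀.arr t c u w → Entry s₀.arr t c v w → tab u v = c →
    s.arr 5 u v 0 = 1

theorem wp_run {τ t T : ℕ} {s₁ : St} {p : Program} (hWA : WA ≤ B)
    (hB : 2 * (n * n) + 3 * n + 1 ≤ B)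
    (htB : t + 1 ≤ B) (hsymm : ∀ i j, tab i j = tab j i) (hp : MulCorrect WA n Δ T p)
    (hpost : BinPost n Δ tab s₁ t s₀) (hvm : s₀.vm = fun _ _ => 0)
    (hsound : MarksSound n tab (s₀.arr 5)) :
    wp R B WA (.run p) (fun s τ' => RunInv n Δ tab s₀ (t + 1) s ∧
      τ' ≤ τ + 2 + (t + 1) * (T + 87 * (n * n) + 12 * n + 9)) s₀ τ := by
  refine wp_for (fun k s τ' => RunInv n Δ tab s₀ k s ∧
    τ' ≤ τ + 1 + k * (T + 87 * (n * n) + 12 * n + 9)) (t + 1) htB ?_ ?_ ?_ ?_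
  · refine ⟨⟨?_, ?_, fun _ _ => rfl, fun _ _ => rfl, hsound, fun _ _ h => h, ?_⟩, by omega⟩
    · rw [St.setV_ne _ _ _ (by omega), hpost.v0]
    · rw [St.setV_ne _ _ _ (by omega)]
    · intro t ht; omega
  · rintro k s τ' ⟨h, -⟩ -
    simp only [HExpr.eval, h.v9, hpost.v9]
  · rintro k hk s τ' ⟨h, hτ⟩ h14
    have E12 := h.arr 12 (by omega)
    have E10 := h.arr 10 (by omega)
    have E11 := h.arr 11 (by omega)
    obtain ⟨r1, r2, r3⟩ := hpost.bound k (by omega)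
    set e := s₀.arr 12 k 0 0 with he
    refine wp_seq (wp_mono (wp_copy (t := k) (e := e) (by omega) (by omega) h.v0 h14 (by rw [E12])
      (by rw [h.vm k le_rfl, hvm])) ?_)
    rintro s1 τ1 ⟨k1, k2, -, k3, k4, k5⟩
    rw [E10, E11] at k4
    obtain ⟨tm, m, htm, hex, hm⟩ := hp e (fun j => s₀.arr 10 k j 0) (fun j => s₀.arr 11 k j 0) r2
      -- A nonempty bin contains a node of degree greater than `Δ`, and degrees are at most `n`.
      (by
        intro he0
        obtain ⟨a1, -⟩ := hpost.core.ent k 0 (by omega)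
        exact ((hpost.core.who k _ a1).2.2.2).trans_le (Nat.count_le _))
      (fun j hj => by
        obtain ⟨a1, a2, -⟩ := hpost.core.ent k j hj
        exact ⟨by omega, by omega⟩)
      -- The array `13` recovers the list index from the position, so no position is listed twice.
      (fun j hj j' hj' hX hY => by
        obtain ⟨-, -, a3, -⟩ := hpost.core.ent k j hj
        obtain ⟨-, -, b3, -⟩ := hpost.core.ent k j' hj'
        rw [hX, hY, b3] at a3
        omega)
    have h1v14 : s1.v 14 = k := by rw [k1 _ (by omega), h14]
    refine wp_seq (wp_call hWA (by rw [h1v14, k4]; exact hex) ?_)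
    rw [h1v14]
    have hR : ReadInv n Δ tab s₀ (fun _ _ => False) k m (s1.setVm k m) := by
      refine ⟨?_, ?_, h1v14, ?_, by simp, ?_, ?_, ?_, fun _ _ h => h.elim⟩
      · rw [St.setVm_v, k1 _ (by omega), h.v0]
      · rw [St.setVm_v, k1 _ (by omega), h.v9]
      · intro j hj; rw [St.setVm_arr, k2, h.arr j hj]
      · intro t' ht'
        rw [St.setVm_ne _ _ _ (by omega), k3 _ (by omega), h.vm _ (by omega)]
      · rw [St.setVm_arr, k2]; exact h.sound
      · rw [St.setVm_arr, k2]; exact h.mono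
    have h5 : ∀ i j, s.arr 5 i j 0 = 1 → s1.arr 5 i j 0 = 1 := by rw [k2]; exact fun _ _ h => h
    -- The reading phase takes the state after the call as its reference point, so that the marks
    -- made by earlier bins and by the low-degree phase survive by monotonicity.
    have hR' : ReadInv n Δ tab (s1.setVm k m) (fun _ _ => False) k m (s1.setVm k m) :=
      ⟨hR.v0, rfl, hR.v14, fun _ _ => rfl, hR.vm, fun _ _ => rfl, hR.sound, fun _ _ h => h,
        fun _ _ h => h.elim⟩
    have harr : ∀ j, j ≠ 5 → (s1.setVm k m).arr j = s₀.arr j := hR.arr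
    have hcore : BinCore n Δ tab (s1.setVm k m).arr := by
      refine ⟨?_, ?_, ?_, ?_⟩ <;>
      simp only [harr 6 (by omega), harr 7 (by omega), harr 8 (by omega), harr 9 (by omega),
        harr 10 (by omega), harr 11 (by omega), harr 12 (by omega), harr 13 (by omega)]
      · exact hpost.core.lab
      · exact hpost.core.who
      · exact hpost.core.ent
      · exact hpost.core.seen
    refine wp_mono (wp_read (m := m) (t := k) (by omega) hsymm
      (hpost.counted.congr fun j hj => harr j (by omega)) hcore
      (fun x hx y hy hxy => by
        rw [harr 10 (by omega), harr 11 (by omega), harr 12 (by omega)]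
        exact (hm x hx y hy).1 hxy) hR') ?_
    rintro s2 τ2 ⟨g, gτ⟩
    refine ⟨g.v14, ⟨?_, ?_, ?_, ?_, g.sound, ?_, ?_⟩, ?_⟩
    · rw [St.setV_ne _ _ _ (by omega), g.v0]
    · rw [St.setV_ne _ _ _ (by omega), g.v9, hR.v9]
    · intro j hj; rw [St.setV_arr, g.arr j hj, harr j hj]
    · intro t' ht'; rw [St.setV_vm, g.vm' t' (by omega), hR.vm' t' (by omega)]
    · intro i j hij; exact g.mono i j (h5 i j (h.mono i j hij))
    · intro t' ht' c u w v hu hv huv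
      rw [St.setV_arr]
      by_cases htk : t' = k
      · subst htk
        obtain ⟨j, hj, u1, u2, u3, u4⟩ := hu
        obtain ⟨j', hj', v1, v2, v3, v4⟩ := hv
        obtain ⟨a1, a2, -⟩ := hpost.core.ent t' j hj
        obtain ⟨b1, b2, -⟩ := hpost.core.ent t' j' hj'
        have a3 := (hpost.core.who t' _ a2).1
        have b3 := (hpost.core.who t' _ b2).1
        rw [u3, u4] at a3
        rw [v3, v4] at b3
        -- Both columns are labels of the pair `(c, w)` and a pair has only one label, so the two
        -- rows meet in a column of the product.
        have hY : s₀.arr 11 t' j 0 = s₀.arr 11 t' j' 0 := by omega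
        have h6 := g.done (s₀.arr 10 t' j 0) (s₀.arr 10 t' j' 0) trivial (by omega) (by omega)
          ((hm _ (by omega) _ (by omega)).2 ⟨j, hj, j', hj', rfl, rfl, hY⟩)
        rw [harr 7 (by omega), harr 8 (by omega), u1, u2, v2] at h6
        exact h6 huv
      · exact g.mono u v (h5 u v (h.done t' (by omega) c u w v hu hv huv))
    · have : (k + 1) * (T + 87 * (n * n) + 12 * n + 9) =
        k * (T + 87 * (n * n) + 12 * n + 9) + (T + 87 * (n * n) + 12 * n + 9) := by ring
      have h81 : 81 * n * n = 81 * (n * n) := by ring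
      omega
  · rintro s τ' ⟨h, hτ⟩
    exact ⟨h, by omega⟩

end FineGrained

namespace FineGrained

/-! ### The complete reduction -/

def HExpr.pow (e : HExpr) : ℕ → HExpr
  | 0 => .lit 1
  | k + 1 => .mul (e.pow k) e

theorem HExpr.eval_pow (s : St) (e : HExpr) (k : ℕ) : (e.pow k).eval s = e.eval s ^ k := by
  induction k with
  | zero => rfl
  | succ k ih => simp [pow, ih, pow_succ]

/-- The integer part of the `q`-th root of `n`. -/
def iroot (q n : ℕ) : ℕ := Nat.findGreatest (fun x => x ^ q ≤ n) n

theorem iroot_pow_le {q : ℕ} (hq : q ≠ 0) (n : ℕ) : iroot q n ^ q ≤ n :=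
  Nat.findGreatest_spec (P := fun x => x ^ q ≤ n) (m := 0) (Nat.zero_le _) (by simp [hq])

theorem lt_iroot_succ_pow {q : ℕ} (hq : q ≠ 0) (n : ℕ) : n < (iroot q n + 1) ^ q := by
  by_contra! h
  by_cases hn : iroot q n + 1 ≤ n
  · exact Nat.findGreatest_is_greatest (P := fun x => x ^ q ≤ n) (Nat.lt_succ_self _) hn h
  · have := Nat.le_self_pow hq (iroot q n + 1)
    omega

theorem iroot_le (q n : ℕ) : iroot q n ≤ n := Nat.findGreatest_le _

/-- The degree threshold. -/
def threshold (q a n₀ n : ℕ) : ℕ := if n < n₀ then n else iroot q n ^ a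

theorem one_le_threshold {q a n₀ n : ℕ} (hn : 1 ≤ n) : 1 ≤ threshold q a n₀ n := by
  unfold threshold
  split_ifs
  · exact hn
  · refine Nat.one_le_pow _ _ ?_
    exact Nat.le_findGreatest hn (by simpa using hn)

/-- Incrementing a counter finds the integer `q`-th root in at most `n` rounds, using no operations
beyond powers with fixed exponents. This is why the exponent of the threshold is a rational number
`a / q`. -/
def HProg.param (q a n₀ : ℕ) : HProg :=
  .seq (.setV 23 (.lit 0))
  (.seq (.loop (.lt ((HExpr.add (.v 23) (.lit 1)).pow q) (.add (.v 0) (.lit 1)))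
    (.setV 23 (.add (.v 23) (.lit 1))))
  (.ite (.lt (.v 0) (.lit n₀)) (.setV 1 (.v 0)) (.setV 1 ((HExpr.v 23).pow a))))

/-- Cell `0` holds the start of the free memory and is never overwritten. It would be the answer for
the pair `(0, 0)`, which is no edge. -/
def HProg.output : HProg :=
  .for 2 (.v 0) (.for 3 (.v 0)
    (.seq (.setV 22 (.add (.mul (.v 2) (.v 0)) (.v 3)))
      (.ite (.v 22) (.setRaw (.v 22) (.arr 5 (.v 2) (.v 3) (.lit 0))) .skip)))

def HProg.main (q a n₀ : ℕ) (p : Program) : HProg :=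
  .ite (.v 0) (.seq (.param q a n₀) (.seq .count (.seq .low (.seq .bins (.seq (.run p) .output)))))
    .skip

variable {R B WA n : ℕ} {tab : ℕ → ℕ → ℕ} {s : St}

theorem wp_param {q a n₀ τ : ℕ} (hq : q ≠ 0) (hB : n + n ^ a ≤ B) (h0 : s.v 0 = n) :
    wp R B WA (.param q a n₀) (fun s' τ' => (s'.v 0 = n ∧ s'.v 1 = threshold q a n₀ n ∧
      s'.arr = s.arr ∧ s'.raw = s.raw ∧ s'.vm = s.vm) ∧ τ' ≤ τ + 2 * n + 4) s τ := by
  refine wp_seq (wp_setV (fun _ => Nat.zero_le _) ?_)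
  have hx := iroot_le q n
  refine wp_seq (wp_loop (I := fun i s' τ' => s'.v 23 = i ∧ s'.v 0 = n ∧
      (s'.arr = s.arr ∧ s'.raw = s.raw ∧ s'.vm = s.vm) ∧ τ' = τ + 1 + 2 * i) (N := iroot q n)
      ?_ ?_ ⟨by simp, by simp [h0], by simp, by omega⟩)
  · rintro i hi s' τ' ⟨h23, h0, hs, hτ⟩
    refine ⟨?_, wp_setV (fun _ => by simp [h23]; omega) ⟨by simp [h23], by simp [h0], by simpa using hs,
      by omega⟩⟩
    simp only [HExpr.eval, HExpr.eval_pow, h23, h0]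
    have : (i + 1) ^ q ≤ n := (Nat.pow_le_pow_left hi q).trans (iroot_pow_le hq n)
    rw [if_pos (by omega)]; omega
  · rintro s' τ' ⟨h23, h0, hs, hτ⟩
    have := lt_iroot_succ_pow hq n
    refine ⟨by simp only [HExpr.eval, HExpr.eval_pow, h23, h0]; rw [if_neg (by omega)], ?_⟩
    refine wp_ite (fun hn => ?_) (fun hn => ?_)
    · have hn : n < n₀ := by by_contra hne; simp [h0, hne] at hn
      refine wp_setV (fun hb => hb.v 0) ⟨⟨by simp [h0], ?_, by simpa using hs⟩, by omega⟩
      simp [h0, threshold, hn]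
    · have hn : ¬ n < n₀ := by intro hne; simp [h0, hne] at hn
      have hxa : iroot q n ^ a ≤ n ^ a := Nat.pow_le_pow_left hx a
      refine wp_setV (fun hb => ?_) ⟨⟨by simp [h0], ?_, by simpa using hs⟩, by omega⟩
      · rw [HExpr.eval_pow]; simp only [HExpr.eval, h23]; omega
      · simp [HExpr.eval_pow, h23, threshold, hn]

theorem rowMajor_inj {i j i' j' : ℕ} (hj : j < n) (hj' : j' < n) (h : i * n + j = i' * n + j') :
    i = i' ∧ j = j' := by
  have h1 : i = i' := by
    rcases lt_trichotomy i i' with h2 | h2 | h2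
    · nlinarith
    · exact h2
    · nlinarith
  subst h1
  exact ⟨rfl, by omega⟩

structure OutputInv (n : ℕ) (A : ℕ → ℕ → ℕ → ℕ → ℕ) (k : ℕ) (s : St) : Prop where
  v0 : s.v 0 = n
  arr : s.arr = A
  raw : ∀ i < n, ∀ j < n, i * n + j < k → i * n + j ≠ 0 → s.raw (i * n + j) = A 5 i j 0

theorem OutputInv.setV {A : ℕ → ℕ → ℕ → ℕ → ℕ} {k : ℕ} (h : OutputInv n A k s) {j x : ℕ}
    (hj : 1 ≤ j) : OutputInv n A k (s.setV j x) :=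
  ⟨by rw [St.setV_ne _ _ _ (by omega), h.v0], h.arr, h.raw⟩

theorem wp_output {τ : ℕ} (hR : R = n * n + 1) (hB : n * n + n ≤ B) (h0 : s.v 0 = n) :
    wp R B WA .output (fun s' τ' => (∀ i < n, ∀ j < n, i * n + j ≠ 0 →
      s'.raw (i * n + j) = s.arr 5 i j 0) ∧ τ' ≤ τ + 5 * n * n + 4 * n + 2) s τ := by
  refine wp_for (fun i s' τ' => OutputInv n s.arr (i * n) s' ∧ τ' ≤ τ + 1 + i * (5 * n + 4)) n
    (by omega) ⟨⟨by simp [h0], rfl, fun _ _ _ _ h => by omega⟩, by omega⟩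
    (fun i s τ' h _ => by simp [h.1.v0]) ?_ ?_
  · rintro i hi s1 τ1 ⟨h, hτ⟩ h2
    refine wp_for (fun k s' τ' => s'.v 2 = i ∧ OutputInv n s.arr (i * n + k) s' ∧
      τ' ≤ τ1 + 2 + 5 * k) n (by omega) ⟨by simp [h2], h.setV (by omega), by omega⟩
      (fun i s τ' h _ => by simp [h.2.1.v0]) ?_ ?_
    · rintro k hk s2 τ2 ⟨h2, h, hτ⟩ h3
      have hidx : i * n + k < n * n := by nlinarith
      refine wp_seq (wp_setV (fun _ => by simp [h2, h3, h.v0]; omega) ?_)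
      simp only [HExpr.eval, h2, h3, h.v0]
      have hI := h.setV (j := 22) (x := i * n + k) (by omega)
      refine wp_ite (fun hc => ?_) (fun hc => ?_)
      · simp only [HExpr.eval, St.setV_self] at hc
        refine wp_setRaw (by simp; omega) (by simp; omega) (fun hb => hb.arr _ _ _ _) ?_
        simp only [HExpr.eval, St.setV_self, ne_eq, Nat.reduceEqDiff, not_false_eq_true, St.setV_ne,
          h2, h3, St.setV_arr, h.arr]
        refine ⟨by simp [h3], by simp [h2], ⟨by simp [h.v0], by simp [h.arr], ?_⟩, by omega⟩
        intro i' hi' j' hj' hlt hne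
        simp only [St.setV_raw, St.setRaw_raw]
        split_ifs with heq
        · obtain ⟨rfl, rfl⟩ := rowMajor_inj hj' hk heq; rfl
        · exact h.raw i' hi' j' hj' (by omega) hne
      · simp only [HExpr.eval, St.setV_self] at hc
        refine wp_skip ⟨by simp [h3], by simp [h2], ⟨by simp [h.v0], by simp [h.arr], ?_⟩,
          by omega⟩
        intro i' hi' j' hj' hlt hne
        exact h.raw i' hi' j' hj' (by omega) hne
    · rintro s2 τ2 ⟨h2, h, hτ⟩
      refine ⟨h2, ?_, ?_⟩
      · rw [add_mul, one_mul]; exact h.setV (by omega)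
      · have : (i + 1) * (5 * n + 4) = i * (5 * n + 4) + 5 * n + 4 := by ring
        omega
  · rintro s1 τ1 ⟨h, hτ⟩
    refine ⟨fun i hi j hj hne => h.raw i hi j hj ?_ hne, ?_⟩
    · nlinarith
    · have : n * (5 * n + 4) = 5 * n * n + 4 * n := by ring
      omega

-- Soundness is kept through all phases, as every mark comes with a triangle. For completeness, a
-- triangle with a low corner was marked in the low-degree phase, and one with three high corners is
-- found in the bin that holds the third corner of the edge as a middle node.
open Classical in
theorem wp_main {q a n₀ T : ℕ} {p : Program} (hq : q ≠ 0) (hR : R = n * n + 1) (hWA : WA ≤ B)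
    (hB : 2 * (n * n) + 3 * n + 1 + n ^ a ≤ B) (hsymm : ∀ i j, tab i j = tab j i)
    (htab : ∀ i j, tab i j ≤ n * n) (hp : MulCorrect WA n (threshold q a n₀ n) T p)
    (h0 : s.v 0 = n) (harr : s.arr = fun _ _ _ _ => 0) (hvm : s.vm = fun _ _ => 0)
    (hraw : ∀ i < n, ∀ j < n, s.raw (1 + i * n + j) = tab i j) :
    wp R B WA (.main q a n₀ p) (fun s' τ' => (∀ i < n, ∀ j < n, i * n + j ≠ 0 → tab i j ≠ 0 →
      s'.raw (i * n + j) = if Tri n tab i j then 1 else 0) ∧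
      ∃ t, t ≤ 2 * n / threshold q a n₀ n ∧
        τ' ≤ 2 + 200 * (threshold q a n₀ n * (n * n) + (t + 1) * (T + n * n))) s 0 := by
  refine wp_ite (fun hn => ?_) (fun hn => ?_)
  swap
  · simp only [HExpr.eval, h0] at hn
    exact wp_skip ⟨fun i hi => by omega, 0, Nat.zero_le _, by omega⟩
  simp only [HExpr.eval, h0] at hn
  have hΔ := one_le_threshold (q := q) (a := a) (n₀ := n₀) (n := n) (by omega)
  set Δ := threshold q a n₀ n with hΔdef
  refine wp_seq (wp_mono (wp_param hq (by omega) h0) ?_)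
  rintro s1 τ1 ⟨⟨a0, a1, a2, a3, a4⟩, aτ⟩
  refine wp_seq (wp_mono (wp_count (Δ := Δ) (tab := tab) hR (by omega) a0 a1
    (fun j hj => by rw [a2, harr]) (fun i hi j hj => by rw [a3]; exact hraw i hi j hj)) ?_)
  rintro s2 τ2 ⟨b, bτ⟩
  refine wp_seq (wp_mono (wp_low hsymm (by omega) b.v0 b.v1 b.counted
    (by rw [b.arr 5 (by omega), a2, harr])) ?_)
  rintro s3 τ3 ⟨d, dτ⟩
  refine wp_seq (wp_mono (wp_bins (by omega) (.inl hΔ) d.v0 d.v1 d.counted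
    (fun j hj => by rw [d.arr j hj, b.arr j (by omega), a2, harr])) ?_)
  rintro s4 τ4 ⟨⟨t, e⟩, eτ⟩
  have hpot : Δ * t ≤ 2 * n := by
    have h1 := e.pot
    have h2 : n * (Δ * t) ≤ n * (2 * n) := by nlinarith
    exact Nat.le_of_mul_le_mul_left h2 (by omega)
  have ht : t ≤ Δ * t := Nat.le_mul_of_pos_left _ (by omega)
  have hnn : n ≤ n * n := Nat.le_mul_of_pos_left _ (by omega)
  refine wp_seq (wp_mono (wp_run (t := t) (Δ := Δ) (tab := tab) (s₁ := s3) hWA (by omega)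
    (by omega) hsymm hp e (by rw [e.vm, d.vm, b.vm, a4, hvm])
    (by rw [e.res]; exact d.sound)) ?_)
  rintro s5 τ5 ⟨f, fτ⟩
  refine wp_mono (wp_output hR (by omega) f.v0) ?_
  rintro s6 τ6 ⟨g, gτ⟩
  refine ⟨?_, t, (Nat.le_div_iff_mul_le (by omega)).2 (by rwa [mul_comm]), ?_⟩
  · intro i hi j hj hne hij
    rw [g i hi j hj hne]
    split_ifs with htri
    · obtain ⟨-, k, hk, hik, hjk⟩ := htri
      set c := tab i j with hc
      have old : s3.arr 5 i j 0 = 1 → s5.arr 5 i j 0 = 1 := fun h =>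
        f.mono i j (by rw [e.res]; exact h)
      -- Each of the three marks set in the low-degree phase serves one case: the low corner is `k`,
      -- `i` or `j`.
      by_cases hkl : colDeg n tab c k ≤ Δ
      · have hki : tab k i = c := by rw [hsymm, hik]
        exact old (d.done k hk i hi j hj trivial (by rwa [hki]) (by rw [hsymm k j, hjk, hki])
          (by rw [hki]) (by rwa [hki])).1
      by_cases hil : colDeg n tab c i ≤ Δ
      · exact old (d.done i hi j hj k hk trivial (by rwa [← hc]) hik hjk hil).2.1
      by_cases hjl : colDeg n tab c j ≤ Δ
      · have hji : tab j i = c := by rw [hsymm]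
        exact old (d.done j hj i hi k hk trivial (by rwa [hji]) (by rw [hji, hjk])
          (by rw [hji, hik]) (by rwa [hji])).2.2
      obtain ⟨t', ht', hent⟩ := e.done c hij (htab i j) k hk (by omega)
      exact f.done t' (by omega) c i k j (hent i hi (by omega) (by rw [hsymm, hik]))
        (hent j hj (by omega) (by rw [hsymm, hjk])) hc.symm
    · rcases f.sound i j with h | ⟨-, h⟩
      · exact h
      · exact absurd h htri
  · have e1 : 11 * n * n = 11 * (n * n) := by ring
    have e2 : (7 * Δ + 8) * n * n = 7 * (Δ * (n * n)) + 8 * (n * n) := by ring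
    have e3 : 5 * n * n = 5 * (n * n) := by ring
    have e4 : n * n ≤ Δ * (n * n) := Nat.le_mul_of_pos_left _ (by omega)
    have e5 : (t + 1) * (T + 87 * (n * n) + 12 * n + 9) ≤ (t + 1) * (108 * (T + n * n)) :=
      Nat.mul_le_mul_left _ (by omega)
    have e6 : (t + 1) * (108 * (T + n * n)) = 108 * ((t + 1) * (T + n * n)) := by ring
    omega

end FineGrained

namespace FineGrained

/-! ### The word RAM program for the triangle problem -/

open Classical in
/-- The entries of the table of a colored graph. -/
noncomputable def ColoredGraph.tab (G : ColoredGraph) (i j : ℕ) : ℕ :=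
  if h : i < G.n ∧ j < G.n then
    if G.graph.Adj ⟨i, h.1⟩ ⟨j, h.2⟩ then (G.color s(⟨i, h.1⟩, ⟨j, h.2⟩) : ℕ) + 1 else 0
  else 0

namespace ColoredGraph
variable (G : ColoredGraph)

theorem tab_symm (i j : ℕ) : G.tab i j = G.tab j i := by
  unfold tab
  by_cases h : i < G.n ∧ j < G.n
  · rw [dif_pos h, dif_pos h.symm, G.graph.adj_comm, Sym2.eq_swap]
  · rw [dif_neg h, dif_neg (fun h' => h h'.symm)]

theorem tab_le (i j : ℕ) : G.tab i j ≤ G.n * G.n := by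
  unfold tab
  split_ifs with h h'
  · exact (G.color s(⟨i, h.1⟩, ⟨j, h.2⟩)).isLt.trans_eq (pow_two _)
  · omega
  · omega

theorem tab_ne_zero {i j : Fin G.n} : G.tab i j ≠ 0 ↔ G.graph.Adj i j := by
  simp [tab]

theorem tab_eq_tab {i j k l : Fin G.n} (h : G.graph.Adj k l) :
    G.tab i j = G.tab k l ↔ G.graph.Adj i j ∧ G.color s(i, j) = G.color s(k, l) := by
  by_cases h' : G.graph.Adj i j <;> simp [tab, h, h', Fin.ext_iff]

theorem tri_iff {i j : Fin G.n} (h : G.graph.Adj i j) : Tri G.n G.tab i j ↔ G.InMonoTriangle i j := by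
  constructor
  · rintro ⟨-, k, hk, h1, h2⟩
    have h1 := (G.tab_eq_tab (i := i) (j := ⟨k, hk⟩) h).1 h1
    have h2 := (G.tab_eq_tab (i := j) (j := ⟨k, hk⟩) h).1 h2
    exact ⟨⟨k, hk⟩, h, h1.1, h2.1, h1.2, h2.2⟩
  · rintro ⟨k, -, h1, h2, h3, h4⟩
    exact ⟨G.tab_ne_zero.2 h, k, k.2, (G.tab_eq_tab h).2 ⟨h1, h3⟩, (G.tab_eq_tab h).2 ⟨h2, h4⟩⟩

theorem table_eq : G.table =
    (List.finRange G.n).flatMap fun i : Fin G.n =>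
      (List.finRange G.n).map fun j : Fin G.n => G.tab i j := by
  unfold table tab
  simp

end ColoredGraph

theorem flatMap_finRange_getD {n : ℕ} (f : ℕ → ℕ → ℕ) (N : ℕ) :
    ((List.range N).flatMap fun i => (List.range n).map fun j => f i j).length = N * n ∧
    ∀ i < N, ∀ j < n,
      ((List.range N).flatMap fun i => (List.range n).map fun j => f i j).getD (i * n + j) 0 =
        f i j := by
  induction N with
  | zero => simp
  | succ N ih =>
    rw [List.range_succ, List.flatMap_append]
    refine ⟨by rw [List.length_append, ih.1]; simp; ring, ?_⟩
    intro i hi j hj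
    by_cases h : i < N
    · rw [List.getD_append _ _ _ _ (by rw [ih.1]; nlinarith)]
      exact ih.2 i h j hj
    · obtain rfl : i = N := by omega
      rw [List.getD_append_right _ _ _ _ (by rw [ih.1]; omega), ih.1]
      simp [hj]

theorem ColoredGraph.table_eq' (G : ColoredGraph) : G.table =
    (List.range G.n).flatMap fun i => (List.range G.n).map fun j => G.tab i j := by
  rw [table_eq, ← List.map_coe_finRange_eq_range, List.flatMap_map]
  simp only [List.map_map, Function.comp_def]

/-- The memory after the start of the free memory has been fixed. -/
noncomputable def startSt (G : ColoredGraph) : St where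
  v := fun j => if j = 0 then G.n else 0
  arr := fun _ _ _ _ => 0
  raw := initMem (G.n :: G.table)
  vm := fun _ _ => 0

def startE : Expr := addE (mulE (.load (.lit 0)) (.load (.lit 0))) (.lit 1)

/-- The address `n² + 1` is the first cell behind the input and at the same time the cell of
variable `0`, as `pr 0 0 = 0`. So `n` is saved there before cell `0` is overwritten with the start
of the free memory. -/
def Program.start : Program :=
  .seq (.store startE (.load (.lit 0))) (.store (.lit 0) startE)

theorem initMem_graph_zero (G : ColoredGraph) : initMem (G.n :: G.table) 0 = G.n := rfl

theorem initMem_graph (G : ColoredGraph) {i j : ℕ} (hi : i < G.n) (hj : j < G.n) :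
    initMem (G.n :: G.table) (1 + i * G.n + j) = G.tab i j := by
  unfold initMem
  rw [show 1 + i * G.n + j = (i * G.n + j) + 1 by ring, List.getD_cons_succ, G.table_eq']
  exact (flatMap_finRange_getD _ _).2 i hi j hj

theorem initMem_graph_of_le (G : ColoredGraph) {a : ℕ} (ha : G.n * G.n + 1 ≤ a) :
    initMem (G.n :: G.table) a = 0 := by
  unfold initMem
  refine List.getD_eq_default _ _ ?_
  rw [List.length_cons, G.table_eq', (flatMap_finRange_getD _ _).1]
  exact ha

theorem initMem_graph_le (G : ColoredGraph) {B : ℕ} (hB : G.n * G.n + G.n ≤ B) (a : ℕ) :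
    initMem (G.n :: G.table) a ≤ B := by
  rcases Nat.eq_zero_or_pos a with rfl | ha
  · rw [initMem_graph_zero]; omega
  by_cases h : G.n * G.n + 1 ≤ a
  · rw [initMem_graph_of_le G h]; omega
  · have hn : 0 < G.n := by
      rcases Nat.eq_zero_or_pos G.n with h0 | h0
      · rw [h0] at h; omega
      · exact h0
    have h1 : (a - 1) / G.n < G.n := Nat.div_lt_of_lt_mul (by omega)
    have h2 := Nat.mod_lt (a - 1) hn
    have h3 := Nat.div_add_mod' (a - 1) G.n
    have := initMem_graph G h1 h2
    rw [add_assoc, h3, show 1 + (a - 1) = a by omega] at this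
    rw [this]
    exact (G.tab_le _ _).trans (by omega)

theorem startSt_bdd (G : ColoredGraph) {B : ℕ} (hB : G.n * G.n + G.n ≤ B) : (startSt G).Bdd B := by
  refine ⟨fun j => ?_, fun _ _ _ _ => Nat.zero_le _, initMem_graph_le G hB,
    fun _ _ => Nat.zero_le _⟩
  simp only [startSt]
  split_ifs <;> omega

theorem exec_start (G : ColoredGraph) {B W : ℕ} (hB2 : 2 ≤ B) (hB : G.n * G.n + G.n + 1 ≤ B)
    (hW : B ^ startE.sz < W) :
    ∃ m, Exec W Program.start (initMem (G.n :: G.table)) 19 m ∧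
      Rep (G.n * G.n + 1) B m (startSt G) := by
  set m₀ := initMem (G.n :: G.table) with hm₀
  have hs : startE.Simple := simple_addE (b := .lit 1) (simple_mulE (a := .load (.lit 0))
    (b := .load (.lit 0)) trivial trivial) trivial
  have le0 : ∀ a, m₀ a ≤ B := initMem_graph_le G (by omega)
  have hz : m₀ 0 = G.n := initMem_graph_zero G
  have hev : startE.eval m₀ = G.n * G.n + 1 := by simp [startE, hz]
  set m₁ := Function.update m₀ (G.n * G.n + 1) G.n with hm₁
  have le1 : ∀ a, m₁ a ≤ B := update_le le0 _ (by omega)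
  have hz1 : m₁ 0 = G.n := by rw [hm₁, Function.update_of_ne (by omega), hz]
  have hev1 : startE.eval m₁ = G.n * G.n + 1 := by simp [startE, hz1]
  have hsz : startE.sz = 8 := rfl
  have mono : ∀ k ≤ 8, B ^ k < W := fun k hk =>
    lt_of_le_of_lt (Nat.pow_le_pow_right (by omega) (by omega)) hW
  have ex1 := Exec.store (W := W) startE (.load (.lit 0)) m₀ (hs.fits hB2 le0 hW)
    (Expr.Simple.fits (e := .load (.lit 0)) hB2 le0 trivial (mono 2 (by omega)))
  have ex2 := Exec.store (W := W) (.lit 0) startE m₁ (Expr.Simple.fits (e := .lit 0) hB2 le1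
    trivial (mono 1 (by omega))) (hs.fits hB2 le1 hW)
  rw [hev, eval_load, eval_lit, hz] at ex1
  rw [hev1, eval_lit] at ex2
  refine ⟨_, .seq ex1 ex2, ?_⟩
  have hhigh : ∀ a, 1 ≤ a → Function.update m₁ 0 (G.n * G.n + 1) (G.n * G.n + 1 + a) = 0 := by
    intro a ha
    rw [Function.update_of_ne (by omega), hm₁, Function.update_of_ne (by omega)]
    exact initMem_graph_of_le G (by omega)
  have hpr : ∀ t i, t ≠ 0 ∨ i ≠ 0 → 1 ≤ pr t i := by
    intro t i h
    unfold pr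
    have : 1 ≤ (t + i) * (t + i) := Nat.mul_pos (by omega) (by omega)
    omega
  refine ⟨by simp, ?_, ?_, ?_, ?_, update_le le1 _ (by omega)⟩
  · intro j
    by_cases hj : j = 0
    · subst hj
      rw [Function.update_of_ne (by omega), hm₁]
      simp [startSt, pr]
    · rw [hhigh _ (hpr _ _ (.inr hj))]; simp [startSt, hj]
  · intro j i k l; rw [hhigh _ (hpr _ _ (.inl (by omega)))]; rfl
  · intro t a; rw [hhigh _ (hpr _ _ (.inl (by omega)))]; rfl
  · intro a h1 h2
    rw [Function.update_of_ne (by omega), hm₁, Function.update_of_ne (by omega)]; rfl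

/-- Running the reduction on the word RAM. -/
theorem exec_reduction (G : ColoredGraph) {q a n₀ T B W WA : ℕ} {p : Program} (hq : q ≠ 0)
    (hWA : WA ≤ B) (hB : 2 * (G.n * G.n) + 3 * G.n + 2 + G.n ^ a ≤ B)
    (hp : MulCorrect WA G.n (threshold q a n₀ G.n) T p)
    (hW : B ^ (startE.sz + (HProg.main q a n₀ p).K) < W) :
    ∃ t m k, k ≤ 2 * G.n / threshold q a n₀ G.n ∧
      t ≤ 19 + (HProg.main q a n₀ p).K *
        (2 + 200 * (threshold q a n₀ G.n * (G.n * G.n) + (k + 1) * (T + G.n * G.n))) ∧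
      Exec W (.seq .start (HProg.main q a n₀ p).comp) (initMem (G.n :: G.table)) t m ∧
      monoAllEdgesTriangle.Correct G m := by
  classical
  have mono : ∀ {k l : ℕ}, B ^ l < W → k ≤ l → B ^ k < W := fun h hkl =>
    lt_of_le_of_lt (Nat.pow_le_pow_right (by omega) hkl) h
  obtain ⟨m₁, e₁, r₁⟩ := exec_start G (B := B) (by omega) (by omega) (mono hW (by omega))
  obtain ⟨s', t, ex, hbdd, hout, k, hk, ht⟩ := wp_main (R := G.n * G.n + 1) (s := startSt G)
    (tab := G.tab) hq rfl hWA (by omega) G.tab_symm G.tab_le hp rfl rfl rfl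
    (fun i hi j hj => initMem_graph G hi hj) (startSt_bdd G (by omega))
  obtain ⟨m', t', ht', ex', r'⟩ := ex.comp (by omega) (by omega) (by omega) hWA (mono hW (by omega))
    m₁ r₁
  refine ⟨19 + t', m', k, hk, ?_, .seq e₁ ex', ?_⟩
  · refine Nat.add_le_add_left (ht'.trans (Nat.mul_le_mul_left _ ?_)) _
    omega
  · intro i j hij
    have hidx : (i : ℕ) * G.n + j < G.n * G.n := by nlinarith [i.2, j.2]
    -- Cell `0` belongs to the pair `(0, 0)`, and a simple graph has no loops.
    have hne : (i : ℕ) * G.n + j ≠ 0 := by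
      intro h0
      have h1 : (i : ℕ) = 0 := by
        by_contra h1
        have : 0 < (i : ℕ) * G.n := Nat.mul_pos (by omega) (by have := i.2; omega)
        omega
      have h2 : (j : ℕ) = 0 := by omega
      exact hij.ne (Fin.ext (h1.trans h2.symm))
    rw [r'.raw _ (by omega) (by omega), hout i i.2 j j.2 hne (G.tab_ne_zero.2 hij)]
    simp only [G.tri_iff hij]

end FineGrained

namespace FineGrained

/-! ### Using an algorithm for sparse products -/

/-- The second factor is the transpose, represented by the list of swapped positions in the same
order. The encoding of this instance is literally `binInput`, and the output table gives the pairs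
of rows with a common column. -/
theorem mulCorrect_of_sparseBMM {c τ : ℝ} {p : Program} {k : ℕ} {T : ℕ → ℕ}
    (hA : ∀ x : (sparseBMM c τ).Inst, ∃ (t : ℕ) (m : Mem), t ≤ T ((sparseBMM c τ).size x) ∧
      Exec (2 ^ (k * (Nat.log 2 ((sparseBMM c τ).size x) + 1))) p
        (initMem ((sparseBMM c τ).input x)) t m ∧ (sparseBMM c τ).Correct x m)
    {n Δ : ℕ} (hcap : ∀ e : ℕ, e ≤ Δ * n + n → (e ≠ 0 → Δ < n) →
      ((e + e : ℕ) : ℝ) ≤ c * ((3 * n : ℕ) : ℝ) ^ τ) :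
    MulCorrect (2 ^ (k * (Nat.log 2 (3 * n) + 1))) n Δ (T (3 * n)) p := by
  classical
  intro e X Y he he' hXY hinj
  let f : Fin e → Fin (3 * n) × Fin (3 * n) := fun j =>
    (⟨X j, (hXY j j.2).1⟩, ⟨Y j, (hXY j j.2).2⟩)
  let g : Fin e → Fin (3 * n) × Fin (3 * n) := fun j =>
    (⟨Y j, (hXY j j.2).2⟩, ⟨X j, (hXY j j.2).1⟩)
  have hf : Function.Injective f := by
    intro i j hij
    simp only [f, Prod.mk.injEq, Fin.mk.injEq] at hij
    exact Fin.ext (hinj i i.2 j j.2 hij.1 hij.2)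
  have hg : Function.Injective g := by
    intro i j hij
    simp only [g, Prod.mk.injEq, Fin.mk.injEq] at hij
    exact Fin.ext (hinj i i.2 j j.2 hij.2 hij.1)
  let x : SparseBMMInst c τ :=
    { n := 3 * n
      A := fun i k => decide (∃ j, f j = (i, k))
      B := fun k i => decide (∃ j, g j = (k, i))
      listA := List.ofFn f
      listB := List.ofFn g
      repA := ⟨List.nodup_ofFn.2 hf, fun i j => by simp [List.mem_ofFn]⟩
      repB := ⟨List.nodup_ofFn.2 hg, fun i j => by simp [List.mem_ofFn]⟩
      sparse := by simpa using hcap e he he' }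
  have hinput : (sparseBMM c τ).input x = binInput (3 * n) e X Y := by
    simp only [sparseBMM, binInput, encodePositions, x, List.length_map, List.length_finRange, List.ofFn_eq_map,
      List.flatMap_map, f, g, ← List.map_coe_finRange_eq_range]
  obtain ⟨t, m, ht, hex, hm⟩ := hA x
  rw [hinput] at hex
  refine ⟨t, m, ht, hex, ?_⟩
  intro a ha b hb
  have h1 := hm ⟨a, ha⟩ ⟨b, hb⟩
  change m (a * (3 * n) + b) = _ at h1
  rw [h1]
  simp only [boolMul, x, decide_eq_true_eq]
  rw [ne_eq, ite_eq_right_iff, Classical.not_imp]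
  simp only [one_ne_zero, not_false_eq_true, and_true]
  constructor
  · rintro ⟨k, ⟨j, hj⟩, ⟨j', hj'⟩⟩
    simp only [f, g, Prod.mk.injEq, Fin.ext_iff] at hj hj'
    exact ⟨j, j.2, j', j'.2, hj.1, hj'.2, hj.2.trans hj'.1.symm⟩
  · rintro ⟨j, hj, j', hj', rfl, rfl, hY⟩
    refine ⟨⟨Y j, (hXY j hj).2⟩, ⟨⟨j, hj⟩, rfl⟩, ⟨⟨j', hj'⟩, ?_⟩⟩
    simp [g, hY]

/-! ### Word sizes -/

theorem two_pow_log_le (n : ℕ) : 2 ^ (Nat.log 2 (3 * n) + 1) ≤ (n + 2) ^ 3 := by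
  rcases Nat.eq_zero_or_pos n with rfl | hn
  · simp
  · have := Nat.pow_log_le_self 2 (x := 3 * n) (by omega)
    rw [pow_succ]
    nlinarith [sq_nonneg (n : ℤ), Nat.zero_le (n ^ 3), Nat.zero_le (n ^ 2)]

theorem wordSize_le (n k : ℕ) : 2 ^ (k * (Nat.log 2 (3 * n) + 1)) ≤ (n + 2) ^ (3 * k) := by
  rw [mul_comm k, pow_mul, pow_mul]
  exact Nat.pow_le_pow_left (two_pow_log_le n) k

/-- With `N = 2 ^ (Nat.log 2 n + 1)` both `n < N` and `2 ≤ N`, hence `n + 2 < N²`; this is the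
origin of the factor `2` in the exponent. -/
theorem pow_lt_wordSize (n : ℕ) {d : ℕ} (hd : d ≠ 0) :
    (n + 2) ^ d < 2 ^ (2 * d * (Nat.log 2 n + 1)) := by
  have h1 : n < 2 ^ (Nat.log 2 n + 1) := Nat.lt_pow_succ_log_self (by omega) n
  have h2 : 2 ≤ 2 ^ (Nat.log 2 n + 1) := Nat.le_self_pow (by omega) 2
  rw [show 2 * d * (Nat.log 2 n + 1) = (Nat.log 2 n + 1) * 2 * d by ring, pow_mul _ _ d, pow_mul]
  refine Nat.pow_lt_pow_left ?_ hd
  rw [pow_two]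
  nlinarith

/-- The running time of the reduction. -/
def reductionTime (K q a n₀ : ℕ) (T : ℕ → ℕ) (n : ℕ) : ℕ :=
  19 + K * (2 + 200 * (threshold q a n₀ n * (n * n) +
    (2 * n / threshold q a n₀ n + 1) * (T (3 * n) + n * n)))

theorem exists_reduction {c τ : ℝ} {p : Program} {k : ℕ} {T : ℕ → ℕ} {q a n₀ : ℕ} (hq : q ≠ 0)
    (hA : ∀ x : (sparseBMM c τ).Inst, ∃ (t : ℕ) (m : Mem), t ≤ T ((sparseBMM c τ).size x) ∧
      Exec (2 ^ (k * (Nat.log 2 ((sparseBMM c τ).size x) + 1))) p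
        (initMem ((sparseBMM c τ).input x)) t m ∧ (sparseBMM c τ).Correct x m)
    (hcap : ∀ n e : ℕ, e ≤ threshold q a n₀ n * n + n → (e ≠ 0 → threshold q a n₀ n < n) →
      ((e + e : ℕ) : ℝ) ≤ c * ((3 * n : ℕ) : ℝ) ^ τ) :
    ∃ (p' : Program) (k' K : ℕ), ∀ G : monoAllEdgesTriangle.Inst, ∃ (t : ℕ) (m : Mem),
      t ≤ reductionTime K q a n₀ T (monoAllEdgesTriangle.size G) ∧
      Exec (2 ^ (k' * (Nat.log 2 (monoAllEdgesTriangle.size G) + 1))) p'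
        (initMem (monoAllEdgesTriangle.input G)) t m ∧ monoAllEdgesTriangle.Correct G m := by
  set K := (HProg.main q a n₀ p).K
  -- The bound `(n + 2) ^ d` covers the numbers of the reduction, with exponent `3 + a`, and the
  -- words of the subroutine on instances of size `3n`, with exponent `3k`.
  set d := 3 + a + 3 * k with hd
  refine ⟨.seq .start (HProg.main q a n₀ p).comp, 2 * (d * (startE.sz + K)), K, fun G => ?_⟩
  have hsz : startE.sz = 8 := rfl
  have hB1 : 2 * (G.n * G.n) + 3 * G.n + 2 + G.n ^ a ≤ (G.n + 2) ^ (3 + a) := by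
    have h1 : G.n ^ a ≤ (G.n + 2) ^ a := Nat.pow_le_pow_left (by omega) a
    have h2 : 1 ≤ (G.n + 2) ^ a := Nat.one_le_pow _ _ (by omega)
    have h3 : 2 * (G.n * G.n) + 3 * G.n + 3 ≤ (G.n + 2) ^ 3 := by
      nlinarith [Nat.zero_le (G.n ^ 3), Nat.zero_le (G.n ^ 2)]
    calc _ ≤ (2 * (G.n * G.n) + 3 * G.n + 3) * (G.n + 2) ^ a := by nlinarith
      _ ≤ _ := by rw [pow_add]; exact Nat.mul_le_mul_right _ h3
  have hB2 : (G.n + 2) ^ (3 + a) ≤ (G.n + 2) ^ d := Nat.pow_le_pow_right (by omega) (by omega)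
  have hB3 : (G.n + 2) ^ (3 * k) ≤ (G.n + 2) ^ d := Nat.pow_le_pow_right (by omega) (by omega)
  obtain ⟨t, m, k₁, h1, h2, h3, h4⟩ := exec_reduction G (B := (G.n + 2) ^ d) (a := a) (n₀ := n₀) hq
    ((wordSize_le G.n k).trans hB3) (hB1.trans hB2) (mulCorrect_of_sparseBMM hA (hcap G.n))
    (W := 2 ^ (2 * (d * (startE.sz + K)) * (Nat.log 2 G.n + 1)))
    (by rw [← pow_mul]; exact pow_lt_wordSize G.n (Nat.mul_ne_zero (by omega) (by omega)))
  refine ⟨t, m, h2.trans ?_, h3, h4⟩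
  unfold reductionTime
  change _ ≤ 19 + K * (2 + 200 * (threshold q a n₀ G.n * (G.n * G.n) +
    (2 * G.n / threshold q a n₀ G.n + 1) * (T (3 * G.n) + G.n * G.n)))
  gcongr

/-! ### The exponent of matrix multiplication is at most three -/

section
variable {R σ : Type*} [CommRing R]

/-- Each summand takes two gates, a product and an addition to the partial sum, which starts from
the free constant `0`. The given circuit is extended and not rebuilt, so that several sums can be
chained. -/
theorem exists_circuit_sum (l : List (MvPolynomial σ R)) (hl : IsCircuit l) (L : List (σ × σ)) :
    ∃ l' : List (MvPolynomial σ R), IsCircuit l' ∧ (∀ p, Available l p → Available l' p) ∧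
      l'.length = l.length + 2 * L.length ∧
      Available l' (L.map fun q => MvPolynomial.X q.1 * MvPolynomial.X q.2).sum := by
  induction L with
  | nil => exact ⟨l, hl, fun _ h => h, rfl, .inr (.inr ⟨0, by simp⟩)⟩
  | cons q L ih =>
    obtain ⟨l', h1, h2, h3, h4⟩ := ih
    have cons : ∀ (l : List (MvPolynomial σ R)) (r p : MvPolynomial σ R), Available l p →
        Available (r :: l) p := fun l r p h => h.imp (List.mem_cons_of_mem _) id
    set P : MvPolynomial σ R := MvPolynomial.X q.1 * MvPolynomial.X q.2 with hP
    refine ⟨(P + (L.map fun q => MvPolynomial.X q.1 * MvPolynomial.X q.2).sum) :: P :: l',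
      ⟨⟨P, _, .inl (by simp), cons _ _ _ h4, .inl rfl⟩, ⟨_, _, .inr (.inl ⟨q.1, rfl⟩),
        .inr (.inl ⟨q.2, rfl⟩), .inr (.inr hP)⟩, h1⟩,
      fun p hp => cons _ _ _ (cons _ _ _ (h2 p hp)), ?_, .inl (by simp [hP])⟩
    simp only [List.length_cons, h3]; ring

theorem exists_circuit_sums (n : ℕ) (Ls : List (List (σ × σ))) (hLs : ∀ L ∈ Ls, L.length = n) :
    ∃ l : List (MvPolynomial σ R), IsCircuit l ∧ l.length = 2 * n * Ls.length ∧
      ∀ L ∈ Ls, Available l (L.map fun q => MvPolynomial.X q.1 * MvPolynomial.X q.2).sum := by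
  induction Ls with
  | nil => exact ⟨[], trivial, by simp, by simp⟩
  | cons L Ls ih =>
    obtain ⟨l, h1, h2, h3⟩ := ih fun L hL => hLs L (List.mem_cons_of_mem _ hL)
    obtain ⟨l', g1, g2, g3, g4⟩ := exists_circuit_sum l h1 L
    refine ⟨l', g1, ?_, ?_⟩
    · rw [g3, h2, hLs L (by simp), List.length_cons]; ring
    · intro L' hL'
      rcases List.mem_cons.1 hL' with rfl | hL'
      · exact g4
      · exact g2 _ (h3 L' hL')

theorem MM_le (R : Type*) [CommRing R] (n : ℕ) : MM R n n n ≤ 2 * n ^ 3 := by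
  obtain ⟨l, h1, h2, h3⟩ := exists_circuit_sums (R := R) n
    ((List.finRange n ×ˢ List.finRange n).map fun q : Fin n × Fin n =>
      (List.finRange n).map fun j : Fin n =>
        ((Sum.inl (q.1, j), Sum.inr (j, q.2)) :
          ((Fin n × Fin n) ⊕ (Fin n × Fin n)) × ((Fin n × Fin n) ⊕ (Fin n × Fin n))))
    (by
      intro L hL
      obtain ⟨q, -, rfl⟩ := List.mem_map.1 hL
      simp)
  refine Nat.sInf_le ⟨l, h1, ?_, ?_⟩
  · rw [h2]; simp [List.length_product]; ring
  · intro i k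
    have := h3 _ (List.mem_map.2 ⟨(i, k), by simp, rfl⟩)
    rw [List.map_map] at this
    simpa [Finset.sum, Function.comp_def, Fin.univ_def] using this

theorem matMulExponent_le_three (R : Type*) [CommRing R] (h : 2 < matMulExponent R) :
    matMulExponent R ≤ 3 := by
  by_cases hb : BddBelow
      {τ : ℝ | (fun n : ℕ => (MM R n n n : ℝ)) =O[atTop] fun n : ℕ => (n : ℝ) ^ τ}
  · refine csInf_le hb ?_
    refine IsBigO.of_bound 2 (Eventually.of_forall fun n => ?_)
    have := MM_le R n
    rw [Real.norm_of_nonneg (by positivity), Real.norm_of_nonneg (by positivity)]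
    rw [show ((3 : ℝ)) = ((3 : ℕ) : ℝ) by norm_num, Real.rpow_natCast]
    exact_mod_cast this
  -- The infimum of a set that is not bounded below is `0` by convention, which the assumption `2 <
  -- ω` excludes.
  · rw [matMulExponent, Real.sInf_of_not_bddBelow hb] at h
    norm_num at h

end

end FineGrained

namespace FineGrained

/-! ### Asymptotics -/

theorem natCast_rpow_isBigO {x y : ℝ} (h : x ≤ y) :
    (fun n : ℕ => (n : ℝ) ^ x) =O[atTop] fun n : ℕ => (n : ℝ) ^ y := by
  refine IsBigO.of_bound 1 ?_
  filter_upwards [eventually_ge_atTop 1] with n hn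
  rw [Real.norm_of_nonneg (by positivity), Real.norm_of_nonneg (by positivity), one_mul]
  exact Real.rpow_le_rpow_of_exponent_le (by exact_mod_cast hn) h

theorem natCast_rpow_mul_isBigO {x y z : ℝ} (h : x + y ≤ z) :
    (fun n : ℕ => (n : ℝ) ^ x * (n : ℝ) ^ y) =O[atTop] fun n : ℕ => (n : ℝ) ^ z := by
  refine IsBigO.congr' (natCast_rpow_isBigO h) ?_ EventuallyEq.rfl
  filter_upwards [eventually_ge_atTop 1] with n hn
  rw [Real.rpow_add (by exact_mod_cast hn)]

theorem const_isBigO_natCast_rpow (C : ℝ) {x : ℝ} (h : 0 ≤ x) :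
    (fun _ : ℕ => C) =O[atTop] fun n : ℕ => (n : ℝ) ^ x := by
  have h1 := natCast_rpow_isBigO h
  simp only [Real.rpow_zero] at h1
  exact (isBigO_const_const C one_ne_zero atTop).trans h1

theorem threshold_le_rpow {q a n₀ n : ℕ} (hq : q ≠ 0) (hn : n₀ ≤ n) :
    (threshold q a n₀ n : ℝ) ≤ (n : ℝ) ^ ((a : ℝ) / q) := by
  rw [threshold, if_neg (by omega), Nat.cast_pow, div_eq_inv_mul,
    Real.rpow_mul_natCast (by positivity)]
  refine pow_le_pow_left₀ (by positivity) ?_ a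
  refine le_of_pow_le_pow_left₀ hq (by positivity) ?_
  rw [Real.rpow_inv_natCast_pow (by positivity) hq]
  exact_mod_cast iroot_pow_le hq n

/-- The integer root is at least `1`, so rounding down loses at most a factor `2`, and its `a`-th
power at most `2 ^ a`. -/
theorem rpow_le_threshold {q a n₀ n : ℕ} (hq : q ≠ 0) (hn : n₀ ≤ n) (h1 : 1 ≤ n) :
    (n : ℝ) ^ ((a : ℝ) / q) ≤ 2 ^ a * threshold q a n₀ n := by
  rw [threshold, if_neg (by omega), Nat.cast_pow, div_eq_inv_mul,
    Real.rpow_mul_natCast (by positivity), ← mul_pow]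
  refine pow_le_pow_left₀ (by positivity) ?_ a
  have hpos : 1 ≤ iroot q n := by
    by_contra h0
    have h2 := lt_iroot_succ_pow hq n
    rw [show iroot q n = 0 by omega] at h2
    simp at h2; omega
  refine le_of_pow_le_pow_left₀ hq (by positivity) ?_
  rw [Real.rpow_inv_natCast_pow (by positivity) hq]
  have h3 : n ≤ (2 * iroot q n) ^ q :=
    (lt_iroot_succ_pow hq n).le.trans (Nat.pow_le_pow_left (by omega) q)
  exact_mod_cast h3

/-- The gap between `a / q` and `α` beats any constant once `n` is large. For `n < n₀` the threshold
is `n`, no node has a higher degree, and the bins are empty, so the arbitrary constant `c` causes no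
trouble for small `n`. -/
theorem exists_capacity {c α : ℝ} (hc : 0 < c) (hα : 0 < α) {q a : ℕ} (hq : q ≠ 0)
    (hr : (a : ℝ) / q < α) :
    ∃ n₀ : ℕ, ∀ n e : ℕ, e ≤ threshold q a n₀ n * n + n → (e ≠ 0 → threshold q a n₀ n < n) →
      ((e + e : ℕ) : ℝ) ≤ c * ((3 * n : ℕ) : ℝ) ^ (α + 1) := by
  have h1 : Tendsto (fun n : ℕ => (n : ℝ) ^ (α - (a : ℝ) / q)) atTop atTop :=
    (tendsto_rpow_atTop (by linarith)).comp tendsto_natCast_atTop_atTop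
  -- One factor `2` of the `4` comes from the two lists, the other from bounding `Δn + n` by `2 n ^
  -- (a / q) n`.
  obtain ⟨n₀, hn₀⟩ := eventually_atTop.1
    ((h1.eventually_ge_atTop (4 / c)).and (eventually_ge_atTop 1))
  refine ⟨n₀, fun n e he he' => ?_⟩
  rcases Nat.eq_zero_or_pos e with rfl | hpos
  · simp only [add_zero, Nat.cast_zero]; positivity
  have hn : n₀ ≤ n := by
    by_contra h
    have := he' hpos.ne'
    rw [threshold, if_pos (by omega)] at this
    omega
  obtain ⟨h2, h3⟩ := hn₀ n hn
  have hn1 : (1 : ℝ) ≤ n := by exact_mod_cast h3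
  have hn0 : (0 : ℝ) < n := by linarith
  have h4 := threshold_le_rpow (a := a) hq hn
  have h5 : (1 : ℝ) ≤ (n : ℝ) ^ ((a : ℝ) / q) := Real.one_le_rpow hn1 (by positivity)
  have h6 : (e : ℝ) ≤ threshold q a n₀ n * n + n := by exact_mod_cast he
  rw [div_le_iff₀ hc] at h2
  calc ((e + e : ℕ) : ℝ) ≤ 2 * (((n : ℝ) ^ ((a : ℝ) / q)) * n + (n : ℝ) ^ ((a : ℝ) / q) * n) := by
        push_cast; nlinarith
    _ = 4 * (n : ℝ) ^ ((a : ℝ) / q) * n := by ring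
    _ ≤ ((n : ℝ) ^ (α - (a : ℝ) / q) * c) * (n : ℝ) ^ ((a : ℝ) / q) * n := by gcongr
    _ = c * ((n : ℝ) ^ (α - (a : ℝ) / q) * (n : ℝ) ^ ((a : ℝ) / q) * n) := by ring
    _ = c * (n : ℝ) ^ (α + 1) := by
        rw [← Real.rpow_add hn0, sub_add_cancel, Real.rpow_add_one hn0.ne']
    _ ≤ _ := by
        gcongr
        omega

theorem isBigO_comp_three_mul {T : ℕ → ℕ} {x : ℝ}
    (hT : (fun n => (T n : ℝ)) =O[atTop] fun n : ℕ => (n : ℝ) ^ x) :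
    (fun n => (T (3 * n) : ℝ)) =O[atTop] fun n : ℕ => (n : ℝ) ^ x := by
  have h1 : Tendsto (fun n : ℕ => 3 * n) atTop atTop :=
    tendsto_atTop_mono (fun n => Nat.le_mul_of_pos_left n (by omega)) tendsto_id
  refine (hT.comp_tendsto h1).trans ?_
  refine IsBigO.of_bound ((3 : ℝ) ^ x) (Eventually.of_forall fun n => ?_)
  simp only [Function.comp_apply]
  push_cast
  rw [Real.mul_rpow (by norm_num) (by positivity), norm_mul,
    Real.norm_of_nonneg (by positivity : (0 : ℝ) ≤ (3 : ℝ) ^ x)]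

/-- The low-degree phase takes `Δn²`, of exponent `a / q + 2`. There are `O(n ^ (1 - a / q))` bins,
each costing one product and a scan of a table of size `O(n²)`; the assumption `2 ≤ x` lets the
product dominate the scan. -/
theorem reductionTime_isBigO {q a n₀ : ℕ} (hq : q ≠ 0) {T : ℕ → ℕ} {x E : ℝ} (hx : 2 ≤ x)
    (hT : (fun n => (T n : ℝ)) =O[atTop] fun n : ℕ => (n : ℝ) ^ x)
    (hr : (a : ℝ) / q ≤ 1) (h1 : (a : ℝ) / q + 2 ≤ E) (h2 : 1 - (a : ℝ) / q + x ≤ E) (K : ℕ) :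
    (fun n => (reductionTime K q a n₀ T n : ℝ)) =O[atTop] fun n : ℕ => (n : ℝ) ^ E := by
  have hr0 : 0 ≤ (a : ℝ) / q := by positivity
  have hE : 0 ≤ E := by linarith
  have hsq : (fun n : ℕ => (n : ℝ) * n) = fun n : ℕ => (n : ℝ) ^ (2 : ℝ) := by
    ext n; rw [Real.rpow_two, sq]
  have hΔ : (fun n : ℕ => (threshold q a n₀ n : ℝ)) =O[atTop]
      fun n : ℕ => (n : ℝ) ^ ((a : ℝ) / q) := by
    refine IsBigO.of_bound 1 ?_
    filter_upwards [eventually_ge_atTop n₀] with n hn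
    rw [Real.norm_of_nonneg (by positivity), Real.norm_of_nonneg (by positivity), one_mul]
    exact threshold_le_rpow hq hn
  have hA : (fun n : ℕ => (threshold q a n₀ n : ℝ) * ((n : ℝ) * n)) =O[atTop]
      fun n : ℕ => (n : ℝ) ^ E := by
    rw [funext_iff] at hsq
    simp only [hsq]
    exact (hΔ.mul (isBigO_refl _ _)).trans (natCast_rpow_mul_isBigO h1)
  have hB : (fun n : ℕ => ((2 * n / threshold q a n₀ n + 1 : ℕ) : ℝ)) =O[atTop]
      fun n : ℕ => (n : ℝ) ^ (1 - (a : ℝ) / q) := by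
    refine IsBigO.of_bound (2 * 2 ^ a + 1) ?_
    filter_upwards [eventually_ge_atTop n₀, eventually_ge_atTop 1] with n hn hn1
    have hn1' : (1 : ℝ) ≤ n := by exact_mod_cast hn1
    have hn0 : (0 : ℝ) < n := by linarith
    rw [Real.norm_of_nonneg (by positivity), Real.norm_of_nonneg (by positivity)]
    have hs := rpow_le_threshold (a := a) hq hn hn1
    have hsp : (0 : ℝ) < (n : ℝ) ^ ((a : ℝ) / q) := by positivity
    have htp : (0 : ℝ) < threshold q a n₀ n := by
      by_contra h
      have : (2 : ℝ) ^ a * threshold q a n₀ n ≤ 0 :=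
        mul_nonpos_of_nonneg_of_nonpos (by positivity) (not_lt.1 h)
      linarith
    have h3 : (1 : ℝ) ≤ (n : ℝ) ^ (1 - (a : ℝ) / q) := Real.one_le_rpow hn1' (by linarith)
    have h4 : ((2 * n / threshold q a n₀ n : ℕ) : ℝ) ≤ 2 * 2 ^ a * (n : ℝ) ^ (1 - (a : ℝ) / q) := by
      refine Nat.cast_div_le.trans ?_
      rw [div_le_iff₀ htp, Real.rpow_sub hn0, Real.rpow_one]
      push_cast
      calc (2 : ℝ) * n = 2 * (n / (n : ℝ) ^ ((a : ℝ) / q)) * (n : ℝ) ^ ((a : ℝ) / q) := by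
            field_simp
        _ ≤ 2 * (n / (n : ℝ) ^ ((a : ℝ) / q)) * (2 ^ a * threshold q a n₀ n) := by gcongr
        _ = _ := by ring
    push_cast at h4 ⊢
    linarith
  have hC : (fun n : ℕ => (T (3 * n) : ℝ) + (n : ℝ) * n) =O[atTop] fun n : ℕ => (n : ℝ) ^ x := by
    refine (isBigO_comp_three_mul hT).add ?_
    rw [hsq]
    exact natCast_rpow_isBigO hx
  have hD := (hB.mul hC).trans (natCast_rpow_mul_isBigO h2)
  have hF := (const_isBigO_natCast_rpow 19 hE).add (((const_isBigO_natCast_rpow 2 hE).add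
    ((hA.add hD).const_mul_left 200)).const_mul_left (K : ℝ))
  refine hF.congr_left fun n => ?_
  simp only [reductionTime]
  push_cast
  ring

theorem exists_ratio_between {x y : ℝ} (hx : 0 ≤ x) (hxy : x < y) :
    ∃ a q : ℕ, q ≠ 0 ∧ x < (a : ℝ) / q ∧ (a : ℝ) / q < y := by
  obtain ⟨r, h1, h2⟩ := exists_rat_btwn hxy
  have hr : 0 ≤ r := by
    have : (0 : ℝ) ≤ r := hx.trans h1.le
    exact_mod_cast this
  have h3 : ((r.num.toNat : ℝ)) / r.den = r := by
    have h4 : ((r.num.toNat : ℤ) : ℝ) = (r.num : ℝ) := by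
      rw [Int.toNat_of_nonneg (Rat.num_nonneg.2 hr)]
    rw [Int.cast_natCast] at h4
    rw [h4]
    exact (Rat.cast_def r).symm
  exact ⟨r.num.toNat, r.den, r.den_nz, by rwa [h3], by rwa [h3]⟩

/-- A fast algorithm for sparse Boolean products gives a fast algorithm for monochromatic
triangles. -/
theorem monoAllEdgesTriangle_of_sparseBMM {ω c ε : ℝ} (hω : 2 < ω) (hω' : ω ≤ 3) (hc : 0 < c)
    (hε : 0 < ε)
    (h : (sparseBMM c ((1 + ω) / 2)).SolvableInTime fun n => (n : ℝ) ^ (ω - ε)) :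
    ∃ δ : ℝ, 0 < δ ∧
      monoAllEdgesTriangle.SolvableInTime fun n => (n : ℝ) ^ ((3 + ω) / 2 - δ) := by
  obtain ⟨p, k, T, hT, hA⟩ := h
  -- Capping the saving at `ω - 2` keeps the time for a product at least quadratic.
  set η := min ε (ω - 2) with hη
  have hη0 : 0 < η := lt_min hε (by linarith)
  have hη1 : η ≤ ε := min_le_left _ _
  have hη2 : η ≤ ω - 2 := min_le_right _ _
  have hT' := hT.trans (natCast_rpow_isBigO (show ω - ε ≤ ω - η by linarith))
  -- With `a / q` at most `(ω - 1) / 2 - η / 3` the low-degree phase saves `η / 3`. With `a / q` at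
  -- least `(ω - 1) / 2 - 2η / 3` the bins lose at most `2η / 3` of the `η` saved by the products.
  -- The lower end is nonnegative since it is at least `(5 - ω) / 6`.
  obtain ⟨a, q, hq, hlo, hhi⟩ := exists_ratio_between
    (x := (ω - 1) / 2 - 2 * (η / 3)) (y := (ω - 1) / 2 - η / 3) (by linarith) (by linarith)
  obtain ⟨n₀, hn₀⟩ := exists_capacity (α := (ω - 1) / 2) (a := a) hc (by linarith) hq (by linarith)
  rw [show (ω - 1) / 2 + 1 = (1 + ω) / 2 by ring] at hn₀
  obtain ⟨p', k', K, hred⟩ := exists_reduction hq hA hn₀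
  exact ⟨η / 3, by linarith, p', k', _, reductionTime_isBigO hq (by linarith) hT'
    (by linarith) (by linarith) (by linarith) K, hred⟩

end FineGrained

theorem mainTheorem12 (R : Type*) [CommRing R] [CharZero R]
    (hω : 2 < FineGrained.matMulExponent R)
    (hyp : FineGrained.MonoAllEdgesTriangleHypothesis (FineGrained.matMulExponent R)) :
    ∀ c : ℝ, 0 < c → ∀ ε : ℝ, 0 < ε →
      ¬ (FineGrained.sparseBMM c ((1 + FineGrained.matMulExponent R) / 2)).SolvableInTime
          (fun n => (n : ℝ) ^ (FineGrained.matMulExponent R - ε)) := by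
  intro c hc ε hε h
  obtain ⟨δ, hδ, hδ'⟩ := FineGrained.monoAllEdgesTriangle_of_sparseBMM hω
    (FineGrained.matMulExponent_le_three R hω) hc hε h
  exact hyp δ hδ hδ'
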